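/- \textbf{Setting.} Let $V,W$ be (real) Banach spaces, let $T>0$, and let $A$ be the generator of a strongly continuous semigroup $(S_t)_{t\ge 0}$ of continuous linear operators on $W$. For $n\in\{1,2\}$ the domain $D(A^n)$ is equipped with the graph norm $|y|_{D(A^n)}=|y|+\sum_{j=1}^n|A^jy|$. For Banach spaces $E,F$, $L(E,F)$ denotes the space of continuous linear operators with the operator norm. Let $V\otimes V$ be the completed projective tensor product, so that $L(V,L(V,E))\hookrightarrow L(V\otimes V,E)$ via $B(v\otimes w)=(Bv)w$ for every Banach space $E$. For a path $Z$ write $Z_{s,t}=Z_t-Z_s$, and for a one- or two-parameter function $Z$ on $[0,T]$ let $\|Z\|_\gamma=\sup_{s\ne t}|Z_{s,t}|/|t-s|^\gamma$. Let $\beta\in(\frac13,\frac12]$, and let $\mathbf X=(X,\mathbb X)$ be a $\beta$-H\"older rough path on $[0,T]$ over $V$: $X:[0,T]\to V$ and $\mathbb X:[0,T]^2\to V\otimes V$ satisfy $\|X\|_\beta<\infty$, $\|\mathbb X\|_{2\beta}<\infty$ and Chen's relation $\mathbb X_{s,t}-\mathbb X_{s,u}-\mathbb X_{u,t}=X_{s,u}\otimes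 X_{u,t}$ for all $s,u,t\in[0,T]$. For $T_0\in(0,T]$ and a Banach space $E$, $\mathscr D_X^{2\beta}([0,T_0],E)$ is the set of all pairs $(Y,Y')$ of $\beta$-H\"older continuous paths $Y:[0,T_0]\to E$, $Y':[0,T_0]\to L(V,E)$ such that the remainder $R^Y_{s,t}=Y_{s,t}-Y'_sX_{s,t}$ satisfies $\|R^Y\|_{2\beta}<\infty$ on $[0,T_0]$. For $(Y,Y')\in\mathscr D_X^{2\beta}([0,t],L(V,E))$ the rough integral is $\int_0^tY_s\,d\mathbf X_s=\lim_{|\Pi|\to0}\sum_{[u,v]\in\Pi}(Y_uX_{u,v}+Y'_u\mathbb X_{u,v})$, the limit being taken over partitions $\Pi$ of $[0,t]$ with mesh $|\Pi|$ tending to zero. Assume: (i) $f_0\in{\rm Lip}([0,T]\times W,D(A))$, that is, $f_0:[0,T]\times W\to D(A)$ is continuous and there is $L>0$ with $|f_0(t,y)-f_0(t,z)|_{D(A)}\le L|y-z|$ for all $t\in[0,T]$ and $y,z\in W$; (ii) $f\in C_b^{2\beta,3}([0,T]\times W,L(V,D(A^2)))$, that is, $f:[0,T]\times W\to L(V,D(A^2))$,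 each $f(t,\cdot)$ is three times continuously Fr\'echet differentiable, the derivatives $D_y^kf$, $0\le k\le3$, are bounded on $[0,T]\times W$, and $\sup_{y\in W}\|D_y^kf(\cdot,y)\|_{2\beta}<\infty$ for $0\le k\le2$. For $\xi\in D(A)$ and $T_0\in(0,T]$, a \emph{local mild solution} on $[0,T_0]$ of $$dY_t=(AY_t+f_0(t,Y_t))\,dt+f(t,Y_t)\,d\mathbf X_t,\qquad Y_0=\xi,$$ is a pair $(Y,Y')\in\mathscr D_X^{2\beta}([0,T_0],W)$ such that $Y'_t=f(t,Y_t)$ and $$Y_t=S_t\xi+\int_0^tS_{t-s}f_0(s,Y_s)\,ds+\int_0^tS_{t-s}f(s,Y_s)\,d\mathbf X_s\qquad\text{for all }t\in[0,T_0],$$ where the last term is the rough integral, taken in $W$, of the path $s\mapsto S_{t-s}f(s,Y_s)\in L(V,W)$ with Gubinelli derivative $s\mapsto S_{t-s}D_yf(s,Y_s)Y'_s\in L(V,L(V,W))$. \textbf{Theorem.} For every $\xi\in D(A)$ there exist $T_0\in(0,T]$ and a unique local mild solution $(Y,Y')\in\mathscr D_X^{2\beta}([0,T_0],W)$ on $[0,T_0]$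 of this equation with $Y_0=\xi$. -/

import Mathlib

noncomputable section

namespace RPDE

open Set Filter Topology
open scoped TensorProduct

/-! ### Strongly continuous semigroups, generators and their domains -/

/-- A strongly continuous semigroup `(S_t)_{t ≥ 0}` of continuous linear operators on `W`.
Only the values at times `t ≥ 0` carry information. -/
structure C0Semigroup (W : Type*) [NormedAddCommGroup W] [NormedSpace ℝ W] where
  op : ℝ → W →L[ℝ] W
  op_zero : op 0 = ContinuousLinearMap.id ℝ W
  op_add : ∀ s t : ℝ, 0 ≤ s → 0 ≤ t → op (s + t) = (op s).comp (op t)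
  tendsto_op : ∀ y : W, Tendsto (fun t => op t y) (𝓝[>] 0) (𝓝 y)

namespace C0Semigroup

variable {W : Type*} [NormedAddCommGroup W] [NormedSpace ℝ W]

/-- `z = lim_{h ↓ 0} (S_h y - y) / h`. -/
def HasGen (S : C0Semigroup W) (y z : W) : Prop :=
  Tendsto (fun h : ℝ => h⁻¹ • (S.op h y - y)) (𝓝[>] 0) (𝓝 z)

/-- The generator `A y = lim_{h ↓ 0} (S_h y - y) / h`
(an arbitrary value if the limit does not exist, that is, outside the domain `D(A)`). -/
def gen (S : C0Semigroup W) (y : W) : W :=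
  haveI : Nonempty W := ⟨0⟩
  limUnder (𝓝[>] (0 : ℝ)) fun h : ℝ => h⁻¹ • (S.op h y - y)

/-- Membership in `D(A^n)`: `D(A^0) = W`, and `y ∈ D(A^(n+1))` if and only if
`y ∈ D(A^n)` and `A^n y ∈ D(A)`. -/
def InDom (S : C0Semigroup W) : ℕ → W → Prop
  | 0, _ => True
  | n + 1, y => InDom S n y ∧ ∃ z, S.HasGen (S.gen^[n] y) z

theorem HasGen.gen_eq {S : C0Semigroup W} {y z : W} (h : S.HasGen y z) : S.gen y = z :=
  Tendsto.limUnder_eq h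

theorem HasGen.add {S : C0Semigroup W} {y y' z z' : W} (h : S.HasGen y z)
    (h' : S.HasGen y' z') : S.HasGen (y + y') (z + z') := by
  refine (Tendsto.add h h').congr fun t => ?_
  rw [← smul_add, map_add]
  congr 1
  abel

theorem HasGen.smul {S : C0Semigroup W} {y z : W} (h : S.HasGen y z) (c : ℝ) :
    S.HasGen (c • y) (c • z) := by
  refine (Tendsto.const_smul h c).congr fun t => ?_
  rw [map_smul, ← smul_sub, smul_comm]

theorem hasGen_zero (S : C0Semigroup W) : S.HasGen 0 0 := by
  simp [HasGen]

theorem InDom.add_aux {S : C0Semigroup W} {n : ℕ} {x y : W} (hx : S.InDom n x)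
    (hy : S.InDom n y) :
    S.InDom n (x + y) ∧ S.gen^[n] (x + y) = S.gen^[n] x + S.gen^[n] y := by
  induction n with
  | zero => exact ⟨trivial, rfl⟩
  | succ n ih =>
    obtain ⟨hx, u, hu⟩ := hx
    obtain ⟨hy, v, hv⟩ := hy
    obtain ⟨h1, h2⟩ := ih hx hy
    have h3 : S.HasGen (S.gen^[n] (x + y)) (u + v) := by
      rw [h2]
      exact hu.add hv
    refine ⟨⟨h1, _, h3⟩, ?_⟩
    simp only [Function.iterate_succ_apply']
    rw [h3.gen_eq, hu.gen_eq, hv.gen_eq]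

theorem InDom.smul_aux {S : C0Semigroup W} {n : ℕ} {x : W} (c : ℝ) (hx : S.InDom n x) :
    S.InDom n (c • x) ∧ S.gen^[n] (c • x) = c • S.gen^[n] x := by
  induction n with
  | zero => exact ⟨trivial, rfl⟩
  | succ n ih =>
    obtain ⟨hx, u, hu⟩ := hx
    obtain ⟨h1, h2⟩ := ih hx
    have h3 : S.HasGen (S.gen^[n] (c • x)) (c • u) := by
      rw [h2]
      exact hu.smul c
    refine ⟨⟨h1, _, h3⟩, ?_⟩
    simp only [Function.iterate_succ_apply']
    rw [h3.gen_eq, hu.gen_eq]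

theorem InDom.of_le {S : C0Semigroup W} {m n : ℕ} (hmn : m ≤ n) {x : W} (hx : S.InDom n x) :
    S.InDom m x := by
  induction n, hmn using Nat.le_induction with
  | base => exact hx
  | succ n _ ih => exact ih hx.1

theorem inDom_zero (S : C0Semigroup W) (n : ℕ) :
    S.InDom n (0 : W) ∧ S.gen^[n] (0 : W) = 0 := by
  induction n with
  | zero => exact ⟨trivial, rfl⟩
  | succ n ih =>
    have h3 : S.HasGen (S.gen^[n] (0 : W)) 0 := by
      rw [ih.2]
      exact S.hasGen_zero
    refine ⟨⟨ih.1, _, h3⟩, ?_⟩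
    rw [Function.iterate_succ_apply', h3.gen_eq]

/-- The linear subspace `D(A^n)` of `W`. -/
def domain (S : C0Semigroup W) (n : ℕ) : Submodule ℝ W where
  carrier := {y | S.InDom n y}
  add_mem' hx hy := (InDom.add_aux hx hy).1
  zero_mem' := (S.inDom_zero n).1
  smul_mem' c _ hx := (InDom.smul_aux c hx).1

/-- The space `D(A^n)` as a type of its own. It carries the graph norm below, not the
norm inherited from `W`. -/
def Dom (S : C0Semigroup W) (n : ℕ) : Type _ := S.domain n

instance (S : C0Semigroup W) (n : ℕ) : AddCommGroup (S.Dom n) :=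
  inferInstanceAs (AddCommGroup (S.domain n))

instance (S : C0Semigroup W) (n : ℕ) : Module ℝ (S.Dom n) :=
  inferInstanceAs (Module ℝ (S.domain n))

/-- The inclusion `D(A^n) → W` as a linear map. -/
def inclₗ (S : C0Semigroup W) (n : ℕ) : S.Dom n →ₗ[ℝ] W := (S.domain n).subtype

/-- The graph norm `|y|_{D(A^n)} = |y| + |A y| + ⋯ + |A^n y|`. -/
instance (S : C0Semigroup W) (n : ℕ) : Norm (S.Dom n) :=
  ⟨fun y => ∑ j ∈ Finset.range (n + 1), ‖S.gen^[j] (S.inclₗ n y)‖⟩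

theorem norm_def (S : C0Semigroup W) (n : ℕ) (y : S.Dom n) :
    ‖y‖ = ∑ j ∈ Finset.range (n + 1), ‖S.gen^[j] (S.inclₗ n y)‖ := rfl

theorem inclₗ_inDom (S : C0Semigroup W) (n : ℕ) (y : S.Dom n) {j : ℕ}
    (hj : j ∈ Finset.range (n + 1)) : S.InDom j (S.inclₗ n y) := by
  have h : S.InDom n (S.inclₗ n y) := y.2
  exact h.of_le (Nat.lt_succ_iff.mp (Finset.mem_range.mp hj))

theorem norm_inclₗ_le (S : C0Semigroup W) (n : ℕ) (y : S.Dom n) : ‖S.inclₗ n y‖ ≤ ‖y‖ := by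
  rw [norm_def]
  exact Finset.single_le_sum (f := fun j => ‖S.gen^[j] (S.inclₗ n y)‖)
    (fun j _ => norm_nonneg _) (Finset.mem_range.mpr n.succ_pos)

theorem normedSpaceCore (S : C0Semigroup W) (n : ℕ) : NormedSpace.Core ℝ (S.Dom n) where
  norm_nonneg y := Finset.sum_nonneg fun j _ => norm_nonneg _
  norm_smul c y := by
    simp only [norm_def]
    rw [Finset.mul_sum]
    refine Finset.sum_congr rfl fun j hj => ?_
    rw [map_smul, (InDom.smul_aux c (S.inclₗ_inDom n y hj)).2, norm_smul]
  norm_triangle x y := by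
    simp only [norm_def]
    rw [← Finset.sum_add_distrib]
    refine Finset.sum_le_sum fun j hj => ?_
    rw [map_add, (InDom.add_aux (S.inclₗ_inDom n x hj) (S.inclₗ_inDom n y hj)).2]
    exact norm_add_le _ _
  norm_eq_zero_iff y := by
    constructor
    · intro h
      have h0 : ‖S.inclₗ n y‖ ≤ 0 := h ▸ S.norm_inclₗ_le n y
      exact (Submodule.subtype_injective (S.domain n))
        ((norm_le_zero_iff.mp h0).trans (map_zero (S.inclₗ n)).symm)
    · rintro rfl
      rw [norm_def]
      refine Finset.sum_eq_zero fun j _ => ?_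
      rw [map_zero, (S.inDom_zero j).2, norm_zero]

instance (S : C0Semigroup W) (n : ℕ) : NormedAddCommGroup (S.Dom n) :=
  NormedAddCommGroup.ofCore (S.normedSpaceCore n)

instance (S : C0Semigroup W) (n : ℕ) : NormedSpace ℝ (S.Dom n) :=
  NormedSpace.ofCore (S.normedSpaceCore n)

/-- The continuous inclusion `D(A^n) → W`. -/
def incl (S : C0Semigroup W) (n : ℕ) : S.Dom n →L[ℝ] W :=
  (S.inclₗ n).mkContinuous 1 fun y => by simpa using S.norm_inclₗ_le n y

end C0Semigroup

/-! ### The projective tensor product `V ⊗ V` -/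

section Tensor

variable (V : Type*) [NormedAddCommGroup V] [NormedSpace ℝ V]

/-- The Banach space `V ⊗ V`: the completion of the algebraic tensor product of two copies of
`V` with respect to the projective norm. -/
abbrev TensorSq : Type _ := UniformSpace.Completion (⨂[ℝ] _ : Fin 2, V)

variable {V}

/-- The elementary tensor `v ⊗ w`. -/
def tmul (v w : V) : TensorSq V :=
  ((PiTensorProduct.tprod ℝ ![v, w] : ⨂[ℝ] _ : Fin 2, V) : TensorSq V)

variable {W : Type*} [NormedAddCommGroup W] [NormedSpace ℝ W]

/-- The embedding `L(V, L(V, W)) → L(V ⊗ V, W)`; it is characterised by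
`tensorLift B (v ⊗ w) = B v w`. -/
def tensorLift [CompleteSpace W] (B : V →L[ℝ] V →L[ℝ] W) : TensorSq V →L[ℝ] W :=
  (PiTensorProduct.liftIsometry ℝ (fun _ : Fin 2 => V) W
    (ContinuousLinearMap.uncurryLeft
      (((continuousMultilinearCurryFin1 ℝ V W).symm.toContinuousLinearEquiv :
        (V →L[ℝ] W) →L[ℝ] _).comp B))).extend
    (UniformSpace.Completion.toComplL : (⨂[ℝ] _ : Fin 2, V) →L[ℝ] TensorSq V)

theorem tensorLift_tmul [CompleteSpace W] (B : V →L[ℝ] V →L[ℝ] W) (v w : V) :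
    tensorLift B (tmul v w) = B v w := by
  have h := ContinuousLinearMap.extend_eq
    (PiTensorProduct.liftIsometry ℝ (fun _ : Fin 2 => V) W
      (ContinuousLinearMap.uncurryLeft
        (((continuousMultilinearCurryFin1 ℝ V W).symm.toContinuousLinearEquiv :
          (V →L[ℝ] W) →L[ℝ] _).comp B)))
    (e := (UniformSpace.Completion.toComplL : (⨂[ℝ] _ : Fin 2, V) →L[ℝ] TensorSq V))
    UniformSpace.Completion.denseRange_coe
    (UniformSpace.Completion.isUniformInducing_coe _)
    (PiTensorProduct.tprod ℝ ![v, w])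
  refine h.trans ?_
  simp [PiTensorProduct.liftIsometry_apply_apply]

end Tensor

/-! ### Rough paths, controlled rough paths and the rough integral

Paths on `[0, T]` are represented by functions on `ℝ`; only their values on `[0, T]` matter. -/

section RoughPaths

variable {E : Type*} [NormedAddCommGroup E] [NormedSpace ℝ E]

/-- `sup_{s ≠ t ∈ [0,T]} |F_{s,t}| / |t - s|^γ < ∞` for a two-parameter function `F`. -/
def HolderTwo (T γ : ℝ) (F : ℝ → ℝ → E) : Prop :=
  ∃ C : ℝ, ∀ s ∈ Icc (0 : ℝ) T, ∀ t ∈ Icc (0 : ℝ) T, s ≠ t → ‖F s t‖ ≤ C * |t - s| ^ γ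

/-- `Y` is `γ`-Hölder continuous on `[0, T]`. -/
def HolderPath (T γ : ℝ) (Y : ℝ → E) : Prop :=
  HolderTwo T γ fun s t => Y t - Y s

variable {V : Type*} [NormedAddCommGroup V] [NormedSpace ℝ V]

/-- `(X, 𝕏)` is an `α`-Hölder rough path on `[0, T]` over `V`. -/
structure IsRoughPath (T α : ℝ) (X : ℝ → V) (XX : ℝ → ℝ → TensorSq V) : Prop where
  holder : HolderPath T α X
  holder_second : HolderTwo T (2 * α) XX
  /-- Chen's relation -/
  chen : ∀ s ∈ Icc (0 : ℝ) T, ∀ u ∈ Icc (0 : ℝ) T, ∀ t ∈ Icc (0 : ℝ) T,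
    XX s t - XX s u - XX u t = tmul (X u - X s) (X t - X u)

/-- `(Y, Y')` is a controlled rough path: it belongs to `𝒟_X^{2α}([0, T], E)`. -/
structure IsControlled (T α : ℝ) (X : ℝ → V) (Y : ℝ → E) (Y' : ℝ → V →L[ℝ] E) : Prop where
  holder : HolderPath T α Y
  holder_deriv : HolderPath T α Y'
  holder_remainder : HolderTwo T (2 * α) fun s t => Y t - Y s - Y' s (X t - X s)

/-- A partition `a = t_0 < t_1 < ⋯ < t_n = b` of `[a, b]`. -/
structure Partition (a b : ℝ) where
  n : ℕ
  pt : ℕ → ℝ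
  pt_zero : pt 0 = a
  pt_last : pt n = b
  pt_lt : ∀ i < n, pt i < pt (i + 1)

/-- `I` is the rough (Gubinelli) integral of `(Y, Y')` against `(X, 𝕏)` over `[a, b]`: the limit
of the compensated Riemann sums `∑ (Y_s X_{s,t} + Y'_s 𝕏_{s,t})` as the mesh tends to zero. -/
def HasRoughIntegral [CompleteSpace E] (X : ℝ → V) (XX : ℝ → ℝ → TensorSq V)
    (Y : ℝ → V →L[ℝ] E) (Y' : ℝ → V →L[ℝ] V →L[ℝ] E) (a b : ℝ) (I : E) : Prop :=
  ∀ ε > 0, ∃ δ > 0, ∀ π : Partition a b, (∀ i < π.n, π.pt (i + 1) - π.pt i < δ) →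
    ‖∑ i ∈ Finset.range π.n, (Y (π.pt i) (X (π.pt (i + 1)) - X (π.pt i)) +
      tensorLift (Y' (π.pt i)) (XX (π.pt i) (π.pt (i + 1)))) - I‖ < ε

end RoughPaths

/-! ### Coefficients and mild solutions -/

section Equation

variable {W : Type*} [NormedAddCommGroup W] [NormedSpace ℝ W]
variable {E : Type*} [NormedAddCommGroup E] [NormedSpace ℝ E]

/-- The class `Lip([0, T] × W, E)`: jointly continuous, and Lipschitz in the second variable
uniformly in time. -/
structure IsLip (T : ℝ) (f₀ : ℝ → W → E) : Prop where
  cont : ContinuousOn (fun p : ℝ × W => f₀ p.1 p.2) (Icc 0 T ×ˢ univ)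
  lip : ∃ L : ℝ, ∀ t ∈ Icc (0 : ℝ) T, ∀ y z : W, ‖f₀ t y - f₀ t z‖ ≤ L * ‖y - z‖

/-- The class `C_b^{γ,n}([0, T] × W, E)`: each `f(t, ·)` is `n` times continuously Fréchet
differentiable, the derivatives of orders `0, …, n` are bounded uniformly in `(t, y)`, and those
of orders `0, …, n - 1` are `γ`-Hölder continuous in `t`, uniformly in `y`. -/
structure IsCb (T γ : ℝ) (n : ℕ) (f : ℝ → W → E) : Prop where
  contDiff : ∀ t ∈ Icc (0 : ℝ) T, ContDiff ℝ n (f t)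
  bounded : ∃ C : ℝ, ∀ k ≤ n, ∀ t ∈ Icc (0 : ℝ) T, ∀ y : W, ‖iteratedFDeriv ℝ k (f t) y‖ ≤ C
  holder : ∃ C : ℝ, ∀ k < n, ∀ y : W, ∀ s ∈ Icc (0 : ℝ) T, ∀ t ∈ Icc (0 : ℝ) T,
    ‖iteratedFDeriv ℝ k (f t) y - iteratedFDeriv ℝ k (f s) y‖ ≤ C * |t - s| ^ γ

variable {V : Type*} [NormedAddCommGroup V] [NormedSpace ℝ V]

/-- `(Y, Y') ∈ 𝒟_X^{2α}([0, T₀], W)` is a mild solution on `[0, T₀]` of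
`dY_t = (A Y_t + f₀(t, Y_t)) dt + f(t, Y_t) d𝐗_t`, `Y_0 = ξ`: one has `Y' = f(Y)` and
`Y_t = S_t ξ + ∫_0^t S_{t-s} f₀(s, Y_s) ds + ∫_0^t S_{t-s} f(s, Y_s) d𝐗_s` for `t ∈ [0, T₀]`.
The last term is the rough integral in `W` of the path `s ↦ S_{t-s} f(s, Y_s)` with Gubinelli
derivative `s ↦ S_{t-s} f(Y)'_s`, where `f(Y)'_s = D_y f(s, Y_s) Y'_s`. -/
structure IsMildSolution [CompleteSpace W] (S : C0Semigroup W) (α : ℝ)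
    (X : ℝ → V) (XX : ℝ → ℝ → TensorSq V)
    (f₀ : ℝ → W → S.Dom 1) (f : ℝ → W → V →L[ℝ] S.Dom 2) (ξ : W) (T₀ : ℝ)
    (Y : ℝ → W) (Y' : ℝ → V →L[ℝ] W) : Prop where
  controlled : IsControlled T₀ α X Y Y'
  deriv_eq : ∀ t ∈ Icc (0 : ℝ) T₀, Y' t = (S.incl 2).comp (f t (Y t))
  mild : ∀ t ∈ Icc (0 : ℝ) T₀, ∃ I : W,
    HasRoughIntegral X XX
      (fun s => ((S.op (t - s)).comp (S.incl 2)).comp (f s (Y s)))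
      (fun s => (ContinuousLinearMap.compL ℝ V (S.Dom 2) W
        ((S.op (t - s)).comp (S.incl 2))).comp ((fderiv ℝ (f s) (Y s)).comp (Y' s)))
      0 t I ∧
    Y t = S.op t ξ + (∫ s in (0 : ℝ)..t, S.op (t - s) (S.incl 1 (f₀ s (Y s)))) + I

end Equation

end RPDE

end

/-!
Mild solutions are the fixed points of the map that sends a controlled path `(Y, Y')` to
`S_t ξ + ∫_0^t S_{t-s} f₀(s, Y_s) ds + ∫_0^t S_{t-s} f(s, Y_s) d𝐗_s`, with Gubinelli derivative
`f(t, Y_t)` (`IsPicard`, `isMildSolution_iff`). The point of the argument is that this map contracts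
the seminorm of controlled paths on short intervals.

*Rough integral.* By Chen's relation the germ `h_u X_{u,v} + h'_u 𝕏_{u,v}` of a controlled path is
additive up to an error of order `3β > 1`. The sewing lemma (`AlmostAdditive.exists_path`) provides
a path whose increments are close to the germ, and these increments are the limits of the
compensated Riemann sums (`hasRoughIntegral_of_germ`).

*Convolution.* The convolution `I_t = ∫_0^t S_{t-r} g_r d𝐗_r` is not an increment of one integral,
since the integrand depends on `t`. In `I_t - I_s` the part over `[s, t]` is `g_s X_{s,t}` up to
order `2β`, and the part over `[0, s]` is an integral with the kernel `S_{t-r} - S_{s-r}`. As a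
family of operators from `D(A²)` to `W`, this kernel is bounded and Lipschitz in `r` with constants
of order `t - s` (`C0Semigroup.kernelBound_kernel_sub`); `t - s ≤ (t - s)^(2β)` because `β ≤ 1/2`
and all times are at most `1`. Hence the convolution is controlled by `X` with derivative `g`
(`exists_rough_convolution`). No regularity in space is lost, and no singular weights are needed.

*Contraction.* Let two controlled paths agree on `[0, a]`, and let `D` be the seminorm of their
difference on `[a, b]`. The difference and its derivative are of size `(b - a)^β D` there, since
they vanish at `a`. Composition with `f` preserves both sizes (`CoeffBound.ctrlPath_sub`); this is
where three derivatives of `f` in space are used, and only mean value estimates enter. In the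
convolution, the sup norms of the integrand enter as they are and its Hölder seminorms with a
factor `(b - a)^β`. The images therefore differ by at most `c (b - a)^β D`
(`EquationBound.ctrlBound_picard_sub`), with `c` depending on an a priori bound `N` of the two
paths.

*Conclusion.* For existence, the Picard iterates starting from `ξ + f(0, ξ) X_{0,t}` stay bounded
and converge on a short interval (`EquationBound.exists_fixedPoint`). For uniqueness, two solutions
on the same interval have a common bound `N`, and the contraction estimate on successive windows
`[a, b]` shows that they agree (`EquationBound.picard_unique`).
-/

noncomputable section

namespace RPDE

open Set Filter Topology
open scoped TensorProduct

/-! ### The sewing lemma -/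

section Sewing

variable {W : Type*} [NormedAddCommGroup W]

/-- The two-parameter germ `Ξ` is almost additive on `[a, b]`: its defect of additivity at
`s ≤ u ≤ t` is at most `C (t - s)^θ`. -/
def AlmostAdditive (a b θ C : ℝ) (Ξ : ℝ → ℝ → W) : Prop :=
  ∀ s u t : ℝ, a ≤ s → s ≤ u → u ≤ t → t ≤ b → ‖Ξ s t - Ξ s u - Ξ u t‖ ≤ C * (t - s) ^ θ

theorem AlmostAdditive.diag {a b θ C : ℝ} {Ξ : ℝ → ℝ → W} (h : AlmostAdditive a b θ C Ξ)
    (hθ : 1 < θ) {u : ℝ} (ha : a ≤ u) (hb : u ≤ b) : Ξ u u = 0 := by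
  have := h u u u ha le_rfl le_rfl hb
  rw [sub_self u, Real.zero_rpow (by linarith), mul_zero, sub_self, zero_sub, norm_neg] at this
  exact norm_le_zero_iff.mp this

/-- The constant of the sewing lemma: the solution `K` of `2^(1-θ) K + 2 = K`. -/
def sewConst (θ : ℝ) : ℝ := 2 / (1 - 2 ^ (1 - θ))

theorem two_rpow_lt_one {θ : ℝ} (hθ : 1 < θ) : (2 : ℝ) ^ (1 - θ) < 1 :=
  Real.rpow_lt_one_of_one_lt_of_neg (by norm_num) (by linarith)

theorem sewConst_pos {θ : ℝ} (hθ : 1 < θ) : 0 < sewConst θ := by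
  have := two_rpow_lt_one hθ
  unfold sewConst
  exact div_pos two_pos (by linarith)

theorem sewConst_eq {θ : ℝ} (hθ : 1 < θ) : (2 : ℝ) ^ (1 - θ) * sewConst θ + 2 = sewConst θ := by
  have := two_rpow_lt_one hθ
  have h : (1 - (2 : ℝ) ^ (1 - θ)) ≠ 0 := by linarith
  unfold sewConst
  field_simp
  ring

/-- Riemann sums of an almost additive germ stay close to the germ, uniformly in the number of
points: the interval around the midpoint is split off, and the two remaining sums run over
intervals of at most half the length. -/
theorem AlmostAdditive.norm_sum_sub_le {a b θ C : ℝ} {Ξ : ℝ → ℝ → W}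
    (h : AlmostAdditive a b θ C Ξ) (hθ : 1 < θ) (hC : 0 ≤ C) {p : ℕ → ℝ} (hp : Monotone p)
    (m : ℕ) : ∀ i, a ≤ p i → p (i + m) ≤ b →
      ‖∑ k ∈ Finset.range m, Ξ (p (i + k)) (p (i + k + 1)) - Ξ (p i) (p (i + m))‖
        ≤ sewConst θ * C * (p (i + m) - p i) ^ θ := by
  induction m using Nat.strong_induction_on with
  | _ m ih =>
    intro i ha hb
    have hK := sewConst_pos hθ
    rcases Nat.eq_zero_or_pos m with rfl | hm
    · simp [h.diag hθ ha hb, Real.zero_rpow (by linarith : θ ≠ 0)]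
    have hpi : p i ≤ p (i + m) := hp (by omega)
    -- `[p (i + j), p (i + j + 1)]` contains the midpoint
    obtain ⟨j, hjm, hj1, hj2⟩ : ∃ j < m, p (i + j) ≤ (p i + p (i + m)) / 2 ∧
        (p i + p (i + m)) / 2 ≤ p (i + j + 1) := by
      by_contra! hcon
      have key : ∀ j ≤ m, p (i + j) ≤ (p i + p (i + m)) / 2 ∧
          (j = m → p (i + j) < (p i + p (i + m)) / 2) := by
        intro j
        induction j with
        | zero => exact fun _ => ⟨by simp; linarith, by omega⟩
        | succ j ihj =>
          intro hj
          have := hcon j (by omega) (ihj (by omega)).1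
          rw [← add_assoc]
          exact ⟨this.le, fun _ => this⟩
      have := (key m le_rfl).2 rfl
      linarith
    obtain ⟨l, rfl⟩ : ∃ l, m = j + 1 + l := ⟨m - (j + 1), by omega⟩
    have e1 : i + (j + 1 + l) = i + j + 1 + l := by omega
    rw [e1] at hb hpi hj1 hj2 ⊢
    have L := ih j (by omega) i ha ((hp (by omega)).trans hb)
    have R := ih l (by omega) (i + j + 1) (ha.trans (hp (by omega))) hb
    rw [Finset.sum_range_add, Finset.sum_range_succ]
    simp only [← add_assoc] at R ⊢
    set q := p (i + j + 1 + l)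
    have m1 : p i ≤ p (i + j) := hp (by omega)
    have m2 : p (i + j) ≤ p (i + j + 1) := hp (by omega)
    have m3 : p (i + j + 1) ≤ q := hp (by omega)
    have d1 := h (p i) (p (i + j)) q ha m1 (m2.trans m3) hb
    have d2 := h (p (i + j)) (p (i + j + 1)) q (ha.trans m1) m2 m3 hb
    have hlen : 0 ≤ q - p i := by linarith
    have hhalf : ∀ x, 0 ≤ x → x ≤ (q - p i) / 2 → x ^ θ ≤ (q - p i) ^ θ * 2 ^ (-θ) := by
      intro x hx hx2
      calc x ^ θ ≤ ((q - p i) / 2) ^ θ := Real.rpow_le_rpow hx hx2 (by linarith)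
        _ = _ := by
          rw [div_eq_mul_inv, Real.mul_rpow hlen (by norm_num), Real.inv_rpow (by norm_num),
            Real.rpow_neg (by norm_num)]
    have h1 := hhalf (p (i + j) - p i) (by linarith) (by linarith)
    have h2 := hhalf (q - p (i + j + 1)) (by linarith) (by linarith)
    have h3 : (q - p (i + j)) ^ θ ≤ (q - p i) ^ θ :=
      Real.rpow_le_rpow (by linarith) (by linarith) (by linarith)
    have hsplit : (2 : ℝ) ^ (1 - θ) = 2 * 2 ^ (-θ) := by
      rw [sub_eq_add_neg, Real.rpow_add (by norm_num), Real.rpow_one]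
    have hKe := sewConst_eq hθ
    rw [hsplit] at hKe
    have hKC : 0 ≤ sewConst θ * C := mul_nonneg hK.le hC
    set A := ∑ k ∈ Finset.range j, Ξ (p (i + k)) (p (i + k + 1))
    set B := ∑ k ∈ Finset.range l, Ξ (p (i + j + 1 + k)) (p (i + j + 1 + k + 1))
    calc ‖A + Ξ (p (i + j)) (p (i + j + 1)) + B - Ξ (p i) q‖
        = ‖(A - Ξ (p i) (p (i + j))) + (B - Ξ (p (i + j + 1)) q)
            - (Ξ (p i) q - Ξ (p i) (p (i + j)) - Ξ (p (i + j)) q)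
            - (Ξ (p (i + j)) q - Ξ (p (i + j)) (p (i + j + 1)) - Ξ (p (i + j + 1)) q)‖ := by
          congr 1; abel
      _ ≤ ‖A - Ξ (p i) (p (i + j))‖ + ‖B - Ξ (p (i + j + 1)) q‖
            + ‖Ξ (p i) q - Ξ (p i) (p (i + j)) - Ξ (p (i + j)) q‖
            + ‖Ξ (p (i + j)) q - Ξ (p (i + j)) (p (i + j + 1)) - Ξ (p (i + j + 1)) q‖ :=
          (norm_sub_le _ _).trans (add_le_add_left ((norm_sub_le _ _).trans
            (add_le_add_left (norm_add_le _ _) _)) _)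
      _ ≤ sewConst θ * C * ((q - p i) ^ θ * 2 ^ (-θ)) + sewConst θ * C * ((q - p i) ^ θ * 2 ^ (-θ))
            + C * (q - p i) ^ θ + C * (q - p i) ^ θ := by
          gcongr
          · exact L.trans (by gcongr)
          · exact R.trans (by gcongr)
          · exact d2.trans (by gcongr)
      _ = (2 * 2 ^ (-θ) * sewConst θ + 2) * C * (q - p i) ^ θ := by ring
      _ = _ := by rw [hKe]

theorem sum_range_two_mul {M : Type*} [AddCommMonoid M] (g : ℕ → M) (m : ℕ) :
    ∑ k ∈ Finset.range (2 * m), g k = ∑ k ∈ Finset.range m, (g (2 * k) + g (2 * k + 1)) := by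
  induction m with
  | zero => simp
  | succ m ih =>
    rw [Finset.sum_range_succ, ← ih, mul_add, mul_one, Finset.sum_range_succ,
      Finset.sum_range_succ, add_assoc]

/-- The dyadic grid of level `n` on `[a, b]`. -/
def dyadic (a b : ℝ) (n k : ℕ) : ℝ := a + k * ((b - a) / 2 ^ n)

/-- The Riemann sum of the germ `Ξ` over the part of the dyadic grid to the left of `t`. -/
def dyadicSum (a b : ℝ) (Ξ : ℝ → ℝ → W) (n : ℕ) (t : ℝ) : W :=
  ∑ k ∈ Finset.range (2 ^ n), Ξ (min (dyadic a b n k) t) (min (dyadic a b n (k + 1)) t)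

theorem dyadic_mono {a b : ℝ} (hab : a ≤ b) (n : ℕ) : Monotone (dyadic a b n) := by
  intro i j hij
  unfold dyadic
  have : 0 ≤ (b - a) / 2 ^ n := div_nonneg (by linarith) (by positivity)
  have h : (i : ℝ) ≤ j := by exact_mod_cast hij
  gcongr

theorem le_dyadic {a b : ℝ} (hab : a ≤ b) (n k : ℕ) : a ≤ dyadic a b n k :=
  le_add_of_nonneg_right (mul_nonneg k.cast_nonneg (div_nonneg (by linarith) (by positivity)))

theorem dyadic_zero (a b : ℝ) (n : ℕ) : dyadic a b n 0 = a := by simp [dyadic]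

theorem dyadic_last (a b : ℝ) (n : ℕ) : dyadic a b n (2 ^ n) = b := by
  simp only [dyadic]; push_cast; field_simp; ring

theorem dyadic_succ_sub (a b : ℝ) (n k : ℕ) :
    dyadic a b n (k + 1) - dyadic a b n k = (b - a) / 2 ^ n := by
  simp only [dyadic]; push_cast; ring

theorem dyadic_succ_two_mul (a b : ℝ) (n k : ℕ) :
    dyadic a b (n + 1) (2 * k) = dyadic a b n k := by
  simp only [dyadic]; push_cast; rw [pow_succ]; field_simp

theorem min_sub_min_le {x y : ℝ} (hxy : x ≤ y) (t : ℝ) : min y t - min x t ≤ y - x := by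
  rcases min_cases y t with ⟨h, _⟩ | ⟨h, _⟩ <;> rcases min_cases x t with ⟨h', _⟩ | ⟨h', _⟩ <;>
    rw [h, h'] <;> linarith

theorem dyadic_error {a b θ : ℝ} (hab : a ≤ b) (C : ℝ) (n : ℕ) :
    (2 ^ n : ℝ) * (C * ((b - a) / 2 ^ n) ^ θ) = C * (b - a) ^ θ * (2 ^ (1 - θ)) ^ n := by
  have e : ((2 : ℝ) ^ (1 - θ)) ^ n = 2 ^ n / (2 ^ n) ^ θ := by
    rw [← Real.rpow_natCast, ← Real.rpow_mul (by norm_num), ← Real.rpow_natCast 2 n,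
      ← Real.rpow_mul (by norm_num), ← Real.rpow_sub (by norm_num)]
    ring_nf
  rw [Real.div_rpow (by linarith) (by positivity), e]
  ring

theorem AlmostAdditive.norm_dyadicSum_succ_sub_le {a b θ C : ℝ} {Ξ : ℝ → ℝ → W}
    (h : AlmostAdditive a b θ C Ξ) (hθ : 1 < θ) (hC : 0 ≤ C) (hab : a ≤ b) {t : ℝ}
    (hat : a ≤ t) (htb : t ≤ b) (n : ℕ) :
    ‖dyadicSum a b Ξ (n + 1) t - dyadicSum a b Ξ n t‖
      ≤ C * (b - a) ^ θ * (2 ^ (1 - θ)) ^ n := by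
  rw [← dyadic_error hab]
  have hm := dyadic_mono hab (n + 1)
  unfold dyadicSum
  rw [pow_succ', sum_range_two_mul, ← Finset.sum_sub_distrib]
  refine (norm_sum_le_of_le (f := _) (n := fun _ => C * ((b - a) / 2 ^ n) ^ θ) _ ?_).trans
    (by simp)
  intro k hk
  have e : 2 * k + 1 + 1 = 2 * (k + 1) := by ring
  rw [e, dyadic_succ_two_mul, dyadic_succ_two_mul]
  have h1 : dyadic a b n k ≤ dyadic a b (n + 1) (2 * k + 1) := by
    rw [← dyadic_succ_two_mul]; exact hm (Nat.le_succ _)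
  have h2 : dyadic a b (n + 1) (2 * k + 1) ≤ dyadic a b n (k + 1) := by
    rw [← dyadic_succ_two_mul a b n]; exact hm (by omega)
  have h0 : a ≤ dyadic a b n k := le_dyadic hab n k
  have := h _ _ _ (le_min h0 hat) (min_le_min_right t h1) (min_le_min_right t h2)
    ((min_le_right _ _).trans htb)
  rw [norm_sub_rev, ← sub_sub]
  refine this.trans ?_
  have hl : 0 ≤ min (dyadic a b n (k + 1)) t - min (dyadic a b n k) t :=
    sub_nonneg.mpr (min_le_min_right t (h1.trans h2))
  gcongr
  rw [← dyadic_succ_sub a b n k]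
  exact min_sub_min_le (h1.trans h2) t

theorem AlmostAdditive.norm_dyadicSum_sub_sub_le {a b θ C : ℝ} {Ξ : ℝ → ℝ → W}
    (h : AlmostAdditive a b θ C Ξ) (hθ : 1 < θ) (hC : 0 ≤ C) {s t : ℝ}
    (has : a ≤ s) (hst : s ≤ t) (htb : t ≤ b) (n : ℕ) :
    ‖dyadicSum a b Ξ n t - dyadicSum a b Ξ n s - Ξ s t‖
      ≤ C * (b - a) ^ θ * (2 ^ (1 - θ)) ^ n + sewConst θ * C * (t - s) ^ θ := by
  have hab : a ≤ b := has.trans (hst.trans htb)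
  have hm := dyadic_mono hab n
  -- the grid clamped to `[s, t]`
  set q : ℕ → ℝ := fun k => max s (min (dyadic a b n k) t) with hq
  have hqm : Monotone q := fun i j hij => max_le_max_left s (min_le_min_right t (hm hij))
  have q0 : q 0 = s := by
    simp only [hq, dyadic_zero]; rw [min_eq_left (by linarith), max_eq_left has]
  have q1 : q (2 ^ n) = t := by
    simp only [hq, dyadic_last]; rw [min_eq_right htb, max_eq_right hst]
  have hS := h.norm_sum_sub_le hθ hC hqm (2 ^ n) 0 (by rw [q0]; exact has)
    (by rw [zero_add, q1]; exact htb)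
  simp only [zero_add, q0, q1] at hS
  have hE : ‖dyadicSum a b Ξ n t - dyadicSum a b Ξ n s
      - ∑ k ∈ Finset.range (2 ^ n), Ξ (q k) (q (k + 1))‖
        ≤ C * (b - a) ^ θ * (2 ^ (1 - θ)) ^ n := by
    rw [← dyadic_error hab]
    unfold dyadicSum
    rw [← Finset.sum_sub_distrib, ← Finset.sum_sub_distrib]
    refine (norm_sum_le_of_le (f := _) (n := fun _ => C * ((b - a) / 2 ^ n) ^ θ) _ ?_).trans
      (by simp)
    intro k _
    have hk : dyadic a b n k ≤ dyadic a b n (k + 1) := hm (Nat.le_succ k)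
    have hd := dyadic_succ_sub a b n k
    have hk0 := le_dyadic hab n k
    simp only [hq]
    set x := dyadic a b n k
    set y := dyadic a b n (k + 1)
    have hnn : 0 ≤ C * ((b - a) / 2 ^ n) ^ θ :=
      mul_nonneg hC (Real.rpow_nonneg (div_nonneg (by linarith) (by positivity)) _)
    have hss := h.diag hθ has (hst.trans htb)
    rcases le_total y s with hys | hys
    · have hxs := hk.trans hys
      rw [min_eq_left hys, min_eq_left hxs, min_eq_left (hys.trans hst),
        min_eq_left (hxs.trans hst), max_eq_left hys, max_eq_left hxs, hss]
      simpa using hnn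
    · rcases le_total s x with hsx | hsx
      · rw [min_eq_right hys, min_eq_right hsx, hss, max_eq_right (le_min hsx hst),
          max_eq_right (le_min hys hst)]
        simpa using hnn
      · rw [min_eq_right hys, min_eq_left hsx, min_eq_left (hsx.trans hst), max_eq_left hsx,
          max_eq_right (le_min hys hst)]
        refine (h x s (min y t) hk0 hsx (le_min hys hst) ((min_le_right _ _).trans htb)).trans ?_
        have : 0 ≤ min y t - x := by linarith [le_min hys hst]
        rw [← hd]
        gcongr
        exact min_le_left _ _
  calc _ = ‖(dyadicSum a b Ξ n t - dyadicSum a b Ξ n s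
      - ∑ k ∈ Finset.range (2 ^ n), Ξ (q k) (q (k + 1)))
      + (∑ k ∈ Finset.range (2 ^ n), Ξ (q k) (q (k + 1)) - Ξ s t)‖ := by congr 1; abel
    _ ≤ _ := (norm_add_le _ _).trans (add_le_add hE hS)

/-- **Sewing lemma.** An almost additive germ with exponent `θ > 1` is close to the increments of
a path. The path is the limit of the clamped dyadic Riemann sums. -/
theorem AlmostAdditive.exists_path [CompleteSpace W] {a b θ C : ℝ} {Ξ : ℝ → ℝ → W}
    (h : AlmostAdditive a b θ C Ξ) (hθ : 1 < θ) (hC : 0 ≤ C) :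
    ∃ J : ℝ → W, ∀ s t : ℝ, a ≤ s → s ≤ t → t ≤ b →
      ‖J t - J s - Ξ s t‖ ≤ sewConst θ * C * (t - s) ^ θ := by
  have hlim : ∀ t : ℝ, ∃ y : W, a ≤ t → t ≤ b →
      Tendsto (fun n => dyadicSum a b Ξ n t) atTop (𝓝 y) := by
    intro t
    by_cases ht : a ≤ t ∧ t ≤ b
    · obtain ⟨y, hy⟩ := cauchySeq_tendsto_of_complete
        (cauchySeq_of_le_geometric (f := fun n => dyadicSum a b Ξ n t) _ _ (two_rpow_lt_one hθ)
          fun n => by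
            rw [dist_eq_norm, norm_sub_rev]
            exact h.norm_dyadicSum_succ_sub_le hθ hC (ht.1.trans ht.2) ht.1 ht.2 n)
      exact ⟨y, fun _ _ => hy⟩
    · exact ⟨0, fun h1 h2 => absurd ⟨h1, h2⟩ ht⟩
  choose J hJ using hlim
  refine ⟨J, fun s t has hst htb => ?_⟩
  have h1 := (((hJ t (has.trans hst) htb).sub (hJ s has (hst.trans htb))).sub_const (Ξ s t)).norm
  have h2 : Tendsto (fun n : ℕ => C * (b - a) ^ θ * ((2 : ℝ) ^ (1 - θ)) ^ n
      + sewConst θ * C * (t - s) ^ θ) atTop (𝓝 (sewConst θ * C * (t - s) ^ θ)) := by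
    have := ((tendsto_pow_atTop_nhds_zero_of_lt_one (by positivity)
      (two_rpow_lt_one hθ)).const_mul (C * (b - a) ^ θ)).add_const (sewConst θ * C * (t - s) ^ θ)
    simpa using this
  exact le_of_tendsto_of_tendsto' h1 h2 fun n =>
    h.norm_dyadicSum_sub_sub_le hθ hC has hst htb n

end Sewing

/-! ### The lift of a bilinear map to the projective tensor product -/

section TensorLift

variable {V : Type*} [NormedAddCommGroup V] [NormedSpace ℝ V]
variable {W : Type*} [NormedAddCommGroup W] [NormedSpace ℝ W]

/-- A bilinear map as a multilinear map indexed by `Fin 2`. -/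
def toMultilinear (B : V →L[ℝ] V →L[ℝ] W) : ContinuousMultilinearMap ℝ (fun _ : Fin 2 => V) W :=
  ContinuousLinearMap.uncurryLeft
    (((continuousMultilinearCurryFin1 ℝ V W).symm.toContinuousLinearEquiv :
      (V →L[ℝ] W) →L[ℝ] _).comp B)

theorem toMultilinear_apply (B : V →L[ℝ] V →L[ℝ] W) (m : Fin 2 → V) :
    toMultilinear B m = B (m 0) (m 1) := by
  simp [toMultilinear, ContinuousLinearMap.uncurryLeft_apply, Fin.tail]

variable [CompleteSpace W]

theorem tensorLift_coe (B : V →L[ℝ] V →L[ℝ] W) (x : ⨂[ℝ] _ : Fin 2, V) :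
    tensorLift B (x : TensorSq V) =
      PiTensorProduct.liftIsometry ℝ (fun _ : Fin 2 => V) W (toMultilinear B) x :=
  ContinuousLinearMap.extend_eq
    (PiTensorProduct.liftIsometry ℝ (fun _ : Fin 2 => V) W (toMultilinear B))
    (e := (UniformSpace.Completion.toComplL : (⨂[ℝ] _ : Fin 2, V) →L[ℝ] TensorSq V))
    UniformSpace.Completion.denseRange_coe
    (UniformSpace.Completion.isUniformInducing_coe _) x

theorem tensorLift_sub (B B' : V →L[ℝ] V →L[ℝ] W) (x : TensorSq V) :
    tensorLift (B - B') x = tensorLift B x - tensorLift B' x := by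
  induction x using UniformSpace.Completion.induction_on with
  | hp => exact isClosed_eq (by fun_prop) (by fun_prop)
  | ih x =>
    rw [tensorLift_coe, tensorLift_coe, tensorLift_coe, ← sub_apply,
      ← map_sub]
    congr 2

theorem norm_tensorLift_apply_le (B : V →L[ℝ] V →L[ℝ] W) (x : TensorSq V) :
    ‖tensorLift B x‖ ≤ ‖B‖ * ‖x‖ := by
  induction x using UniformSpace.Completion.induction_on with
  | hp => exact isClosed_le (by fun_prop) (by fun_prop)
  | ih x =>
    rw [tensorLift_coe, UniformSpace.Completion.norm_coe]
    refine (ContinuousLinearMap.le_opNorm _ _).trans ?_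
    refine mul_le_mul_of_nonneg_right ?_ (norm_nonneg x)
    rw [LinearIsometryEquiv.norm_map]
    refine ContinuousMultilinearMap.opNorm_le_bound (norm_nonneg B) fun m => ?_
    rw [toMultilinear_apply, Fin.prod_univ_two, ← mul_assoc]
    exact B.le_opNorm₂ _ _

theorem tensorLift_zero_apply (x : TensorSq V) :
    tensorLift (0 : V →L[ℝ] V →L[ℝ] W) x = 0 :=
  norm_le_zero_iff.mp ((norm_tensorLift_apply_le _ x).trans
    (by rw [ContinuousLinearMap.opNorm_zero, zero_mul]))

theorem tmul_zero_right (v : V) : tmul v (0 : V) = 0 := by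
  unfold tmul
  rw [(PiTensorProduct.tprod ℝ).map_coord_zero (m := ![v, 0]) 1 rfl]
  rfl

end TensorLift

/-! ### Partitions and uniqueness of the rough integral -/

section Partition

theorem Partition.mono {a b : ℝ} (π : Partition a b) {i j : ℕ} (hij : i ≤ j) (hj : j ≤ π.n) :
    π.pt i ≤ π.pt j := by
  induction j, hij using Nat.le_induction with
  | base => exact le_rfl
  | succ j _ ih => exact (ih (by omega)).trans (π.pt_lt j (by omega)).le

theorem Partition.left_le {a b : ℝ} (π : Partition a b) {i : ℕ} (hi : i ≤ π.n) :
    a ≤ π.pt i :=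
  π.pt_zero.symm.le.trans (π.mono (Nat.zero_le _) hi)

theorem Partition.le_right {a b : ℝ} (π : Partition a b) {i : ℕ} (hi : i ≤ π.n) :
    π.pt i ≤ b :=
  (π.mono hi le_rfl).trans π.pt_last.le

theorem Partition.lt_right {a b : ℝ} (π : Partition a b) {i : ℕ} (hi : i < π.n) :
    π.pt i < b :=
  (π.pt_lt i hi).trans_le (π.le_right hi)

theorem Partition.sum_sub {G : Type*} [AddCommGroup G] {a b : ℝ} (π : Partition a b)
    (J : ℝ → G) : ∑ i ∈ Finset.range π.n, (J (π.pt (i + 1)) - J (π.pt i)) = J b - J a := by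
  rw [Finset.sum_range_sub (fun i => J (π.pt i)), π.pt_zero, π.pt_last]

theorem exists_partition_mesh_lt {a b δ : ℝ} (hab : a ≤ b) (hδ : 0 < δ) :
    ∃ π : Partition a b, ∀ i < π.n, π.pt (i + 1) - π.pt i < δ := by
  rcases hab.eq_or_lt with rfl | hab
  · exact ⟨⟨0, fun _ => a, rfl, rfl, by simp⟩, by simp⟩
  obtain ⟨N, hN⟩ := exists_nat_gt ((b - a) / δ)
  have hN0 : (0 : ℝ) < N := (div_pos (by linarith) hδ).trans hN
  have hstep : 0 < (b - a) / N := div_pos (by linarith) hN0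
  refine ⟨⟨N, fun i => a + i * ((b - a) / N), by simp, by field_simp; ring, fun i _ => ?_⟩,
    fun i _ => ?_⟩
  · push_cast; linarith
  · have : (b - a) / N < δ := by rw [div_lt_iff₀ hN0]; rwa [div_lt_iff₀' hδ] at hN
    simp only
    push_cast; linarith

variable {V : Type*} [NormedAddCommGroup V] [NormedSpace ℝ V]
variable {W : Type*} [NormedAddCommGroup W] [NormedSpace ℝ W] [CompleteSpace W]

/-- The germ `h_u X_{u,v} + h'_u 𝕏_{u,v}` of the rough integral of `(h, h')`. -/
def roughGerm (X : ℝ → V) (XX : ℝ → ℝ → TensorSq V) (h : ℝ → V →L[ℝ] W)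
    (h' : ℝ → V →L[ℝ] V →L[ℝ] W) (u v : ℝ) : W :=
  h u (X v - X u) + tensorLift (h' u) (XX u v)

variable {X : ℝ → V} {XX : ℝ → ℝ → TensorSq V}

theorem HasRoughIntegral.unique {h : ℝ → V →L[ℝ] W} {h' : ℝ → V →L[ℝ] V →L[ℝ] W} {a b : ℝ}
    (hab : a ≤ b) {I I' : W} (h1 : HasRoughIntegral X XX h h' a b I)
    (h2 : HasRoughIntegral X XX h h' a b I') : I = I' := by
  refine eq_of_forall_dist_le fun ε hε => ?_
  obtain ⟨δ₁, hδ₁, H1⟩ := h1 (ε / 2) (half_pos hε)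
  obtain ⟨δ₂, hδ₂, H2⟩ := h2 (ε / 2) (half_pos hε)
  obtain ⟨π, hπ⟩ := exists_partition_mesh_lt hab (lt_min hδ₁ hδ₂)
  have e1 := H1 π fun i hi => (hπ i hi).trans_le (min_le_left _ _)
  have e2 := H2 π fun i hi => (hπ i hi).trans_le (min_le_right _ _)
  rw [← dist_eq_norm] at e1 e2
  have := dist_triangle_left I I' (∑ i ∈ Finset.range π.n,
    (h (π.pt i) (X (π.pt (i + 1)) - X (π.pt i)) +
      tensorLift (h' (π.pt i)) (XX (π.pt i) (π.pt (i + 1)))))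
  linarith

theorem HasRoughIntegral.sub {h k : ℝ → V →L[ℝ] W} {h' k' : ℝ → V →L[ℝ] V →L[ℝ] W} {a b : ℝ}
    {I I' : W} (h1 : HasRoughIntegral X XX h h' a b I)
    (h2 : HasRoughIntegral X XX k k' a b I') :
    HasRoughIntegral X XX (fun s => h s - k s) (fun s => h' s - k' s) a b (I - I') := by
  intro ε hε
  obtain ⟨δ₁, hδ₁, H1⟩ := h1 (ε / 2) (half_pos hε)
  obtain ⟨δ₂, hδ₂, H2⟩ := h2 (ε / 2) (half_pos hε)
  refine ⟨min δ₁ δ₂, lt_min hδ₁ hδ₂, fun π hπ => ?_⟩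
  have e1 := H1 π fun i hi => (hπ i hi).trans_le (min_le_left _ _)
  have e2 := H2 π fun i hi => (hπ i hi).trans_le (min_le_right _ _)
  refine lt_of_eq_of_lt (congrArg norm ?_) ((norm_sub_le _ _).trans_lt
    ((add_lt_add e1 e2).trans_eq (add_halves ε)))
  rw [sub_sub_sub_comm, ← Finset.sum_sub_distrib]
  congr 1
  refine Finset.sum_congr rfl fun i _ => ?_
  rw [tensorLift_sub, sub_apply]
  abel

/-- Only the values of the integrand on `[a, b)` enter the rough integral over `[a, b]`. -/
theorem HasRoughIntegral.congr {h k : ℝ → V →L[ℝ] W} {h' k' : ℝ → V →L[ℝ] V →L[ℝ] W} {a b : ℝ}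
    {I : W} (h1 : HasRoughIntegral X XX h h' a b I) (e : ∀ r, a ≤ r → r < b → h r = k r)
    (e' : ∀ r, a ≤ r → r < b → h' r = k' r) : HasRoughIntegral X XX k k' a b I := by
  intro ε hε
  obtain ⟨δ, hδ, H⟩ := h1 ε hε
  refine ⟨δ, hδ, fun π hπ => ?_⟩
  convert H π hπ using 4 with i hi
  have hi := Finset.mem_range.mp hi
  rw [e _ (π.left_le hi.le) (π.lt_right hi), e' _ (π.left_le hi.le) (π.lt_right hi)]

theorem hasRoughIntegral_zero (a b : ℝ) :
    HasRoughIntegral X XX (fun _ => (0 : V →L[ℝ] W)) (fun _ => 0) a b 0 := by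
  intro ε hε
  exact ⟨1, one_pos, fun π _ => by simpa [tensorLift_zero_apply] using hε⟩

end Partition

/-! ### Existence of the rough integral -/

section RoughIntegral

variable {V : Type*} [NormedAddCommGroup V] [NormedSpace ℝ V]
variable {E : Type*} [NormedAddCommGroup E] [NormedSpace ℝ E]
variable {W : Type*} [NormedAddCommGroup W] [NormedSpace ℝ W]

/-- A rough path with an explicit Hölder constant `M`, on ordered pairs of times. -/
structure RoughBound (T β M : ℝ) (X : ℝ → V) (XX : ℝ → ℝ → TensorSq V) : Prop where
  nonneg : 0 ≤ M
  first : ∀ s t : ℝ, 0 ≤ s → s ≤ t → t ≤ T → ‖X t - X s‖ ≤ M * (t - s) ^ β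
  second : ∀ s t : ℝ, 0 ≤ s → s ≤ t → t ≤ T → ‖XX s t‖ ≤ M * (t - s) ^ (2 * β)
  chen : ∀ s u t : ℝ, 0 ≤ s → s ≤ u → u ≤ t → t ≤ T →
    XX s t - XX s u - XX u t = tmul (X u - X s) (X t - X u)

theorem RoughBound.mono {T T' β M : ℝ} {X : ℝ → V} {XX : ℝ → ℝ → TensorSq V}
    (h : RoughBound T β M X XX) (hT : T' ≤ T) : RoughBound T' β M X XX :=
  ⟨h.nonneg, fun s t hs hst ht => h.first s t hs hst (ht.trans hT),
    fun s t hs hst ht => h.second s t hs hst (ht.trans hT),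
    fun s u t hs hsu hut ht => h.chen s u t hs hsu hut (ht.trans hT)⟩

/-- `HolderTwo` says nothing about the diagonal, so its vanishing there is a hypothesis. -/
theorem HolderTwo.exists_bound {E : Type*} [NormedAddCommGroup E] {T γ : ℝ} {F : ℝ → ℝ → E}
    (h : HolderTwo T γ F) (hF : ∀ s, 0 ≤ s → s ≤ T → F s s = 0) :
    ∃ C, 0 ≤ C ∧ ∀ s t : ℝ, 0 ≤ s → s ≤ t → t ≤ T → ‖F s t‖ ≤ C * (t - s) ^ γ := by
  obtain ⟨C, hC⟩ := h
  refine ⟨|C|, abs_nonneg _, fun s t hs hst ht => ?_⟩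
  have hp : 0 ≤ (t - s) ^ γ := Real.rpow_nonneg (by linarith) _
  rcases hst.eq_or_lt with rfl | hlt
  · rw [hF s hs ht, norm_zero]; exact mul_nonneg (abs_nonneg _) hp
  · have := hC s ⟨hs, hst.trans ht⟩ t ⟨hs.trans hst, ht⟩ hlt.ne
    rw [abs_of_nonneg (by linarith : 0 ≤ t - s)] at this
    exact this.trans (by gcongr; exact le_abs_self C)

theorem IsRoughPath.exists_roughBound {T β : ℝ} {X : ℝ → V} {XX : ℝ → ℝ → TensorSq V}
    (h : IsRoughPath T β X XX) : ∃ M, RoughBound T β M X XX := by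
  obtain ⟨C1, h10, h1⟩ := HolderTwo.exists_bound h.holder (fun s _ _ => sub_self _)
  obtain ⟨C2, h20, h2⟩ := HolderTwo.exists_bound h.holder_second (fun s hs hsT => by
    have := h.chen s ⟨hs, hsT⟩ s ⟨hs, hsT⟩ s ⟨hs, hsT⟩
    rw [sub_self (X s), tmul_zero_right, sub_self, zero_sub, neg_eq_zero] at this
    exact this)
  refine ⟨C1 + C2, by positivity, fun s t hs hst ht => (h1 s t hs hst ht).trans ?_,
    fun s t hs hst ht => (h2 s t hs hst ht).trans ?_, fun s u t hs hsu hut ht =>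
      h.chen s ⟨hs, hsu.trans (hut.trans ht)⟩ u ⟨hs.trans hsu, hut.trans ht⟩ t
        ⟨hs.trans (hsu.trans hut), ht⟩⟩
  · have := Real.rpow_nonneg (sub_nonneg.mpr hst) β
    gcongr; linarith
  · have := Real.rpow_nonneg (sub_nonneg.mpr hst) (2 * β)
    gcongr; linarith

/-- On `[a, b]`, the path `Y'` is `β`-Hölder and the remainder `Y_{s,t} - Y'_s X_{s,t}` is
`2β`-Hölder, both with constant `D`: a ball of the seminorm of controlled rough paths. -/
def CtrlBound (X : ℝ → V) (β a b D : ℝ) (Y : ℝ → E) (Y' : ℝ → V →L[ℝ] E) : Prop :=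
  ∀ s t : ℝ, a ≤ s → s ≤ t → t ≤ b → ‖Y' t - Y' s‖ ≤ D * (t - s) ^ β ∧
    ‖Y t - Y s - Y' s (X t - X s)‖ ≤ D * (t - s) ^ (2 * β)

theorem rpow_mul_rpow_le {β γ x y z : ℝ} (hβ : 0 ≤ β) (hγ : 0 ≤ γ) (hx : 0 ≤ x) (hxz : x ≤ z)
    (hy : 0 ≤ y) (hyz : y ≤ z) : x ^ β * y ^ γ ≤ z ^ (β + γ) := by
  rw [Real.rpow_add_of_nonneg (hx.trans hxz) hβ hγ]
  have := hx.trans hxz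
  gcongr

variable [CompleteSpace W] {X : ℝ → V} {XX : ℝ → ℝ → TensorSq V}

/-- By Chen's relation, the defect of additivity of the germ of the rough integral consists of one
term with the remainder of `h` and one with an increment of `h'`, both of order `3β > 1`. -/
theorem CtrlBound.almostAdditive {T β M a b H : ℝ} (hX : RoughBound T β M X XX) (hβ : 0 < β)
    (ha : 0 ≤ a) (hb : b ≤ T) (hH : 0 ≤ H) {h : ℝ → V →L[ℝ] W} {h' : ℝ → V →L[ℝ] V →L[ℝ] W}
    (hh : CtrlBound X β a b H h h') :
    AlmostAdditive a b (3 * β) (2 * M * H) (roughGerm X XX h h') := by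
  intro s u t has hsu hut htb
  have hM := hX.nonneg
  obtain ⟨h1, h2⟩ := hh s u has hsu (hut.trans htb)
  have x1 := hX.first u t (ha.trans (has.trans hsu)) hut (htb.trans hb)
  have x2 := hX.second u t (ha.trans (has.trans hsu)) hut (htb.trans hb)
  have hc := hX.chen s u t (ha.trans has) hsu hut (htb.trans hb)
  have e : roughGerm X XX h h' s t - roughGerm X XX h h' s u - roughGerm X XX h h' u t
      = -((h u - h s - h' s (X u - X s)) (X t - X u))
        - tensorLift (h' u - h' s) (XX u t) := by
    have : XX s t = XX s u + XX u t + tmul (X u - X s) (X t - X u) := by rw [← hc]; abel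
    unfold roughGerm
    rw [this, map_add, map_add, tensorLift_tmul, tensorLift_sub]
    simp only [sub_apply, map_sub]
    abel
  rw [e]
  have p1 := rpow_mul_rpow_le (z := t - s) (by positivity : 0 ≤ 2 * β) hβ.le
    (by linarith : 0 ≤ u - s) (by linarith) (by linarith : 0 ≤ t - u) (by linarith)
  have p2 := rpow_mul_rpow_le (z := t - s) hβ.le (by positivity : 0 ≤ 2 * β)
    (by linarith : 0 ≤ u - s) (by linarith) (by linarith : 0 ≤ t - u) (by linarith)
  rw [show 2 * β + β = 3 * β by ring] at p1
  rw [show β + 2 * β = 3 * β by ring] at p2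
  have q1 : 0 ≤ (u - s) ^ β := Real.rpow_nonneg (by linarith) _
  have q2 : 0 ≤ (u - s) ^ (2 * β) := Real.rpow_nonneg (by linarith) _
  calc _ ≤ ‖(h u - h s - h' s (X u - X s)) (X t - X u)‖ + ‖tensorLift (h' u - h' s) (XX u t)‖ := by
        refine (norm_sub_le _ _).trans ?_
        rw [norm_neg]
    _ ≤ (H * (u - s) ^ (2 * β)) * (M * (t - u) ^ β)
        + (H * (u - s) ^ β) * (M * (t - u) ^ (2 * β)) := by
      gcongr
      · exact (ContinuousLinearMap.le_opNorm _ _).trans (by gcongr)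
      · exact (norm_tensorLift_apply_le _ _).trans (by gcongr)
    _ = M * H * ((u - s) ^ (2 * β) * (t - u) ^ β) + M * H * ((u - s) ^ β * (t - u) ^ (2 * β)) := by
      ring
    _ ≤ M * H * (t - s) ^ (3 * β) + M * H * (t - s) ^ (3 * β) := by gcongr
    _ = _ := by ring

/-- A path whose increments are close to an integral germ computes the rough integral: along a
partition of mesh `δ` the errors add up to at most `c δ^(θ-1) (t - s)`. -/
theorem hasRoughIntegral_of_germ {h : ℝ → V →L[ℝ] W} {h' : ℝ → V →L[ℝ] V →L[ℝ] W} {J : ℝ → W}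
    {a b c θ : ℝ} (hθ : 1 < θ) (hc : 0 ≤ c)
    (hJ : ∀ s t : ℝ, a ≤ s → s ≤ t → t ≤ b →
      ‖J t - J s - roughGerm X XX h h' s t‖ ≤ c * (t - s) ^ θ) :
    HasRoughIntegral X XX h h' a b (J b - J a) := by
  intro ε hε
  have hlim : Tendsto (fun δ : ℝ => c * δ ^ (θ - 1) * (b - a)) (𝓝[>] 0) (𝓝 0) := by
    have h0 : Tendsto (fun δ : ℝ => δ ^ (θ - 1)) (𝓝[>] 0) (𝓝 0) := by
      have := (Real.continuousAt_rpow_const 0 (θ - 1) (Or.inr (by linarith))).tendsto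
      rw [Real.zero_rpow (by linarith)] at this
      exact this.mono_left nhdsWithin_le_nhds
    simpa using (h0.const_mul c).mul_const (b - a)
  obtain ⟨δ, hδε, hδ⟩ := ((hlim.eventually (gt_mem_nhds hε)).and self_mem_nhdsWithin).exists
  refine ⟨δ, hδ, fun π hπ => lt_of_le_of_lt ?_ hδε⟩
  rw [← π.sum_sub J, ← Finset.sum_sub_distrib, ← π.sum_sub (fun x => x), Finset.mul_sum]
  refine norm_sum_le_of_le _ fun i hi => ?_
  have hi := Finset.mem_range.mp hi
  have hlt := π.pt_lt i hi
  rw [norm_sub_rev]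
  refine (hJ _ _ (π.left_le hi.le) hlt.le (π.le_right hi)).trans ?_
  have hpos : 0 < π.pt (i + 1) - π.pt i := by linarith
  rw [mul_assoc]
  refine mul_le_mul_of_nonneg_left ?_ hc
  calc (π.pt (i + 1) - π.pt i) ^ θ
      = (π.pt (i + 1) - π.pt i) ^ (θ - 1) * (π.pt (i + 1) - π.pt i) := by
        conv_rhs => rw [← Real.rpow_one (π.pt (i + 1) - π.pt i), Real.rpow_one]
        rw [← Real.rpow_add_one hpos.ne', sub_add_cancel]
    _ ≤ _ := by
      have := (hπ i hi).le
      gcongr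

/-- Existence of the rough integral over all subintervals, with the estimate of the sewing
lemma. -/
theorem CtrlBound.exists_integral {T β M a b H : ℝ} (hX : RoughBound T β M X XX)
    (hβ : 1 / 3 < β) (ha : 0 ≤ a) (hb : b ≤ T) (hH : 0 ≤ H) {h : ℝ → V →L[ℝ] W}
    {h' : ℝ → V →L[ℝ] V →L[ℝ] W} (hh : CtrlBound X β a b H h h') :
    ∃ J : ℝ → W, ∀ s t : ℝ, a ≤ s → s ≤ t → t ≤ b →
      HasRoughIntegral X XX h h' s t (J t - J s) ∧
      ‖J t - J s - roughGerm X XX h h' s t‖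
        ≤ sewConst (3 * β) * (2 * M * H) * (t - s) ^ (3 * β) := by
  have hθ : 1 < 3 * β := by linarith
  have hM := hX.nonneg
  have hK := sewConst_pos hθ
  obtain ⟨J, hJ⟩ := (hh.almostAdditive hX (by linarith) ha hb hH).exists_path hθ (by positivity)
  exact ⟨J, fun s t has hst htb => ⟨hasRoughIntegral_of_germ hθ (by positivity)
    fun s' t' h1 h2 h3 => hJ s' t' (has.trans h1) h2 (h3.trans htb), hJ s t has hst htb⟩⟩

end RoughIntegral

/-! ### Composition with a Lipschitz family of operators -/

section Kernel

variable {V : Type*} [NormedAddCommGroup V] [NormedSpace ℝ V]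
variable {E : Type*} [NormedAddCommGroup E] [NormedSpace ℝ E]
variable {W : Type*} [NormedAddCommGroup W] [NormedSpace ℝ W]

/-- The family of operators `K` is bounded by `κ` and `κ`-Lipschitz on `[a, b]`. -/
def KernelBound (a b κ : ℝ) (K : ℝ → E →L[ℝ] W) : Prop :=
  ∀ s t : ℝ, a ≤ s → s ≤ t → t ≤ b → ‖K s‖ ≤ κ ∧ ‖K t - K s‖ ≤ κ * (t - s)

/-- The path `s ↦ K_s g_s`. -/
def kerPath (K : ℝ → E →L[ℝ] W) (g : ℝ → V →L[ℝ] E) (s : ℝ) : V →L[ℝ] W :=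
  (K s).comp (g s)

/-- The Gubinelli derivative `s ↦ K_s g'_s` of `s ↦ K_s g_s`. -/
def kerDeriv (K : ℝ → E →L[ℝ] W) (g' : ℝ → V →L[ℝ] V →L[ℝ] E) (s : ℝ) : V →L[ℝ] V →L[ℝ] W :=
  (ContinuousLinearMap.compL ℝ V E W (K s)).comp (g' s)

theorem norm_compL_comp_le (K : E →L[ℝ] W) (B : V →L[ℝ] V →L[ℝ] E) :
    ‖(ContinuousLinearMap.compL ℝ V E W K).comp B‖ ≤ ‖K‖ * ‖B‖ := by
  refine (ContinuousLinearMap.opNorm_comp_le _ _).trans ?_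
  gcongr
  refine ContinuousLinearMap.opNorm_le_bound _ (norm_nonneg _) fun f => ?_
  exact ContinuousLinearMap.opNorm_comp_le K f

theorem norm_kerDeriv_le (K : ℝ → E →L[ℝ] W) (g' : ℝ → V →L[ℝ] V →L[ℝ] E) (s : ℝ) :
    ‖kerDeriv K g' s‖ ≤ ‖K s‖ * ‖g' s‖ :=
  norm_compL_comp_le _ _

theorem kerPath_sub (K K' : ℝ → E →L[ℝ] W) (g : ℝ → V →L[ℝ] E) (s : ℝ) :
    kerPath K g s - kerPath K' g s = kerPath (fun r => K r - K' r) g s := by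
  simp only [kerPath, ContinuousLinearMap.sub_comp]

theorem kerDeriv_sub (K K' : ℝ → E →L[ℝ] W) (g' : ℝ → V →L[ℝ] V →L[ℝ] E) (s : ℝ) :
    kerDeriv K g' s - kerDeriv K' g' s = kerDeriv (fun r => K r - K' r) g' s := by
  simp only [kerDeriv, map_sub, ContinuousLinearMap.sub_comp]

theorem kerPath_sub_right (K : ℝ → E →L[ℝ] W) (g k : ℝ → V →L[ℝ] E) (s : ℝ) :
    kerPath K g s - kerPath K k s = kerPath K (fun r => g r - k r) s := by
  simp only [kerPath, ContinuousLinearMap.comp_sub]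

theorem kerDeriv_sub_right (K : ℝ → E →L[ℝ] W) (g' k' : ℝ → V →L[ℝ] V →L[ℝ] E) (s : ℝ) :
    kerDeriv K g' s - kerDeriv K k' s = kerDeriv K (fun r => g' r - k' r) s := by
  simp only [kerDeriv, ContinuousLinearMap.comp_sub]

theorem le_rpow_of_le_one {x γ : ℝ} (hx : 0 ≤ x) (hx1 : x ≤ 1) (hγ : γ ≤ 1) :
    x ≤ x ^ γ := by
  rcases hx.eq_or_lt with rfl | h0
  · exact Real.rpow_nonneg le_rfl _
  · conv_lhs => rw [← Real.rpow_one x]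
    exact Real.rpow_le_rpow_of_exponent_ge h0 hx1 hγ

theorem kerDeriv_sub_eq (K : ℝ → E →L[ℝ] W)
    (g' : ℝ → V →L[ℝ] V →L[ℝ] E) (s t : ℝ) : kerDeriv K g' t - kerDeriv K g' s
        = (ContinuousLinearMap.compL ℝ V E W (K t - K s)).comp (g' t)
          + (ContinuousLinearMap.compL ℝ V E W (K s)).comp (g' t - g' s) := by
  refine ContinuousLinearMap.ext fun v => ContinuousLinearMap.ext fun w => ?_
  change K t (g' t v w) - K s (g' s v w) = (K t (g' t v w) - K s (g' t v w)) +
    K s (g' t v w - g' s v w)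
  rw [map_sub]
  abel

theorem norm_kerDeriv_sub_le (K : ℝ → E →L[ℝ] W) (g' : ℝ → V →L[ℝ] V →L[ℝ] E) (s t : ℝ) :
    ‖kerDeriv K g' t - kerDeriv K g' s‖ ≤ ‖K t - K s‖ * ‖g' t‖ + ‖K s‖ * ‖g' t - g' s‖ := by
  rw [kerDeriv_sub_eq]
  exact (ContinuousLinearMap.opNorm_add_le _ _).trans
    (add_le_add (norm_compL_comp_le _ _) (norm_compL_comp_le _ _))

/-- Lipschitz families act on controlled paths; times are at most `1`, so that `t - s` is dominated
by `(t - s)^(2β)`. -/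
theorem CtrlBound.kernel {X : ℝ → V} {β a b κ G : ℝ} (hβ : β ≤ 1 / 2) (ha : 0 ≤ a)
    (hb : b ≤ 1) (hκ : 0 ≤ κ) {K : ℝ → E →L[ℝ] W} (hK : KernelBound a b κ K)
    {g : ℝ → V →L[ℝ] E} {g' : ℝ → V →L[ℝ] V →L[ℝ] E} (hg : CtrlBound X β a b G g g')
    (hg0 : ∀ r, a ≤ r → r ≤ b → ‖g r‖ ≤ G ∧ ‖g' r‖ ≤ G) :
    CtrlBound X β a b (2 * κ * G) (kerPath K g) (kerDeriv K g') := by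
  intro s t has hst htb
  obtain ⟨k1, k2⟩ := hK s t has hst htb
  obtain ⟨g1, g2⟩ := hg s t has hst htb
  obtain ⟨n1, n2⟩ := hg0 t (has.trans hst) htb
  have hl : 0 ≤ t - s := by linarith
  have l1 := le_rpow_of_le_one (γ := β) hl (by linarith) (by linarith)
  have l2 := le_rpow_of_le_one (γ := 2 * β) hl (by linarith) (by linarith)
  constructor
  · refine (norm_kerDeriv_sub_le K g' s t).trans ?_
    calc _ ≤ (κ * (t - s) ^ β) * G + κ * (G * (t - s) ^ β) := by
          gcongr
          exact k2.trans (by gcongr)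
      _ = _ := by ring
  · have e : kerPath K g t - kerPath K g s - kerDeriv K g' s (X t - X s)
        = (K t - K s).comp (g t) + (K s).comp (g t - g s - g' s (X t - X s)) := by
      ext v; simp [kerDeriv, kerPath]; abel
    rw [e]
    calc _ ≤ ‖K t - K s‖ * ‖g t‖ + ‖K s‖ * ‖g t - g s - g' s (X t - X s)‖ :=
          (norm_add_le _ _).trans (add_le_add (ContinuousLinearMap.opNorm_comp_le _ _)
            (ContinuousLinearMap.opNorm_comp_le _ _))
      _ ≤ (κ * (t - s) ^ (2 * β)) * G + κ * (G * (t - s) ^ (2 * β)) := by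
          gcongr
          exact k2.trans (by gcongr)
      _ = _ := by ring

end Kernel

/-! ### Estimates for strongly continuous semigroups -/

namespace C0Semigroup

variable {W : Type*} [NormedAddCommGroup W] [NormedSpace ℝ W]

theorem op_add_apply (S : C0Semigroup W) {s t : ℝ} (hs : 0 ≤ s) (ht : 0 ≤ t) (y : W) :
    S.op (s + t) y = S.op s (S.op t y) := by
  rw [S.op_add s t hs ht]; rfl

theorem op_comm (S : C0Semigroup W) {s t : ℝ} (hs : 0 ≤ s) (ht : 0 ≤ t) (y : W) :
    S.op s (S.op t y) = S.op t (S.op s y) := by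
  rw [← S.op_add_apply hs ht, add_comm, S.op_add_apply ht hs]

theorem HasGen.op {S : C0Semigroup W} {y z : W} (h : S.HasGen y z) {q : ℝ} (hq : 0 ≤ q) :
    S.HasGen (S.op q y) (S.op q z) := by
  refine (((S.op q).continuous.tendsto z).comp h).congr' ?_
  filter_upwards [self_mem_nhdsWithin] with t ht
  rw [Function.comp_apply, map_smul, map_sub, S.op_comm hq (le_of_lt ht)]

theorem HasGen.sub {S : C0Semigroup W} {y y' z z' : W} (h : S.HasGen y z)
    (h' : S.HasGen y' z') : S.HasGen (y - y') (z - z') := by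
  simpa [sub_eq_add_neg] using h.add (h'.smul (-1))

/-- The operators `S_t` are bounded uniformly for small times, by the Banach–Steinhaus theorem. -/
theorem exists_norm_op_le_near_zero [CompleteSpace W] (S : C0Semigroup W) :
    ∃ δ > 0, ∃ C : ℝ, ∀ t, 0 < t → t < δ → ‖S.op t‖ ≤ C := by
  by_contra! hcon
  choose t ht0 ht1 htC using fun n : ℕ => hcon (1 / ((n : ℝ) + 1)) (by positivity) n
  have hlim : Tendsto t atTop (𝓝[>] 0) := tendsto_nhdsWithin_iff.mpr
    ⟨squeeze_zero (fun n => (ht0 n).le) (fun n => (ht1 n).le)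
      tendsto_one_div_add_atTop_nhds_zero_nat, Eventually.of_forall ht0⟩
  obtain ⟨C, hC⟩ := banach_steinhaus (g := fun n => S.op (t n)) fun y => by
    obtain ⟨C, hC⟩ := ((S.tendsto_op y).comp hlim).norm.bddAbove_range
    exact ⟨C, fun n => hC ⟨n, rfl⟩⟩
  obtain ⟨n, hn⟩ := exists_nat_gt C
  exact absurd (hC n) (not_le.mpr (hn.trans (htC n)))

/-- The operators `S_t`, `0 ≤ t ≤ 1`, are uniformly bounded, by the bound near zero and the
semigroup law. -/
theorem exists_norm_op_le [CompleteSpace W] (S : C0Semigroup W) :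
    ∃ M : ℝ, 1 ≤ M ∧ ∀ t, 0 ≤ t → t ≤ 1 → ‖S.op t‖ ≤ M := by
  obtain ⟨δ, hδ, C, hC⟩ := S.exists_norm_op_le_near_zero
  have key : ∀ n : ℕ, ∃ M : ℝ, 1 ≤ M ∧ ∀ t, 0 ≤ t → t ≤ n * (δ / 2) → ‖S.op t‖ ≤ M := by
    intro n
    induction n with
    | zero =>
      refine ⟨1, le_rfl, fun t h0 h1 => ?_⟩
      obtain rfl : t = 0 := le_antisymm (by simpa using h1) h0
      rw [S.op_zero]; exact ContinuousLinearMap.norm_id_le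
    | succ n ih =>
      obtain ⟨M, hM1, hM⟩ := ih
      refine ⟨max M (C * M), le_max_of_le_left hM1, fun t h0 h1 => ?_⟩
      rcases le_total t (n * (δ / 2)) with h | h
      · exact (hM t h0 h).trans (le_max_left _ _)
      rcases lt_or_ge t (δ / 2) with h' | h'
      · rcases h0.eq_or_lt with rfl | h0
        · rw [S.op_zero]; exact ContinuousLinearMap.norm_id_le.trans (le_max_of_le_left hM1)
        · refine le_max_of_le_right ((hC t h0 (by linarith)).trans (le_mul_of_one_le_right ?_ hM1))
          exact (norm_nonneg _).trans (hC t h0 (by linarith))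
      · have e := S.op_add (δ / 2) (t - δ / 2) (by linarith) (by linarith)
        rw [add_sub_cancel] at e
        rw [e]
        push_cast at h1
        have hh := hC (δ / 2) (by linarith) (by linarith)
        refine le_max_of_le_right ((ContinuousLinearMap.opNorm_comp_le _ _).trans ?_)
        exact mul_le_mul hh (hM _ (by linarith) (by linarith)) (norm_nonneg _)
          ((norm_nonneg _).trans hh)
  obtain ⟨n, hn⟩ := exists_nat_ge (1 / (δ / 2))
  obtain ⟨M, hM1, hM⟩ := key n
  rw [div_le_iff₀ (by linarith)] at hn
  exact ⟨M, hM1, fun t h0 h1 => hM t h0 (h1.trans hn)⟩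

variable {S : C0Semigroup W} {M : ℝ}

theorem norm_op_sub_op_le (hM : ∀ t, 0 ≤ t → t ≤ 1 → ‖S.op t‖ ≤ M) {s t : ℝ} (hs : 0 ≤ s)
    (hst : s ≤ t) (ht : t ≤ 1) (y : W) : ‖S.op t y - S.op s y‖ ≤ M * ‖S.op (t - s) y - y‖ := by
  have e : S.op t y = S.op s (S.op (t - s) y) := by
    rw [← S.op_add_apply hs (by linarith), add_sub_cancel]
  rw [e, ← map_sub]
  exact (S.op s).le_of_opNorm_le (hM s hs (hst.trans ht)) _

theorem continuousOn_op (hM1 : 1 ≤ M) (hM : ∀ t, 0 ≤ t → t ≤ 1 → ‖S.op t‖ ≤ M) (y : W) :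
    ContinuousOn (fun t => S.op t y) (Icc 0 1) := by
  rw [Metric.continuousOn_iff]
  intro t ht ε hε
  have hM0 : 0 < M := by linarith
  obtain ⟨δ, hδ, H⟩ := (Metric.tendsto_nhdsWithin_nhds.mp (S.tendsto_op y)) (ε / M) (by positivity)
  have key : ∀ a b : ℝ, 0 ≤ a → a ≤ b → b ≤ 1 → b - a < δ → ‖S.op b y - S.op a y‖ < ε := by
    intro a b ha hab hb hd
    rcases hab.eq_or_lt with rfl | hlt
    · simpa using hε
    refine (norm_op_sub_op_le hM ha hab hb y).trans_lt ?_
    have := H (x := b - a) (by simpa using hlt)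
      (by rwa [Real.dist_0_eq_abs, abs_of_pos (by linarith)])
    rw [dist_eq_norm, lt_div_iff₀ hM0] at this
    linarith
  refine ⟨δ, hδ, fun a ha had => ?_⟩
  rw [Real.dist_eq, abs_lt] at had
  rw [dist_eq_norm]
  rcases le_total a t with h | h
  · rw [norm_sub_rev]; exact key a t ha.1 h ht.2 (by linarith)
  · exact key t a ht.1 h ha.2 (by linarith)

theorem HasGen.hasDerivWithinAt {y z : W} (h : S.HasGen y z) {r : ℝ} (hr : 0 ≤ r) :
    HasDerivWithinAt (fun t => S.op t y) (S.op r z) (Ici r) r := by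
  rw [← hasDerivWithinAt_Ioi_iff_Ici, hasDerivWithinAt_iff_tendsto_slope' self_notMem_Ioi]
  have hshift : Tendsto (fun x : ℝ => x - r) (𝓝[>] r) (𝓝[>] 0) := by
    refine tendsto_nhdsWithin_iff.mpr ⟨?_, ?_⟩
    · have : Tendsto (fun x : ℝ => x - r) (𝓝 r) (𝓝 (r - r)) := tendsto_id.sub_const r
      rw [sub_self] at this
      exact this.mono_left nhdsWithin_le_nhds
    · filter_upwards [self_mem_nhdsWithin] with x hx using sub_pos.mpr (mem_Ioi.mp hx)
  refine (((S.op r).continuous.tendsto z).comp (h.comp hshift)).congr' ?_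
  filter_upwards [self_mem_nhdsWithin] with x hx
  have hx' : 0 ≤ x - r := sub_nonneg.mpr (le_of_lt hx)
  rw [slope_def_module, Function.comp_apply, Function.comp_apply, map_smul, map_sub,
    ← S.op_add_apply hr hx', add_sub_cancel]

/-- On the domain of the generator, the orbits are Lipschitz. -/
theorem HasGen.norm_op_sub_le (hM1 : 1 ≤ M) (hM : ∀ t, 0 ≤ t → t ≤ 1 → ‖S.op t‖ ≤ M) {y z : W}
    (h : S.HasGen y z) {s t : ℝ} (hs : 0 ≤ s) (hst : s ≤ t) (ht : t ≤ 1) :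
    ‖S.op t y - S.op s y‖ ≤ M * ‖z‖ * (t - s) := by
  refine norm_image_sub_le_of_norm_deriv_right_le_segment (f := fun r => S.op r y)
    (f' := fun r => S.op r z) (a := s) (b := t)
    ((continuousOn_op hM1 hM y).mono (Icc_subset_Icc hs ht))
    (fun r hr => h.hasDerivWithinAt (hs.trans hr.1)) (fun r hr => ?_) t ⟨hst, le_rfl⟩
  exact (S.op r).le_of_opNorm_le (hM r (hs.trans hr.1) (hr.2.le.trans ht)) z

/-- On the domain of the square of the generator, mixed second differences of the orbits are
bounded by the product of the two time steps. -/
theorem HasGen.norm_second_difference_le (hM1 : 1 ≤ M)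
    (hM : ∀ t, 0 ≤ t → t ≤ 1 → ‖S.op t‖ ≤ M) {y z w : W} (h : S.HasGen y z) (h' : S.HasGen z w)
    {p q k : ℝ} (hp : 0 ≤ p) (hq : 0 ≤ q) (hk : 0 ≤ k) (hsum : p + q + k ≤ 1) :
    ‖(S.op (p + k) y - S.op p y) - (S.op (p + q + k) y - S.op (p + q) y)‖
      ≤ M ^ 3 * ‖w‖ * k * q := by
  have hM0 : 0 ≤ M := by linarith
  have e : (S.op (p + k) y - S.op p y) - (S.op (p + q + k) y - S.op (p + q) y)
      = S.op p (S.op k (y - S.op q y) - S.op 0 (y - S.op q y)) := by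
    rw [S.op_zero, ContinuousLinearMap.id_apply, add_assoc p q k, add_comm q k,
      S.op_add_apply (t := k + q) hp (by linarith), S.op_add_apply hk hq, S.op_add_apply hp hk,
      S.op_add_apply hp hq]
    simp only [map_sub]
    abel
  rw [e]
  have h1 := (h.sub (h.op hq)).norm_op_sub_le hM1 hM le_rfl hk (by linarith)
  have h2 := h'.norm_op_sub_le hM1 hM le_rfl hq (by linarith)
  rw [norm_sub_rev, S.op_zero, ContinuousLinearMap.id_apply, sub_zero] at h2
  rw [sub_zero] at h1
  calc _ ≤ M * ‖S.op k (y - S.op q y) - S.op 0 (y - S.op q y)‖ :=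
        (S.op p).le_of_opNorm_le (hM p hp (by linarith)) _
    _ ≤ M * (M * (M * ‖w‖ * q) * k) := by
        gcongr
        exact h1.trans (by gcongr)
    _ = _ := by ring

theorem norm_gen_iterate_le {n j : ℕ} (hj : j ≤ n) (y : S.Dom n) :
    ‖S.gen^[j] (S.incl n y)‖ ≤ ‖y‖ := by
  rw [norm_def]
  exact Finset.single_le_sum (f := fun j => ‖S.gen^[j] (S.inclₗ n y)‖)
    (fun j _ => norm_nonneg _) (Finset.mem_range.mpr (by omega))

theorem hasGen_iterate {n j : ℕ} (hj : j < n) (y : S.Dom n) :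
    S.HasGen (S.gen^[j] (S.incl n y)) (S.gen^[j + 1] (S.incl n y)) := by
  have hy : S.InDom n (S.incl n y) := y.2
  obtain ⟨-, z, hz⟩ := hy.of_le (Nat.succ_le_of_lt hj)
  rw [Function.iterate_succ_apply', hz.gen_eq]
  exact hz

theorem norm_incl_le (n : ℕ) : ‖S.incl n‖ ≤ 1 :=
  ContinuousLinearMap.opNorm_le_bound _ zero_le_one fun y => by
    simpa using norm_gen_iterate_le (S := S) (Nat.zero_le n) y

theorem norm_op_comp_incl_sub_le (hM1 : 1 ≤ M) (hM : ∀ t, 0 ≤ t → t ≤ 1 → ‖S.op t‖ ≤ M) {n : ℕ}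
    (hn : 1 ≤ n) {s t : ℝ} (hs : 0 ≤ s) (hst : s ≤ t) (ht : t ≤ 1) :
    ‖(S.op t).comp (S.incl n) - (S.op s).comp (S.incl n)‖ ≤ M * (t - s) := by
  have hM0 : 0 ≤ M := by linarith
  have hts : 0 ≤ t - s := by linarith
  refine ContinuousLinearMap.opNorm_le_bound _ (by positivity) fun y => ?_
  have h1 := (hasGen_iterate (S := S) (j := 0) (by omega) y).norm_op_sub_le hM1 hM hs hst ht
  have h2 := norm_gen_iterate_le (S := S) hn y
  calc _ ≤ M * ‖S.gen^[1] (S.incl n y)‖ * (t - s) := h1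
    _ ≤ M * ‖y‖ * (t - s) := by gcongr
    _ = _ := by ring

/-- The convolution kernel `r ↦ S_{t-r}`, as a path of operators from `D(A^2)` to `W`. -/
def kernel (S : C0Semigroup W) (t r : ℝ) : S.Dom 2 →L[ℝ] W := (S.op (t - r)).comp (S.incl 2)

theorem norm_op_comp_incl_le (hM1 : 1 ≤ M) (hM : ∀ t, 0 ≤ t → t ≤ 1 → ‖S.op t‖ ≤ M) (n : ℕ) {t : ℝ}
    (h0 : 0 ≤ t) (h1 : t ≤ 1) : ‖(S.op t).comp (S.incl n)‖ ≤ M := by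
  refine (ContinuousLinearMap.opNorm_comp_le _ _).trans ?_
  calc _ ≤ M * 1 := mul_le_mul (hM t h0 h1) (norm_incl_le n) (norm_nonneg _) (by linarith)
    _ = M := mul_one M

theorem kernelBound_kernel (hM1 : 1 ≤ M) (hM : ∀ t, 0 ≤ t → t ≤ 1 → ‖S.op t‖ ≤ M) {t : ℝ}
    (ht : t ≤ 1) : KernelBound 0 t M (S.kernel t) := by
  intro r r' hr hrr hrt
  refine ⟨norm_op_comp_incl_le hM1 hM 2 (by linarith) (by linarith), ?_⟩
  have := norm_op_comp_incl_sub_le hM1 hM (n := 2) (by norm_num) (by linarith : 0 ≤ t - r')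
    (by linarith : t - r' ≤ t - r) (by linarith)
  rw [norm_sub_rev] at this
  exact this.trans_eq (by ring)

/-- The difference of the convolution kernels at times `s ≤ t` is of order `t - s`, together with
its Lipschitz constant; the latter is where two powers of the generator are needed. -/
theorem kernelBound_kernel_sub (hM1 : 1 ≤ M) (hM : ∀ t, 0 ≤ t → t ≤ 1 → ‖S.op t‖ ≤ M) {s t : ℝ}
    (hst : s ≤ t) (ht : t ≤ 1) :
    KernelBound 0 s (M ^ 3 * (t - s)) fun r => S.kernel t r - S.kernel s r := by
  intro r r' hr hrr hrs
  have hts : 0 ≤ t - s := by linarith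
  have hM3 : M ≤ M ^ 3 := le_self_pow₀ hM1 (by norm_num)
  constructor
  · have := norm_op_comp_incl_sub_le hM1 hM (n := 2) (by norm_num) (by linarith : 0 ≤ s - r)
      (by linarith : s - r ≤ t - r) (by linarith)
    refine this.trans ?_
    rw [sub_sub_sub_cancel_right]
    gcongr
  · have hM0 : 0 ≤ M := by linarith
    have hrr0 : 0 ≤ r' - r := by linarith
    refine ContinuousLinearMap.opNorm_le_bound _ (by positivity) fun y => ?_
    have h2 := norm_gen_iterate_le (S := S) (le_refl 2) y
    have := (hasGen_iterate (S := S) (j := 0) (by omega) y).norm_second_difference_le hM1 hM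
      (hasGen_iterate (j := 1) (by omega) y) (by linarith : 0 ≤ s - r') hrr0 hts (by linarith)
    rw [show s - r' + (t - s) = t - r' by ring, show s - r' + (r' - r) = s - r by ring,
      show s - r + (t - s) = t - r by ring] at this
    calc _ ≤ M ^ 3 * ‖S.gen^[2] (S.incl 2 y)‖ * (t - s) * (r' - r) := this
      _ ≤ M ^ 3 * ‖y‖ * (t - s) * (r' - r) := by gcongr
      _ = _ := by ring

end C0Semigroup

/-! ### Second and third order mean value estimates -/

section MeanValue

variable {W : Type*} [NormedAddCommGroup W] [NormedSpace ℝ W]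
variable {G : Type*} [NormedAddCommGroup G] [NormedSpace ℝ G]

theorem norm_sub_le_of_iteratedFDeriv_one {φ : W → G} (hφ : ContDiff ℝ 1 φ) {C : ℝ}
    (hC : ∀ y, ‖iteratedFDeriv ℝ 1 φ y‖ ≤ C) (y z : W) : ‖φ y - φ z‖ ≤ C * ‖y - z‖ :=
  convex_univ.norm_image_sub_le_of_norm_fderiv_le (𝕜 := ℝ)
    (fun x _ => (hφ.differentiable one_ne_zero) x)
    (fun x _ => (norm_iteratedFDeriv_one (𝕜 := ℝ) φ).symm.le.trans (hC x)) (mem_univ z) (mem_univ y)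

/-- The difference of increments of `φ` along two segments. -/
theorem norm_four_point_le {φ : W → G} (hφ : Differentiable ℝ φ) {A₁ A₂ : ℝ}
    (h₁ : ∀ y z, ‖φ y - φ z‖ ≤ A₁ * ‖y - z‖)
    (h₂ : ∀ y z, ‖fderiv ℝ φ y - fderiv ℝ φ z‖ ≤ A₂ * ‖y - z‖) (y₀ y₁ z₀ z₁ : W) :
    ‖(φ y₁ - φ z₁) - (φ y₀ - φ z₀)‖
      ≤ A₁ * ‖(y₁ - z₁) - (y₀ - z₀)‖ + A₂ * ‖y₀ - z₀‖ * ‖z₁ - z₀‖ := by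
  have hψ : ∀ z, HasFDerivAt (fun z => φ (z + (y₀ - z₀)) - φ z)
      (fderiv ℝ φ (z + (y₀ - z₀)) - fderiv ℝ φ z) z := fun z =>
    ((hasFDerivAt_comp_add_right (y₀ - z₀)).mpr (hφ (z + (y₀ - z₀))).hasFDerivAt).sub
      (hφ z).hasFDerivAt
  have h := convex_univ.norm_image_sub_le_of_norm_hasFDerivWithin_le (C := A₂ * ‖y₀ - z₀‖)
    (fun z _ => (hψ z).hasFDerivWithinAt)
    (fun z _ => (h₂ _ _).trans_eq (by rw [add_sub_cancel_left])) (mem_univ z₀) (mem_univ z₁)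
  rw [add_sub_cancel] at h
  calc _ = ‖(φ y₁ - φ (z₁ + (y₀ - z₀)))
        + ((φ (z₁ + (y₀ - z₀)) - φ z₁) - (φ y₀ - φ z₀))‖ := by congr 1; abel
    _ ≤ _ := (norm_add_le _ _).trans (add_le_add ((h₁ _ _).trans_eq (by congr 2; abel)) h)

/-- The difference of the first order Taylor remainders of `φ` at two points. The derivative of
the remainder in the increment is an increment of `Dφ`, so that no symmetry of second derivatives
is needed. -/
theorem norm_taylor_sub_taylor_le {φ : W → G} (hφ : Differentiable ℝ φ) {A₂ A₃ : ℝ} (hA₂ : 0 ≤ A₂)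
    (hA₃ : 0 ≤ A₃)
    (h₂ : ∀ y z, ‖fderiv ℝ φ y - fderiv ℝ φ z‖ ≤ A₂ * ‖y - z‖)
    (h₃ : ∀ y₀ y₁ z₀ z₁, ‖(fderiv ℝ φ y₁ - fderiv ℝ φ z₁) - (fderiv ℝ φ y₀ - fderiv ℝ φ z₀)‖
      ≤ A₂ * ‖(y₁ - z₁) - (y₀ - z₀)‖ + A₃ * ‖y₀ - z₀‖ * ‖z₁ - z₀‖) (y z u v : W) :
    ‖(φ (y + u) - φ y - fderiv ℝ φ y u) - (φ (z + v) - φ z - fderiv ℝ φ z v)‖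
      ≤ A₂ * (‖u‖ + ‖v‖) * ‖u - v‖ + A₃ * ‖y - z‖ * ‖v‖ ^ 2 := by
  have hτ : ∀ y x : W, HasFDerivAt (fun x => φ (y + x) - φ y - fderiv ℝ φ y x)
      (fderiv ℝ φ (y + x) - fderiv ℝ φ y) x := fun y x =>
    (((hasFDerivAt_comp_add_left y).mpr (hφ (y + x)).hasFDerivAt).sub_const (φ y)).sub
      (fderiv ℝ φ y).hasFDerivAt
  have hseg : ∀ x ∈ segment ℝ v u, ‖x‖ ≤ ‖u‖ + ‖v‖ := by
    intro x hx
    have hball := (convex_closedBall (0 : W) (‖u‖ + ‖v‖)).segment_subset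
      (x := v) (y := u) (by simp) (by simp) hx
    simpa using hball
  have h1 := (convex_segment v u).norm_image_sub_le_of_norm_hasFDerivWithin_le
    (C := A₂ * (‖u‖ + ‖v‖)) (fun x _ => (hτ y x).hasFDerivWithinAt)
    (fun x hx => (h₂ _ _).trans (by rw [add_sub_cancel_left]; gcongr; exact hseg x hx))
    (left_mem_segment ℝ v u) (right_mem_segment ℝ v u)
  have h2 := (convex_closedBall (0 : W) ‖v‖).norm_image_sub_le_of_norm_hasFDerivWithin_le
    (C := A₃ * ‖y - z‖ * ‖v‖) (fun x _ => ((hτ y x).sub (hτ z x)).hasFDerivWithinAt)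
    (fun x hx => by
      have hx : ‖x‖ ≤ ‖v‖ := by simpa using hx
      have := h₃ y (y + x) z (z + x)
      rw [add_sub_add_right_eq_sub, sub_self, norm_zero, mul_zero, zero_add,
        add_sub_cancel_left] at this
      calc _ = ‖(fderiv ℝ φ (y + x) - fderiv ℝ φ (z + x)) - (fderiv ℝ φ y - fderiv ℝ φ z)‖ := by
            congr 1; abel
        _ ≤ A₃ * ‖y - z‖ * ‖x‖ := this
        _ ≤ _ := by gcongr) (x := 0) (y := v) (by simp) (by simp)
  simp only [Pi.sub_apply, add_zero, map_zero, sub_self, sub_zero] at h2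
  calc _ = ‖((φ (y + u) - φ y - fderiv ℝ φ y u) - (φ (y + v) - φ y - fderiv ℝ φ y v))
        + ((φ (y + v) - φ y - fderiv ℝ φ y v) - (φ (z + v) - φ z - fderiv ℝ φ z v))‖ := by
        congr 1; abel
    _ ≤ _ := (norm_add_le _ _).trans (add_le_add h1 (h2.trans_eq (by ring)))

end MeanValue

/-! ### Bounds for coefficients of class `C_b^{γ,3}` -/

section Composition

variable {V : Type*} [NormedAddCommGroup V] [NormedSpace ℝ V]
variable {W : Type*} [NormedAddCommGroup W] [NormedSpace ℝ W]
variable {G : Type*} [NormedAddCommGroup G] [NormedSpace ℝ G]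

/-- The consequences of `F ∈ C_b^{γ,3}` that enter the estimates, with one constant `C`. -/
structure CoeffBound (T γ C : ℝ) (F : ℝ → W → G) : Prop where
  nonneg : 0 ≤ C
  diff : ∀ t, 0 ≤ t → t ≤ T → Differentiable ℝ (F t)
  val : ∀ t, 0 ≤ t → t ≤ T → ∀ y, ‖F t y‖ ≤ C
  deriv : ∀ t, 0 ≤ t → t ≤ T → ∀ y, ‖fderiv ℝ (F t) y‖ ≤ C
  lip : ∀ t, 0 ≤ t → t ≤ T → ∀ y z, ‖F t y - F t z‖ ≤ C * ‖y - z‖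
  lip_deriv : ∀ t, 0 ≤ t → t ≤ T → ∀ y z, ‖fderiv ℝ (F t) y - fderiv ℝ (F t) z‖ ≤ C * ‖y - z‖
  four_point_deriv : ∀ t, 0 ≤ t → t ≤ T → ∀ y₀ y₁ z₀ z₁,
    ‖(fderiv ℝ (F t) y₁ - fderiv ℝ (F t) z₁) - (fderiv ℝ (F t) y₀ - fderiv ℝ (F t) z₀)‖
      ≤ C * ‖(y₁ - z₁) - (y₀ - z₀)‖ + C * ‖y₀ - z₀‖ * ‖z₁ - z₀‖
  time : ∀ s t, 0 ≤ s → s ≤ t → t ≤ T → ∀ y, ‖F t y - F s y‖ ≤ C * (t - s) ^ γ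
  time_lip : ∀ s t, 0 ≤ s → s ≤ t → t ≤ T → ∀ y z,
    ‖(F t y - F s y) - (F t z - F s z)‖ ≤ C * (t - s) ^ γ * ‖y - z‖
  time_deriv : ∀ s t, 0 ≤ s → s ≤ t → t ≤ T → ∀ y,
    ‖fderiv ℝ (F t) y - fderiv ℝ (F s) y‖ ≤ C * (t - s) ^ γ
  time_lip_deriv : ∀ s t, 0 ≤ s → s ≤ t → t ≤ T → ∀ y z,
    ‖(fderiv ℝ (F t) y - fderiv ℝ (F s) y) - (fderiv ℝ (F t) z - fderiv ℝ (F s) z)‖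
      ≤ C * (t - s) ^ γ * ‖y - z‖

theorem CoeffBound.mono {T T' γ C : ℝ} {F : ℝ → W → G} (h : CoeffBound T γ C F) (hT : T' ≤ T) :
    CoeffBound T' γ C F where
  nonneg := h.nonneg
  diff t h0 h1 := h.diff t h0 (h1.trans hT)
  val t h0 h1 := h.val t h0 (h1.trans hT)
  deriv t h0 h1 := h.deriv t h0 (h1.trans hT)
  lip t h0 h1 := h.lip t h0 (h1.trans hT)
  lip_deriv t h0 h1 := h.lip_deriv t h0 (h1.trans hT)
  four_point_deriv t h0 h1 := h.four_point_deriv t h0 (h1.trans hT)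
  time s t h0 h1 h2 := h.time s t h0 h1 (h2.trans hT)
  time_lip s t h0 h1 h2 := h.time_lip s t h0 h1 (h2.trans hT)
  time_deriv s t h0 h1 h2 := h.time_deriv s t h0 h1 (h2.trans hT)
  time_lip_deriv s t h0 h1 h2 := h.time_lip_deriv s t h0 h1 (h2.trans hT)

theorem IsCb.exists_coeffBound {T γ : ℝ} {F : ℝ → W → G} (h : IsCb T γ 3 F) :
    ∃ C, CoeffBound T γ C F := by
  obtain ⟨C₁, hC₁⟩ := h.bounded
  obtain ⟨C₂, hC₂⟩ := h.holder
  have hcd : ∀ t, 0 ≤ t → t ≤ T → ContDiff ℝ 3 (F t) := fun t h0 h1 => h.contDiff t ⟨h0, h1⟩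
  have b : ∀ k ≤ 3, ∀ t, 0 ≤ t → t ≤ T → ∀ y, ‖iteratedFDeriv ℝ k (F t) y‖ ≤ |C₁| + |C₂| :=
    fun k hk t h0 h1 y => (hC₁ k hk t ⟨h0, h1⟩ y).trans
      ((le_abs_self _).trans (le_add_of_nonneg_right (abs_nonneg _)))
  have bt : ∀ k < 3, ∀ s t, 0 ≤ s → s ≤ t → t ≤ T → ∀ y,
      ‖iteratedFDeriv ℝ k (fun y => F t y - F s y) y‖ ≤ (|C₁| + |C₂|) * (t - s) ^ γ := by
    intro k hk s t h0 hst h1 y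
    have hk' : (k : WithTop ℕ∞) ≤ 3 := by exact_mod_cast hk.le
    rw [fun_iteratedFDeriv_sub_apply
      ((hcd t (h0.trans hst) h1).of_le hk').contDiffAt
      ((hcd s h0 (hst.trans h1)).of_le hk').contDiffAt]
    have := hC₂ k hk y s ⟨h0, hst.trans h1⟩ t ⟨h0.trans hst, h1⟩
    rw [abs_of_nonneg (sub_nonneg.mpr hst)] at this
    refine this.trans (mul_le_mul_of_nonneg_right ?_ (Real.rpow_nonneg (sub_nonneg.mpr hst) _))
    exact (le_abs_self _).trans (le_add_of_nonneg_left (abs_nonneg _))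
  have hD : ∀ φ : W → G, ContDiff ℝ 3 φ → ContDiff ℝ 2 (fderiv ℝ φ) := fun φ hφ =>
    hφ.fderiv_right (by norm_num)
  have hD2 : ∀ φ : W → G, ContDiff ℝ 3 φ → ContDiff ℝ 1 (fderiv ℝ (fderiv ℝ φ)) := fun φ hφ =>
    (hD φ hφ).fderiv_right (by norm_num)
  have lip : ∀ (φ : W → G) (A : ℝ), ContDiff ℝ 3 φ → (∀ y, ‖iteratedFDeriv ℝ 1 φ y‖ ≤ A) →
      ∀ y z, ‖φ y - φ z‖ ≤ A * ‖y - z‖ := fun φ A hφ hA =>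
    norm_sub_le_of_iteratedFDeriv_one (hφ.of_le (by norm_num)) hA
  have lipD : ∀ (φ : W → G) (A : ℝ), ContDiff ℝ 3 φ → (∀ y, ‖iteratedFDeriv ℝ 2 φ y‖ ≤ A) →
      ∀ y z, ‖fderiv ℝ φ y - fderiv ℝ φ z‖ ≤ A * ‖y - z‖ := fun φ A hφ hA =>
    norm_sub_le_of_iteratedFDeriv_one ((hD φ hφ).of_le (by norm_num))
      fun y => norm_iteratedFDeriv_fderiv.le.trans (hA y)
  have dsub : ∀ s t, 0 ≤ s → s ≤ t → t ≤ T → ∀ y,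
      fderiv ℝ (fun y => F t y - F s y) y = fderiv ℝ (F t) y - fderiv ℝ (F s) y :=
    fun s t h0 hst h1 y => fderiv_fun_sub
      ((hcd t (h0.trans hst) h1).differentiable (by norm_num) y)
      ((hcd s h0 (hst.trans h1)).differentiable (by norm_num) y)
  have csub : ∀ s t, 0 ≤ s → s ≤ t → t ≤ T → ContDiff ℝ 3 (fun y => F t y - F s y) :=
    fun s t h0 hst h1 => (hcd t (h0.trans hst) h1).sub (hcd s h0 (hst.trans h1))
  refine ⟨|C₁| + |C₂|, by positivity, fun t h0 h1 => (hcd t h0 h1).differentiable (by norm_num),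
    fun t h0 h1 y => ?_, fun t h0 h1 y => ?_, fun t h0 h1 => ?_, fun t h0 h1 => ?_,
    fun t h0 h1 => ?_, fun s t h0 hst h1 y => ?_, fun s t h0 hst h1 y z => ?_,
    fun s t h0 hst h1 y => ?_, fun s t h0 hst h1 y z => ?_⟩
  · exact (norm_iteratedFDeriv_zero (𝕜 := ℝ)).symm.le.trans (b 0 (by norm_num) t h0 h1 y)
  · exact (norm_iteratedFDeriv_one (𝕜 := ℝ) (F t)).symm.le.trans (b 1 (by norm_num) t h0 h1 y)
  · exact lip _ _ (hcd t h0 h1) (b 1 (by norm_num) t h0 h1)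
  · exact lipD _ _ (hcd t h0 h1) (b 2 (by norm_num) t h0 h1)
  · refine norm_four_point_le ((hD _ (hcd t h0 h1)).differentiable (by norm_num))
      (lipD _ _ (hcd t h0 h1) (b 2 (by norm_num) t h0 h1)) ?_
    refine norm_sub_le_of_iteratedFDeriv_one (hD2 _ (hcd t h0 h1)) fun y => ?_
    rw [norm_iteratedFDeriv_fderiv, norm_iteratedFDeriv_fderiv]
    exact b 3 le_rfl t h0 h1 y
  · exact (norm_iteratedFDeriv_zero (𝕜 := ℝ) (f := fun y => F t y - F s y)).symm.le.trans
      (bt 0 (by norm_num) s t h0 hst h1 y)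
  · exact lip _ _ (csub s t h0 hst h1) (bt 1 (by norm_num) s t h0 hst h1) y z
  · rw [← dsub s t h0 hst h1]
    exact (norm_iteratedFDeriv_one (𝕜 := ℝ) (fun y => F t y - F s y)).symm.le.trans
      (bt 1 (by norm_num) s t h0 hst h1 y)
  · rw [← dsub s t h0 hst h1, ← dsub s t h0 hst h1]
    exact lipD _ _ (csub s t h0 hst h1) (bt 2 (by norm_num) s t h0 hst h1) y z

end Composition

/-! ### Composition of controlled paths with the coefficient -/

section ControlledComposition

variable {V : Type*} [NormedAddCommGroup V] [NormedSpace ℝ V]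
variable {W : Type*} [NormedAddCommGroup W] [NormedSpace ℝ W]
variable {G : Type*} [NormedAddCommGroup G] [NormedSpace ℝ G]

/-- Bounds on a controlled path `(Y, Y')` on `[a, b]`: the constant `δ` bounds `Y`, `Y'` and the
`β`-Hölder seminorm of `Y`, and the constant `D` bounds the Hölder seminorms of `Y'` and of the
remainder. For differences of controlled paths on a short interval `δ` is small compared to `D`. -/
structure CtrlPath (X : ℝ → V) (β a b δ D : ℝ) (Y : ℝ → G) (Y' : ℝ → V →L[ℝ] G) : Prop where
  val : ∀ s, a ≤ s → s ≤ b → ‖Y s‖ ≤ δ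
  deriv : ∀ s, a ≤ s → s ≤ b → ‖Y' s‖ ≤ δ
  incr : ∀ s t, a ≤ s → s ≤ t → t ≤ b → ‖Y t - Y s‖ ≤ δ * (t - s) ^ β
  ctrl : CtrlBound X β a b D Y Y'

theorem CtrlBound.mono {X : ℝ → V} {β a b D a' b' D' : ℝ} {Y : ℝ → G} {Y' : ℝ → V →L[ℝ] G}
    (h : CtrlBound X β a b D Y Y') (ha : a ≤ a') (hb : b' ≤ b) (hD : D ≤ D') :
    CtrlBound X β a' b' D' Y Y' := by
  intro s t has hst htb
  obtain ⟨h1, h2⟩ := h s t (ha.trans has) hst (htb.trans hb)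
  have q1 := Real.rpow_nonneg (sub_nonneg.mpr hst) β
  have q2 := Real.rpow_nonneg (sub_nonneg.mpr hst) (2 * β)
  exact ⟨h1.trans (by gcongr), h2.trans (by gcongr)⟩

theorem CtrlPath.mono {X : ℝ → V} {β a b δ D a' b' δ' D' : ℝ} {Y : ℝ → G} {Y' : ℝ → V →L[ℝ] G}
    (h : CtrlPath X β a b δ D Y Y') (ha : a ≤ a') (hb : b' ≤ b) (hδ : δ ≤ δ') (hD : D ≤ D') :
    CtrlPath X β a' b' δ' D' Y Y' := by
  refine ⟨fun s h1 h2 => (h.val s (ha.trans h1) (h2.trans hb)).trans hδ,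
    fun s h1 h2 => (h.deriv s (ha.trans h1) (h2.trans hb)).trans hδ, fun s t h1 h2 h3 =>
    (h.incr s t (ha.trans h1) h2 (h3.trans hb)).trans ?_, h.ctrl.mono ha hb hD⟩
  exact mul_le_mul_of_nonneg_right hδ (Real.rpow_nonneg (sub_nonneg.mpr h2) β)

theorem CtrlBound.add {X : ℝ → V} {β a b D₁ D₂ : ℝ} {Y Z : ℝ → G} {Y' Z' : ℝ → V →L[ℝ] G}
    (h₁ : CtrlBound X β a b D₁ Y Y') (h₂ : CtrlBound X β a b D₂ Z Z') :
    CtrlBound X β a b (D₁ + D₂) (fun s => Y s + Z s) (fun s => Y' s + Z' s) := by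
  intro s t has hst htb
  obtain ⟨a1, a2⟩ := h₁ s t has hst htb
  obtain ⟨b1, b2⟩ := h₂ s t has hst htb
  rw [add_mul, add_mul]
  constructor
  · rw [add_sub_add_comm]
    exact (norm_add_le _ _).trans (add_le_add a1 b1)
  · rw [add_sub_add_comm, add_apply, add_sub_add_comm]
    exact (norm_add_le _ _).trans (add_le_add a2 b2)

theorem CtrlPath.add {X : ℝ → V} {β a b δ₁ D₁ δ₂ D₂ : ℝ} {Y Z : ℝ → G} {Y' Z' : ℝ → V →L[ℝ] G}
    (h₁ : CtrlPath X β a b δ₁ D₁ Y Y') (h₂ : CtrlPath X β a b δ₂ D₂ Z Z') :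
    CtrlPath X β a b (δ₁ + δ₂) (D₁ + D₂) (fun s => Y s + Z s) (fun s => Y' s + Z' s) := by
  refine ⟨fun s h1 h2 => (norm_add_le _ _).trans (add_le_add (h₁.val s h1 h2) (h₂.val s h1 h2)),
    fun s h1 h2 => (norm_add_le _ _).trans (add_le_add (h₁.deriv s h1 h2) (h₂.deriv s h1 h2)),
    fun s t h1 h2 h3 => ?_, h₁.ctrl.add h₂.ctrl⟩
  rw [add_mul, add_sub_add_comm]
  exact (norm_add_le _ _).trans (add_le_add (h₁.incr s t h1 h2 h3) (h₂.incr s t h1 h2 h3))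

/-- The Gubinelli derivative `s ↦ D F_s(Y_s) Y'_s` of `s ↦ F_s(Y_s)`. -/
def compDeriv (F : ℝ → W → G) (Y : ℝ → W) (Y' : ℝ → V →L[ℝ] W) (s : ℝ) : V →L[ℝ] G :=
  (fderiv ℝ (F s) (Y s)).comp (Y' s)

/-- The increments of the Gubinelli derivative of `F(Y) - F(Z)`. -/
theorem CoeffBound.norm_compDeriv_increment_le {T β C N δ D a b : ℝ} {F : ℝ → W → G}
    (hF : CoeffBound T (2 * β) C F) (hβ : 0 < β) (ha : 0 ≤ a) (hbT : b ≤ T) (hb1 : b ≤ 1)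
    (hN : 0 ≤ N) (hδ : 0 ≤ δ) (hδD : δ ≤ D) {X : ℝ → V} {Y Z : ℝ → W} {Y' Z' : ℝ → V →L[ℝ] W}
    (hY : CtrlPath X β a b N N Y Y') (hZ : CtrlPath X β a b N N Z Z')
    (hYZ : CtrlPath X β a b δ D (fun s => Y s - Z s) (fun s => Y' s - Z' s))
    {s t : ℝ} (h1 : a ≤ s) (h2 : s ≤ t) (h3 : t ≤ b) :
    ‖compDeriv F Y Y' t - compDeriv F Z Z' t - (compDeriv F Y Y' s - compDeriv F Z Z' s)‖
      ≤ C * (N + 2) ^ 2 * D * (t - s) ^ β := by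
  have hC := hF.nonneg
  have hD : 0 ≤ D := hδ.trans hδD
  have hs0 := ha.trans h1
  have hsT := h2.trans (h3.trans hbT)
  have htb := h1.trans h2
  have hsb := h2.trans h3
  have hτ : 0 ≤ t - s := sub_nonneg.mpr h2
  have q : (t - s) ^ (2 * β) ≤ (t - s) ^ β := by
    refine Real.rpow_le_rpow_of_exponent_ge' hτ (by linarith) hβ.le (by linarith)
  have q0 : 0 ≤ (t - s) ^ β := Real.rpow_nonneg hτ _
  have q2 : 0 ≤ (t - s) ^ (2 * β) := Real.rpow_nonneg hτ _
  obtain ⟨c1, -⟩ := hYZ.ctrl s t h1 h2 h3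
  obtain ⟨y1, -⟩ := hY.ctrl s t h1 h2 h3
  have i1 := hYZ.incr s t h1 h2 h3
  -- `B` and `B₀` are the derivatives of `F` along `Y` and `Z`
  set B : ℝ → W →L[ℝ] G := fun r => fderiv ℝ (F r) (Y r) with hB
  set B₀ : ℝ → W →L[ℝ] G := fun r => fderiv ℝ (F r) (Z r) with hB₀
  have e : compDeriv F Y Y' t - compDeriv F Z Z' t - (compDeriv F Y Y' s - compDeriv F Z Z' s)
      = ((B t - B₀ t) - (B s - B₀ s)).comp (Y' t) + (B s - B₀ s).comp (Y' t - Y' s)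
        + (B₀ t - B₀ s).comp (Y' t - Z' t)
        + (B₀ s).comp ((Y' t - Z' t) - (Y' s - Z' s)) := by
    simp only [compDeriv, hB, hB₀, ContinuousLinearMap.sub_comp, ContinuousLinearMap.comp_sub]
    abel
  have b1 : ‖(B t - B₀ t) - (B s - B₀ s)‖ ≤ C * (N + 2) * δ * (t - s) ^ β := by
    have t1 := hF.time_lip_deriv s t hs0 h2 (h3.trans hbT) (Y t) (Z t)
    have t2 := hF.four_point_deriv s hs0 hsT (Y s) (Y t) (Z s) (Z t)
    calc _ = ‖((fderiv ℝ (F t) (Y t) - fderiv ℝ (F s) (Y t))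
          - (fderiv ℝ (F t) (Z t) - fderiv ℝ (F s) (Z t)))
          + ((fderiv ℝ (F s) (Y t) - fderiv ℝ (F s) (Z t))
          - (fderiv ℝ (F s) (Y s) - fderiv ℝ (F s) (Z s)))‖ := by
          congr 1; simp only [hB, hB₀]; abel
      _ ≤ C * (t - s) ^ (2 * β) * ‖Y t - Z t‖ + (C * ‖Y t - Z t - (Y s - Z s)‖
          + C * ‖Y s - Z s‖ * ‖Z t - Z s‖) := (norm_add_le _ _).trans (add_le_add t1 t2)
      _ ≤ C * (t - s) ^ β * δ + (C * (δ * (t - s) ^ β) + C * δ * (N * (t - s) ^ β)) := by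
          gcongr
          · exact hYZ.val t (h1.trans h2) h3
          · exact hYZ.val s h1 (h2.trans h3)
          · exact hZ.incr s t h1 h2 h3
      _ = C * (N + 2) * δ * (t - s) ^ β := by ring
  have b2 : ‖B s - B₀ s‖ ≤ C * δ :=
    (hF.lip_deriv s hs0 hsT _ _).trans (by gcongr; exact hYZ.val s h1 hsb)
  have b3 : ‖B₀ t - B₀ s‖ ≤ C * (N + 1) * (t - s) ^ β := by
    have t1 := hF.time_deriv s t hs0 h2 (h3.trans hbT) (Z t)
    have t2 := hF.lip_deriv s hs0 hsT (Z t) (Z s)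
    calc _ = ‖(fderiv ℝ (F t) (Z t) - fderiv ℝ (F s) (Z t))
          + (fderiv ℝ (F s) (Z t) - fderiv ℝ (F s) (Z s))‖ := by
          congr 1; simp only [hB₀]; abel
      _ ≤ C * (t - s) ^ (2 * β) + C * ‖Z t - Z s‖ :=
          (norm_add_le _ _).trans (add_le_add t1 t2)
      _ ≤ C * (t - s) ^ β + C * (N * (t - s) ^ β) := by
          gcongr
          exact hZ.incr s t h1 h2 h3
      _ = _ := by ring
  rw [e]
  calc _ ≤ ‖(B t - B₀ t) - (B s - B₀ s)‖ * ‖Y' t‖ + ‖B s - B₀ s‖ * ‖Y' t - Y' s‖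
        + ‖B₀ t - B₀ s‖ * ‖Y' t - Z' t‖
        + ‖B₀ s‖ * ‖(Y' t - Z' t) - (Y' s - Z' s)‖ := by
        refine (norm_add_le _ _).trans (add_le_add ((norm_add_le _ _).trans (add_le_add
          ((norm_add_le _ _).trans (add_le_add ?_ ?_)) ?_)) ?_) <;>
          exact ContinuousLinearMap.opNorm_comp_le _ _
    _ ≤ (C * (N + 2) * δ * (t - s) ^ β) * N + (C * δ) * (N * (t - s) ^ β)
        + (C * (N + 1) * (t - s) ^ β) * δ + C * (D * (t - s) ^ β) := by
        gcongr
        · exact hY.deriv t htb h3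
        · exact hYZ.deriv t htb h3
        · exact hF.deriv s hs0 hsT _
    _ = C * (N ^ 2 + 4 * N + 1) * (t - s) ^ β * δ + C * (t - s) ^ β * D := by ring
    _ ≤ C * (N ^ 2 + 4 * N + 1) * (t - s) ^ β * D + C * (t - s) ^ β * D := by gcongr
    _ = C * (N ^ 2 + 4 * N + 2) * D * (t - s) ^ β := by ring
    _ ≤ _ := by gcongr; nlinarith

/-- The remainder of `F(Y) - F(Z)`: a time increment, a difference of Taylor remainders, and the
remainders of `Y` and `Y - Z` under the derivative of `F`. -/
theorem CoeffBound.norm_comp_remainder_le {T β C N δ D a b : ℝ} {F : ℝ → W → G}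
    (hF : CoeffBound T (2 * β) C F) (hβ : 0 < β) (ha : 0 ≤ a) (hbT : b ≤ T)
    (hN : 0 ≤ N) (hδ : 0 ≤ δ) (hδD : δ ≤ D) {X : ℝ → V} {Y Z : ℝ → W} {Y' Z' : ℝ → V →L[ℝ] W}
    (hY : CtrlPath X β a b N N Y Y') (hZ : CtrlPath X β a b N N Z Z')
    (hYZ : CtrlPath X β a b δ D (fun s => Y s - Z s) (fun s => Y' s - Z' s))
    {s t : ℝ} (h1 : a ≤ s) (h2 : s ≤ t) (h3 : t ≤ b) :
    ‖F t (Y t) - F t (Z t) - (F s (Y s) - F s (Z s))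
        - (compDeriv F Y Y' s - compDeriv F Z Z' s) (X t - X s)‖
      ≤ C * (N + 2) ^ 2 * D * (t - s) ^ (2 * β) := by
  have hC := hF.nonneg
  have hD : 0 ≤ D := hδ.trans hδD
  have hs0 := ha.trans h1
  have hsT := h2.trans (h3.trans hbT)
  have htb := h1.trans h2
  have hsb := h2.trans h3
  have hτ : 0 ≤ t - s := sub_nonneg.mpr h2
  have q0 : 0 ≤ (t - s) ^ β := Real.rpow_nonneg hτ _
  have q2 : 0 ≤ (t - s) ^ (2 * β) := Real.rpow_nonneg hτ _
  obtain ⟨-, c2⟩ := hYZ.ctrl s t h1 h2 h3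
  obtain ⟨-, y2⟩ := hY.ctrl s t h1 h2 h3
  have i1 := hYZ.incr s t h1 h2 h3
  have t1 := hF.time_lip s t hs0 h2 (h3.trans hbT) (Y t) (Z t)
  have t2 := norm_taylor_sub_taylor_le (hF.diff s hs0 hsT) hC hC (hF.lip_deriv s hs0 hsT)
    (hF.four_point_deriv s hs0 hsT) (Y s) (Z s) (Y t - Y s) (Z t - Z s)
  rw [add_sub_cancel, add_sub_cancel] at t2
  have t3 := hF.lip_deriv s hs0 hsT (Y s) (Z s)
  have t4 := hF.deriv s hs0 hsT (Z s)
  have yi := hY.incr s t h1 h2 h3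
  have zi := hZ.incr s t h1 h2 h3
  have v1 := hYZ.val s h1 hsb
  have v2 := hYZ.val t htb h3
  set x := X t - X s
  -- the remainders of `Y` and of `Y - Z`
  set R := Y t - Y s - Y' s x with hR
  set R₀ := Y t - Z t - (Y s - Z s) - (Y' s - Z' s) x with hR₀
  have e : F t (Y t) - F t (Z t) - (F s (Y s) - F s (Z s))
        - (compDeriv F Y Y' s - compDeriv F Z Z' s) x
      = ((F t (Y t) - F s (Y t)) - (F t (Z t) - F s (Z t)))
        + ((F s (Y t) - F s (Y s) - fderiv ℝ (F s) (Y s) (Y t - Y s))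
          - (F s (Z t) - F s (Z s) - fderiv ℝ (F s) (Z s) (Z t - Z s)))
        + (fderiv ℝ (F s) (Y s) - fderiv ℝ (F s) (Z s)) R + fderiv ℝ (F s) (Z s) R₀ := by
    simp only [hR, hR₀, compDeriv, sub_apply, ContinuousLinearMap.comp_apply, map_sub]
    abel
  have hββ : (t - s) ^ β * (t - s) ^ β = (t - s) ^ (2 * β) := by
    rw [← Real.rpow_add_of_nonneg hτ hβ.le hβ.le, two_mul]
  have i1' : ‖Y t - Y s - (Z t - Z s)‖ ≤ δ * (t - s) ^ β := by
    rwa [sub_sub_sub_comm] at i1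
  rw [e]
  calc _ ≤ C * (t - s) ^ (2 * β) * ‖Y t - Z t‖
        + (C * (‖Y t - Y s‖ + ‖Z t - Z s‖) * ‖Y t - Y s - (Z t - Z s)‖
          + C * ‖Y s - Z s‖ * ‖Z t - Z s‖ ^ 2)
        + ‖fderiv ℝ (F s) (Y s) - fderiv ℝ (F s) (Z s)‖ * ‖R‖
        + ‖fderiv ℝ (F s) (Z s)‖ * ‖R₀‖ := by
        refine (norm_add_le _ _).trans (add_le_add ((norm_add_le _ _).trans (add_le_add
          ((norm_add_le _ _).trans (add_le_add t1 t2)) ?_)) ?_) <;>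
          exact ContinuousLinearMap.le_opNorm _ _
    _ ≤ C * (t - s) ^ (2 * β) * δ
        + (C * (N * (t - s) ^ β + N * (t - s) ^ β) * (δ * (t - s) ^ β)
          + C * δ * (N * (t - s) ^ β) ^ 2)
        + (C * δ) * (N * (t - s) ^ (2 * β)) + C * (D * (t - s) ^ (2 * β)) := by
        gcongr
        exact t3.trans (by gcongr)
    _ = C * (t - s) ^ (2 * β) * (1 + N) * δ
        + C * (2 * N + N ^ 2) * ((t - s) ^ β * (t - s) ^ β) * δ
        + C * (t - s) ^ (2 * β) * D := by ring
    _ ≤ C * (t - s) ^ (2 * β) * (1 + N) * D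
        + C * (2 * N + N ^ 2) * ((t - s) ^ β * (t - s) ^ β) * D
        + C * (t - s) ^ (2 * β) * D := by gcongr
    _ = C * (N ^ 2 + 3 * N + 2) * D * (t - s) ^ (2 * β) := by rw [hββ]; ring
    _ ≤ _ := by gcongr; nlinarith

/-- Local Lipschitz continuity of the composition of controlled paths with a `C_b^{2β,3}`
function. Both constants are propagated, since the smallness of `δ` has to survive. -/
theorem CoeffBound.ctrlPath_sub {T β C N δ D a b : ℝ} {F : ℝ → W → G}
    (hF : CoeffBound T (2 * β) C F) (hβ : 0 < β) (ha : 0 ≤ a) (hbT : b ≤ T) (hb1 : b ≤ 1)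
    (hN : 0 ≤ N) (hδ : 0 ≤ δ) (hδD : δ ≤ D) {X : ℝ → V} {Y Z : ℝ → W} {Y' Z' : ℝ → V →L[ℝ] W}
    (hY : CtrlPath X β a b N N Y Y') (hZ : CtrlPath X β a b N N Z Z')
    (hYZ : CtrlPath X β a b δ D (fun s => Y s - Z s) (fun s => Y' s - Z' s)) :
    CtrlPath X β a b (C * (N + 2) ^ 2 * δ) (C * (N + 2) ^ 2 * D)
      (fun s => F s (Y s) - F s (Z s))
      (fun s => compDeriv F Y Y' s - compDeriv F Z Z' s) := by
  have hC := hF.nonneg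
  have hD : 0 ≤ D := hδ.trans hδD
  refine ⟨fun s h1 h2 => ?_, fun s h1 h2 => ?_, fun s t h1 h2 h3 => ?_, fun s t h1 h2 h3 => ?_⟩
  · refine (hF.lip s (ha.trans h1) (h2.trans hbT) _ _).trans ?_
    have := hYZ.val s h1 h2
    calc C * ‖Y s - Z s‖ ≤ C * 1 * δ := by rw [mul_one]; gcongr
      _ ≤ C * (N + 2) ^ 2 * δ := by gcongr; nlinarith
  · have e : compDeriv F Y Y' s - compDeriv F Z Z' s
        = (fderiv ℝ (F s) (Y s) - fderiv ℝ (F s) (Z s)).comp (Y' s)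
          + (fderiv ℝ (F s) (Z s)).comp (Y' s - Z' s) := by
      simp only [compDeriv, ContinuousLinearMap.sub_comp, ContinuousLinearMap.comp_sub]; abel
    rw [e]
    have b1 := hF.lip_deriv s (ha.trans h1) (h2.trans hbT) (Y s) (Z s)
    have b2 := hF.deriv s (ha.trans h1) (h2.trans hbT) (Z s)
    calc _ ≤ ‖fderiv ℝ (F s) (Y s) - fderiv ℝ (F s) (Z s)‖ * ‖Y' s‖
          + ‖fderiv ℝ (F s) (Z s)‖ * ‖Y' s - Z' s‖ :=
          (norm_add_le _ _).trans (add_le_add (ContinuousLinearMap.opNorm_comp_le _ _)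
            (ContinuousLinearMap.opNorm_comp_le _ _))
      _ ≤ (C * δ) * N + C * δ := by
          gcongr
          · exact b1.trans (by gcongr; exact hYZ.val s h1 h2)
          · exact hY.deriv s h1 h2
          · exact hYZ.deriv s h1 h2
      _ = C * (N + 1) * δ := by ring
      _ ≤ C * (N + 2) ^ 2 * δ := by gcongr; nlinarith
  · have hs0 := ha.trans h1
    have hsT := h2.trans (h3.trans hbT)
    have hτ : 0 ≤ t - s := sub_nonneg.mpr h2
    have q : (t - s) ^ (2 * β) ≤ (t - s) ^ β := by
      refine Real.rpow_le_rpow_of_exponent_ge' hτ (by linarith) hβ.le (by linarith)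
    have q0 : 0 ≤ (t - s) ^ β := Real.rpow_nonneg hτ _
    have t1 := hF.time_lip s t hs0 h2 (h3.trans hbT) (Y t) (Z t)
    have t2 := norm_four_point_le (hF.diff s hs0 hsT) (hF.lip s hs0 hsT) (hF.lip_deriv s hs0 hsT)
      (Y s) (Y t) (Z s) (Z t)
    have i1 := hYZ.incr s t h1 h2 h3
    calc _ = ‖((F t (Y t) - F s (Y t)) - (F t (Z t) - F s (Z t)))
          + ((F s (Y t) - F s (Z t)) - (F s (Y s) - F s (Z s)))‖ := by congr 1; abel
      _ ≤ C * (t - s) ^ (2 * β) * ‖Y t - Z t‖ + (C * ‖Y t - Z t - (Y s - Z s)‖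
          + C * ‖Y s - Z s‖ * ‖Z t - Z s‖) := (norm_add_le _ _).trans (add_le_add t1 t2)
      _ ≤ C * (t - s) ^ β * δ + (C * (δ * (t - s) ^ β) + C * δ * (N * (t - s) ^ β)) := by
          gcongr
          · exact hYZ.val t (h1.trans h2) h3
          · exact hYZ.val s h1 (h2.trans h3)
          · exact hZ.incr s t h1 h2 h3
      _ = C * (N + 2) * δ * (t - s) ^ β := by ring
      _ ≤ C * (N + 2) ^ 2 * δ * (t - s) ^ β := by gcongr; nlinarith
  · exact ⟨hF.norm_compDeriv_increment_le hβ ha hbT hb1 hN hδ hδD hY hZ hYZ h1 h2 h3,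
      hF.norm_comp_remainder_le hβ ha hbT hN hδ hδD hY hZ hYZ h1 h2 h3⟩

theorem ctrlPath_zero (X : ℝ → V) {β a b N : ℝ} (hN : 0 ≤ N) :
    CtrlPath X β a b N N (fun _ => (0 : G)) (fun _ => 0) := by
  have q : ∀ s t γ : ℝ, s ≤ t → 0 ≤ N * (t - s) ^ γ := fun s t γ h =>
    mul_nonneg hN (Real.rpow_nonneg (sub_nonneg.mpr h) _)
  exact ⟨fun _ _ _ => by simpa using hN, fun _ _ _ => by simpa using hN,
    fun s t _ h _ => by simpa using q s t β h,
    fun s t _ h _ => ⟨by simpa using q s t β h, by simpa using q s t (2 * β) h⟩⟩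

/-- The composition of a controlled path with a `C_b^{2β,3}` function is a controlled path. -/
theorem CoeffBound.exists_ctrlPath {T β C N a b : ℝ} {F : ℝ → W → G}
    (hF : CoeffBound T (2 * β) C F) (hβ : 0 < β) (ha : 0 ≤ a) (hbT : b ≤ T) (hb1 : b ≤ 1)
    (hN : 0 ≤ N) {X : ℝ → V} {Y : ℝ → W} {Y' : ℝ → V →L[ℝ] W}
    (hY : CtrlPath X β a b N N Y Y') :
    ∃ K, 0 ≤ K ∧ CtrlPath X β a b K K (fun s => F s (Y s)) (compDeriv F Y Y') := by
  have hC := hF.nonneg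
  have h1 := hF.ctrlPath_sub hβ ha hbT hb1 hN hN le_rfl hY (ctrlPath_zero X hN)
    (by simpa using hY)
  have h2 : CtrlPath X β a b C C (fun s => F s 0) (compDeriv F (fun _ => 0) fun _ => 0) := by
    have e : ∀ s, compDeriv F (fun _ => 0) (fun _ => (0 : V →L[ℝ] W)) s = 0 := fun s => by
      simp [compDeriv]
    refine ⟨fun s h1 h2 => hF.val s (ha.trans h1) (h2.trans hbT) 0, fun s _ _ => by simpa [e],
      fun s t h1 h2 h3 => (hF.time s t (ha.trans h1) h2 (h3.trans hbT) 0).trans ?_,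
      fun s t h1 h2 h3 => ⟨?_, ?_⟩⟩
    · exact mul_le_mul_of_nonneg_left (Real.rpow_le_rpow_of_exponent_ge' (by linarith)
        (by linarith) hβ.le (by linarith)) hC
    · simpa [e] using mul_nonneg hC (Real.rpow_nonneg (sub_nonneg.mpr h2) _)
    · simpa [e] using hF.time s t (ha.trans h1) h2 (h3.trans hbT) 0
  exact ⟨C * (N + 2) ^ 2 * N + C, by positivity, by simpa using h1.add h2⟩

end ControlledComposition

/-! ### Convolution with the semigroup -/

section Convolution

variable {V : Type*} [NormedAddCommGroup V] [NormedSpace ℝ V]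
variable {E : Type*} [NormedAddCommGroup E] [NormedSpace ℝ E]
variable {W : Type*} [NormedAddCommGroup W] [NormedSpace ℝ W] [CompleteSpace W]
variable {X : ℝ → V} {XX : ℝ → ℝ → TensorSq V} {T β L : ℝ}

theorem KernelBound.exists_integral (hX : RoughBound T β L X XX) (hβ : 1 / 3 < β)
    (hβ' : β ≤ 1 / 2) {t κ δ D : ℝ} (htT : t ≤ T) (ht1 : t ≤ 1) (hκ : 0 ≤ κ) (hδ : 0 ≤ δ)
    (hδD : δ ≤ D) {K : ℝ → E →L[ℝ] W} (hK : KernelBound 0 t κ K) {g : ℝ → V →L[ℝ] E}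
    {g' : ℝ → V →L[ℝ] V →L[ℝ] E} (hg : CtrlPath X β 0 t δ D g g') :
    ∃ J : ℝ → W, ∀ r s : ℝ, 0 ≤ r → r ≤ s → s ≤ t →
      HasRoughIntegral X XX (kerPath K g) (kerDeriv K g') r s (J s - J r) ∧
      ‖J s - J r - roughGerm X XX (kerPath K g) (kerDeriv K g') r s‖
        ≤ 4 * sewConst (3 * β) * L * κ * D * (s - r) ^ (3 * β) := by
  have hD : 0 ≤ D := hδ.trans hδD
  obtain ⟨J, hJ⟩ := (hg.ctrl.kernel hβ' le_rfl ht1 hκ hK fun r h0 h1 =>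
    ⟨(hg.val r h0 h1).trans hδD, (hg.deriv r h0 h1).trans hδD⟩).exists_integral (XX := XX) hX hβ
      le_rfl htT (by positivity)
  exact ⟨J, fun r s h0 h1 h2 => ⟨(hJ r s h0 h1 h2).1, (hJ r s h0 h1 h2).2.trans_eq (by ring)⟩⟩

theorem norm_roughGerm_ker_le (hX : RoughBound T β L X XX) (hβ : 0 < β) {κ δ r s : ℝ}
    {K : ℝ → E →L[ℝ] W} {g : ℝ → V →L[ℝ] E} {g' : ℝ → V →L[ℝ] V →L[ℝ] E} (hδ : 0 ≤ δ)
    (hK : ‖K r‖ ≤ κ) (hg : ‖g r‖ ≤ δ) (hg' : ‖g' r‖ ≤ δ) (h0 : 0 ≤ r) (hrs : r ≤ s) (hsT : s ≤ T)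
    (hl : s - r ≤ 1) :
    ‖roughGerm X XX (kerPath K g) (kerDeriv K g') r s‖ ≤ 2 * κ * δ * L := by
  have hL := hX.nonneg
  have hκ : 0 ≤ κ := (norm_nonneg _).trans hK
  have q1 : (s - r) ^ β ≤ 1 := Real.rpow_le_one (by linarith) hl hβ.le
  have q2 : (s - r) ^ (2 * β) ≤ 1 := Real.rpow_le_one (by linarith) hl (by linarith)
  have x1 : ‖X s - X r‖ ≤ L := (hX.first r s h0 hrs hsT).trans (by nlinarith)
  have x2 : ‖XX r s‖ ≤ L := (hX.second r s h0 hrs hsT).trans (by nlinarith)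
  have k1 : ‖kerPath K g r‖ ≤ κ * δ :=
    (ContinuousLinearMap.opNorm_comp_le _ _).trans (by gcongr)
  have k2 : ‖kerDeriv K g' r‖ ≤ κ * δ := (norm_kerDeriv_le K g' r).trans (by gcongr)
  calc _ ≤ ‖kerPath K g r‖ * ‖X s - X r‖ + ‖kerDeriv K g' r‖ * ‖XX r s‖ :=
        (norm_add_le _ _).trans (add_le_add (ContinuousLinearMap.le_opNorm _ _)
          (norm_tensorLift_apply_le _ _))
    _ ≤ (κ * δ) * L + (κ * δ) * L := by gcongr
    _ = _ := by ring

/-- If `g` vanishes before time `a`, the integral of `K g` over `[0, s]` is only charged on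
`[a, s]`. -/
theorem HasRoughIntegral.norm_le_of_vanish (hX : RoughBound T β L X XX) (hβ : 1 / 3 < β)
    (hβ' : β ≤ 1 / 2) {a s κ δ D : ℝ} (ha : 0 ≤ a) (has : a ≤ s) (hsT : s ≤ T) (hs1 : s ≤ 1)
    (hκ : 0 ≤ κ) (hδ : 0 ≤ δ) (hδD : δ ≤ D) {K : ℝ → E →L[ℝ] W} (hK : KernelBound 0 s κ K)
    {g : ℝ → V →L[ℝ] E} {g' : ℝ → V →L[ℝ] V →L[ℝ] E} (hg : CtrlPath X β 0 s δ D g g')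
    (hvan : ∀ r, 0 ≤ r → r < a → g r = 0 ∧ g' r = 0) {I : W}
    (hI : HasRoughIntegral X XX (kerPath K g) (kerDeriv K g') 0 s I) :
    ‖I‖ ≤ κ * L * (2 * δ + 4 * sewConst (3 * β) * ((s - a) ^ (3 * β) * D)) := by
  obtain ⟨H, hH⟩ := hK.exists_integral hX hβ hβ' hsT hs1 hκ hδ hδD hg
  have e2 : H a - H 0 = 0 := by
    refine HasRoughIntegral.unique ha (hH 0 a le_rfl ha has).1 ?_
    refine (hasRoughIntegral_zero 0 a).congr (fun r h0 h1 => ?_) (fun r h0 h1 => ?_)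
    · rw [kerPath, (hvan r h0 h1).1, ContinuousLinearMap.comp_zero]
    · rw [kerDeriv, (hvan r h0 h1).2, ContinuousLinearMap.comp_zero]
  have e : I = H s - H a := by
    rw [hI.unique (ha.trans has) (hH 0 s le_rfl (ha.trans has) le_rfl).1,
      ← sub_sub_sub_cancel_right (H s) (H a) (H 0), e2, sub_zero]
  have g1 := norm_roughGerm_ker_le hX (by linarith) hδ (hK a a ha le_rfl has).1
    (hg.val a ha has) (hg.deriv a ha has) ha has hsT (by linarith)
  have g2 := (hH a s ha has le_rfl).2
  rw [e]
  calc ‖H s - H a‖ ≤ 2 * κ * δ * L + 4 * sewConst (3 * β) * L * κ * D * (s - a) ^ (3 * β) := by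
        have := norm_sub_norm_le (H s - H a) (roughGerm X XX (kerPath K g) (kerDeriv K g') a s)
        linarith
    _ = _ := by ring

variable {S : C0Semigroup W} {M : ℝ}

/-- The first order term of `∫_s^t S_{t-r} g_r d𝐗_r` is `g_s X_{s,t}`. -/
theorem norm_roughGerm_kernel_sub_le (hM1 : 1 ≤ M) (hM : ∀ t, 0 ≤ t → t ≤ 1 → ‖S.op t‖ ≤ M)
    (hX : RoughBound T β L X XX) (hβ : 0 < β) (hβ' : β ≤ 1 / 2) {δ s t : ℝ} (hδ : 0 ≤ δ)
    {g : ℝ → V →L[ℝ] S.Dom 2} {g' : ℝ → V →L[ℝ] V →L[ℝ] S.Dom 2}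
    (hg : ‖g s‖ ≤ δ) (hg' : ‖g' s‖ ≤ δ) (hs : 0 ≤ s) (hst : s ≤ t) (htT : t ≤ T) (ht1 : t ≤ 1) :
    ‖roughGerm X XX (kerPath (S.kernel t) g) (kerDeriv (S.kernel t) g') s t
        - S.incl 2 (g s (X t - X s))‖ ≤ 2 * M * δ * L * (t - s) ^ (2 * β) := by
  have hL := hX.nonneg
  have hM0 : 0 ≤ M := by linarith
  have hτ : 0 ≤ t - s := sub_nonneg.mpr hst
  have q1 : (t - s) ^ β ≤ 1 := Real.rpow_le_one hτ (by linarith) hβ.le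
  have q2 : t - s ≤ (t - s) ^ (2 * β) := le_rpow_of_le_one hτ (by linarith) (by linarith)
  have x1 : ‖X t - X s‖ ≤ L := (hX.first s t hs hst htT).trans (by nlinarith)
  have x2 := hX.second s t hs hst htT
  have k2 : ‖kerDeriv (S.kernel t) g' s‖ ≤ M * δ := (norm_kerDeriv_le _ g' s).trans
    (mul_le_mul (C0Semigroup.norm_op_comp_incl_le hM1 hM 2 hτ (by linarith)) hg'
      (norm_nonneg (g' s)) hM0)
  have e : roughGerm X XX (kerPath (S.kernel t) g) (kerDeriv (S.kernel t) g') s t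
        - S.incl 2 (g s (X t - X s))
      = ((S.op (t - s)).comp (S.incl 2) - (S.op 0).comp (S.incl 2)) (g s (X t - X s))
        + tensorLift (kerDeriv (S.kernel t) g' s) (XX s t) := by
    rw [S.op_zero]
    simp only [roughGerm, kerPath, C0Semigroup.kernel, sub_apply, ContinuousLinearMap.comp_apply,
      ContinuousLinearMap.id_apply]
    abel
  have k1 := C0Semigroup.norm_op_comp_incl_sub_le hM1 hM (S := S) (n := 2) (by norm_num)
    le_rfl hτ (by linarith)
  rw [sub_zero] at k1
  rw [e]
  calc _ ≤ ‖(S.op (t - s)).comp (S.incl 2) - (S.op 0).comp (S.incl 2)‖ * (‖g s‖ * ‖X t - X s‖)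
        + ‖kerDeriv (S.kernel t) g' s‖ * ‖XX s t‖ := by
        refine (norm_add_le _ _).trans (add_le_add ?_ (norm_tensorLift_apply_le _ _))
        exact (ContinuousLinearMap.le_opNorm _ _).trans
          (mul_le_mul_of_nonneg_left (ContinuousLinearMap.le_opNorm _ _) (norm_nonneg _))
    _ ≤ (M * (t - s) ^ (2 * β)) * (δ * L) + (M * δ) * (L * (t - s) ^ (2 * β)) := by
        gcongr
        exact k1.trans (by gcongr)
    _ = _ := by ring

/-- The rough convolution `I_t = ∫_0^t S_{t-r} g_r d𝐗_r` exists and is controlled by `X` with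
Gubinelli derivative `g`. If `g` vanishes before time `a`, then on `[a, b]` the remainder is small:
the term `D` that comes from the Hölder seminorms of `g` carries the factor `(b - a)^β`. -/
theorem exists_rough_convolution (hM1 : 1 ≤ M) (hM : ∀ t, 0 ≤ t → t ≤ 1 → ‖S.op t‖ ≤ M)
    (hX : RoughBound T β L X XX) (hβ : 1 / 3 < β) (hβ' : β ≤ 1 / 2) {a b δ D : ℝ} (ha : 0 ≤ a)
    (hbT : b ≤ T) (hb1 : b ≤ 1) (hδ : 0 ≤ δ) (hδD : δ ≤ D)
    {g : ℝ → V →L[ℝ] S.Dom 2} {g' : ℝ → V →L[ℝ] V →L[ℝ] S.Dom 2}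
    (hg : CtrlPath X β 0 b δ D g g')
    (hvan : ∀ r, 0 ≤ r → r < a → g r = 0 ∧ g' r = 0) :
    ∃ I : ℝ → W,
      (∀ t, 0 ≤ t → t ≤ b → HasRoughIntegral X XX (kerPath (S.kernel t) g)
        (kerDeriv (S.kernel t) g') 0 t (I t)) ∧
      ∀ s t, a ≤ s → s ≤ t → t ≤ b → ‖I t - I s - S.incl 2 (g s (X t - X s))‖
        ≤ (4 + 8 * sewConst (3 * β)) * M ^ 3 * L * (δ + (b - a) ^ β * D) * (t - s) ^ (2 * β) := by
  have hM0 : 0 ≤ M := by linarith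
  have hL := hX.nonneg
  have hD : 0 ≤ D := hδ.trans hδD
  have hc := (sewConst_pos (by linarith : 1 < 3 * β)).le
  have hM3 : M ≤ M ^ 3 := le_self_pow₀ hM1 (by norm_num)
  have hex : ∀ t : ℝ, ∃ J : ℝ → W, t ≤ b → ∀ r s : ℝ, 0 ≤ r → r ≤ s → s ≤ t →
      HasRoughIntegral X XX (kerPath (S.kernel t) g) (kerDeriv (S.kernel t) g') r s (J s - J r) ∧
      ‖J s - J r - roughGerm X XX (kerPath (S.kernel t) g) (kerDeriv (S.kernel t) g') r s‖
        ≤ 4 * sewConst (3 * β) * L * M * D * (s - r) ^ (3 * β) := by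
    intro t
    by_cases htb : t ≤ b
    · obtain ⟨J, hJ⟩ := (C0Semigroup.kernelBound_kernel hM1 hM (htb.trans hb1)).exists_integral
        hX hβ hβ' (htb.trans hbT) (htb.trans hb1) hM0 hδ hδD (hg.mono le_rfl htb le_rfl le_rfl)
      exact ⟨J, fun _ => hJ⟩
    · exact ⟨0, fun h => absurd h htb⟩
  choose J hJ using hex
  refine ⟨fun t => J t t - J t 0, fun t h0 htb => (hJ t htb 0 t le_rfl h0 le_rfl).1,
    fun s t has hst htb => ?_⟩
  have hs0 := ha.trans has
  have hsb := hst.trans htb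
  have ht1 := htb.trans hb1
  have hτ : 0 ≤ t - s := sub_nonneg.mpr hst
  have q2 : t - s ≤ (t - s) ^ (2 * β) := le_rpow_of_le_one hτ (by linarith) (by linarith)
  have q3 : (t - s) ^ (3 * β) ≤ (b - a) ^ β * (t - s) ^ (2 * β) := by
    rw [show 3 * β = β + 2 * β by ring, Real.rpow_add_of_nonneg hτ (by linarith) (by linarith)]
    gcongr
  have q4 : (s - a) ^ (3 * β) ≤ (b - a) ^ β :=
    (Real.rpow_le_rpow_of_exponent_ge' (by linarith) (by linarith) (by linarith)
      (by linarith : β ≤ 3 * β)).trans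
      (Real.rpow_le_rpow (by linarith) (by linarith) (by linarith))
  have q0 : 0 ≤ (b - a) ^ β := Real.rpow_nonneg (by linarith) _
  -- the part of the integral over `[0, s]` is an integral with the difference of the kernels
  have hκ : 0 ≤ M ^ 3 * (t - s) := by positivity
  have hKd := C0Semigroup.kernelBound_kernel_sub (S := S) hM1 hM hst ht1
  have e1 : HasRoughIntegral X XX (kerPath (fun r => S.kernel t r - S.kernel s r) g)
      (kerDeriv (fun r => S.kernel t r - S.kernel s r) g') 0 s
      ((J t s - J t 0) - (J s s - J s 0)) :=
    ((hJ t htb 0 s le_rfl hs0 hst).1.sub (hJ s hsb 0 s le_rfl hs0 le_rfl).1).congr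
      (fun r _ _ => kerPath_sub _ _ _ _) (fun r _ _ => kerDeriv_sub _ _ _ _)
  have b1 : ‖(J t s - J t 0) - (J s s - J s 0)‖ ≤ M ^ 3 * (t - s) ^ (2 * β) * L
      * (2 * δ + 4 * sewConst (3 * β) * ((b - a) ^ β * D)) := by
    refine (e1.norm_le_of_vanish hX hβ hβ' ha has (hsb.trans hbT) (hsb.trans hb1) hκ hδ hδD hKd
      (hg.mono le_rfl hsb le_rfl le_rfl) hvan).trans ?_
    have : 0 ≤ (s - a) ^ (3 * β) := Real.rpow_nonneg (by linarith) _
    gcongr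
  have b2 := norm_roughGerm_kernel_sub_le hM1 hM hX (by linarith) hβ' hδ (hg.val s hs0 hsb)
    (hg.deriv s hs0 hsb) hs0 hst (htb.trans hbT) ht1
  have b3 := (hJ t htb s t hs0 hst le_rfl).2
  have hd : J t t - J t 0 - (J s s - J s 0) - S.incl 2 (g s (X t - X s))
      = ((J t s - J t 0) - (J s s - J s 0))
        + (roughGerm X XX (kerPath (S.kernel t) g) (kerDeriv (S.kernel t) g') s t
          - S.incl 2 (g s (X t - X s)))
        + (J t t - J t s
          - roughGerm X XX (kerPath (S.kernel t) g) (kerDeriv (S.kernel t) g') s t) := by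
    abel
  rw [hd]
  have qq : 0 ≤ (t - s) ^ (2 * β) := Real.rpow_nonneg hτ _
  calc _ ≤ M ^ 3 * (t - s) ^ (2 * β) * L * (2 * δ + 4 * sewConst (3 * β) * ((b - a) ^ β * D))
        + 2 * M * δ * L * (t - s) ^ (2 * β)
        + 4 * sewConst (3 * β) * L * M * D * (t - s) ^ (3 * β) :=
        (norm_add_le _ _).trans (add_le_add ((norm_add_le _ _).trans (add_le_add b1 b2)) b3)
    _ ≤ M ^ 3 * (t - s) ^ (2 * β) * L * (2 * δ + 4 * sewConst (3 * β) * ((b - a) ^ β * D))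
        + 2 * M ^ 3 * δ * L * (t - s) ^ (2 * β)
        + 4 * sewConst (3 * β) * L * M ^ 3 * D * ((b - a) ^ β * (t - s) ^ (2 * β)) := by
        gcongr
    _ = M ^ 3 * L * (t - s) ^ (2 * β) * (4 * δ + 8 * sewConst (3 * β) * ((b - a) ^ β * D)) := by
        ring
    _ ≤ M ^ 3 * L * (t - s) ^ (2 * β)
        * ((4 + 8 * sewConst (3 * β)) * δ + (4 + 8 * sewConst (3 * β)) * ((b - a) ^ β * D)) := by
        gcongr <;> linarith
    _ = _ := by ring

end Convolution

section Drift

variable {W : Type*} [NormedAddCommGroup W] [NormedSpace ℝ W] {S : C0Semigroup W} {M : ℝ}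

/-- The convolution `∫_0^t S_{t-r} φ_r dr` of the drift. -/
def driftConv (S : C0Semigroup W) (φ : ℝ → S.Dom 1) (t : ℝ) : W :=
  ∫ r in (0 : ℝ)..t, S.op (t - r) (S.incl 1 (φ r))

theorem continuousOn_op_incl (hM1 : 1 ≤ M) (hM : ∀ t, 0 ≤ t → t ≤ 1 → ‖S.op t‖ ≤ M) {s t : ℝ}
    (hs : s ≤ t) (ht : t ≤ 1) {φ : ℝ → S.Dom 1} (hφ : ContinuousOn φ (Icc 0 s)) :
    ContinuousOn (fun r => S.op (t - r) (S.incl 1 (φ r))) (Icc 0 s) := by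
  have hK : ContinuousOn (fun r => (S.op (t - r)).comp (S.incl 1)) (Icc 0 s) := by
    refine (LipschitzOnWith.of_dist_le_mul (K := M.toNNReal) fun x hx y hy => ?_).continuousOn
    rw [Real.coe_toNNReal M (by linarith), dist_eq_norm, Real.dist_eq]
    rcases le_total x y with h | h
    · refine (C0Semigroup.norm_op_comp_incl_sub_le hM1 hM le_rfl (by linarith [hy.2])
        (by linarith) (by linarith [hx.1])).trans_eq ?_
      rw [abs_sub_comm, abs_of_nonneg (by linarith)]; ring
    · rw [norm_sub_rev]
      refine (C0Semigroup.norm_op_comp_incl_sub_le hM1 hM le_rfl (by linarith [hx.2])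
        (by linarith) (by linarith [hy.1])).trans_eq ?_
      rw [abs_of_nonneg (by linarith)]; ring
  exact hK.clm_apply hφ

/-- The drift takes values in `D(A)`, so its convolution is Lipschitz in time. -/
theorem norm_driftConv_sub_le (hM1 : 1 ≤ M) (hM : ∀ t, 0 ≤ t → t ≤ 1 → ‖S.op t‖ ≤ M) {b B : ℝ}
    (hb : b ≤ 1) {φ : ℝ → S.Dom 1} (hφ : ContinuousOn φ (Icc 0 b))
    (hB : ∀ r, 0 ≤ r → r ≤ b → ‖φ r‖ ≤ B) {s t : ℝ} (hs : 0 ≤ s) (hst : s ≤ t) (htb : t ≤ b) :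
    ‖driftConv S φ t - driftConv S φ s‖ ≤ 2 * M * B * (t - s) := by
  have hM0 : 0 ≤ M := by linarith
  have hB0 : 0 ≤ B := (norm_nonneg _).trans (hB s hs (hst.trans htb))
  have hτ : 0 ≤ t - s := sub_nonneg.mpr hst
  have c1 := continuousOn_op_incl hM1 hM le_rfl (htb.trans hb)
    (hφ.mono (Icc_subset_Icc_right htb))
  have c2 := continuousOn_op_incl hM1 hM le_rfl ((hst.trans htb).trans hb)
    (hφ.mono (Icc_subset_Icc_right (hst.trans htb)))
  have i1 : IntervalIntegrable (fun r => S.op (t - r) (S.incl 1 (φ r))) MeasureTheory.volume 0 s :=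
    (c1.mono (Icc_subset_Icc_right hst)).intervalIntegrable_of_Icc hs
  have i2 : IntervalIntegrable (fun r => S.op (t - r) (S.incl 1 (φ r))) MeasureTheory.volume s t :=
    (c1.mono (Icc_subset_Icc_left hs)).intervalIntegrable_of_Icc hst
  have i3 : IntervalIntegrable (fun r => S.op (s - r) (S.incl 1 (φ r))) MeasureTheory.volume 0 s :=
    c2.intervalIntegrable_of_Icc hs
  have e : driftConv S φ t - driftConv S φ s
      = (∫ r in s..t, S.op (t - r) (S.incl 1 (φ r)))
        + ∫ r in (0 : ℝ)..s, (S.op (t - r) (S.incl 1 (φ r)) - S.op (s - r) (S.incl 1 (φ r))) := by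
    rw [intervalIntegral.integral_sub i1 i3, driftConv, driftConv,
      ← intervalIntegral.integral_add_adjacent_intervals i1 i2]
    abel
  have b1 : ‖∫ r in s..t, S.op (t - r) (S.incl 1 (φ r))‖ ≤ M * B * |t - s| := by
    refine intervalIntegral.norm_integral_le_of_norm_le_const fun r hr => ?_
    rw [uIoc_of_le hst] at hr
    have hr0 : 0 ≤ r := hs.trans hr.1.le
    have := C0Semigroup.norm_op_comp_incl_le (S := S) hM1 hM 1 (by linarith [hr.2] : 0 ≤ t - r)
      (by linarith)
    exact (((S.op (t - r)).comp (S.incl 1)).le_of_opNorm_le this (φ r)).trans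
      (by gcongr; exact hB r hr0 (hr.2.trans htb))
  have b2 : ‖∫ r in (0 : ℝ)..s,
      (S.op (t - r) (S.incl 1 (φ r)) - S.op (s - r) (S.incl 1 (φ r)))‖
        ≤ M * (t - s) * B * |s - 0| := by
    refine intervalIntegral.norm_integral_le_of_norm_le_const fun r hr => ?_
    rw [uIoc_of_le hs] at hr
    have := C0Semigroup.norm_op_comp_incl_sub_le (S := S) hM1 hM (le_refl 1)
      (by linarith [hr.2] : 0 ≤ s - r) (by linarith : s - r ≤ t - r) (by linarith [hr.1])
    rw [sub_sub_sub_cancel_right] at this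
    exact (((S.op (t - r)).comp (S.incl 1) - (S.op (s - r)).comp (S.incl 1)).le_of_opNorm_le
      this (φ r)).trans
      (by gcongr; exact hB r hr.1.le (hr.2.trans (hst.trans htb)))
  rw [abs_of_nonneg hτ] at b1
  rw [sub_zero, abs_of_nonneg hs] at b2
  rw [e]
  calc _ ≤ M * B * (t - s) + M * (t - s) * B * s := (norm_add_le _ _).trans (add_le_add b1 b2)
    _ ≤ M * B * (t - s) + M * (t - s) * B * 1 := by gcongr; linarith
    _ = _ := by ring

theorem driftConv_sub (hM1 : 1 ≤ M) (hM : ∀ t, 0 ≤ t → t ≤ 1 → ‖S.op t‖ ≤ M) {t : ℝ}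
    (h0 : 0 ≤ t) (ht : t ≤ 1) {φ ψ : ℝ → S.Dom 1} (hφ : ContinuousOn φ (Icc 0 t))
    (hψ : ContinuousOn ψ (Icc 0 t)) :
    driftConv S φ t - driftConv S ψ t = driftConv S (fun r => φ r - ψ r) t := by
  have i1 := (continuousOn_op_incl hM1 hM le_rfl ht hφ).intervalIntegrable_of_Icc
    (μ := MeasureTheory.volume) h0
  have i2 := (continuousOn_op_incl hM1 hM le_rfl ht hψ).intervalIntegrable_of_Icc
    (μ := MeasureTheory.volume) h0
  simp only [driftConv, map_sub]
  exact (intervalIntegral.integral_sub i1 i2).symm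

end Drift

/-! ### Controlled paths on short intervals -/

section ControlledTools

variable {V : Type*} [NormedAddCommGroup V] [NormedSpace ℝ V]
variable {G : Type*} [NormedAddCommGroup G] [NormedSpace ℝ G]
variable {X : ℝ → V} {XX : ℝ → ℝ → TensorSq V} {T β L : ℝ}

theorem CtrlBound.sub {a b D₁ D₂ : ℝ} {Y Z : ℝ → G} {Y' Z' : ℝ → V →L[ℝ] G}
    (h₁ : CtrlBound X β a b D₁ Y Y') (h₂ : CtrlBound X β a b D₂ Z Z') :
    CtrlBound X β a b (D₁ + D₂) (fun s => Y s - Z s) (fun s => Y' s - Z' s) := by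
  have h₃ : CtrlBound X β a b D₂ (fun s => -Z s) (fun s => -Z' s) := by
    intro s t h1 h2 h3
    obtain ⟨b1, b2⟩ := h₂ s t h1 h2 h3
    constructor
    · rw [show -Z' t - -Z' s = -(Z' t - Z' s) by abel, norm_neg]
      exact b1
    · rw [neg_apply, show -Z t - -Z s - -(Z' s (X t - X s)) = -(Z t - Z s - Z' s (X t - X s)) by
        abel, norm_neg]
      exact b2
  simpa only [sub_eq_add_neg] using h₁.add h₃

/-- Bounds with a constant depending on the length of the interval, from the values at the left
end point and the seminorm. -/
theorem CtrlBound.ctrlPath_of_le (hX : RoughBound T β L X XX) (hβ : 0 < β) {a b A D ε : ℝ}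
    (ha : 0 ≤ a) (hbT : b ≤ T) (hD : 0 ≤ D) (hε : (b - a) ^ β ≤ ε) (hε1 : ε ≤ 1)
    {Y : ℝ → G} {Y' : ℝ → V →L[ℝ] G}
    (h : CtrlBound X β a b D Y Y') (h0 : ‖Y a‖ ≤ A) (h0' : ‖Y' a‖ ≤ A) :
    CtrlPath X β a b ((L + 1) * (A + ε * D)) ((L + 1) * D) Y Y' := by
  have hL := hX.nonneg
  have hA : 0 ≤ A := (norm_nonneg _).trans h0
  have hd : ∀ s, a ≤ s → s ≤ b → ‖Y' s‖ ≤ A + ε * D := by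
    intro s h1 h2
    have h3 := (h a s le_rfl h1 h2).1
    have h4 : (s - a) ^ β ≤ ε := (Real.rpow_le_rpow (by linarith) (by linarith) hβ.le).trans hε
    have h5 := norm_sub_norm_le (Y' s) (Y' a)
    nlinarith
  have hi : ∀ s t, a ≤ s → s ≤ t → t ≤ b →
      ‖Y t - Y s‖ ≤ (L * A + (L + 1) * (ε * D)) * (t - s) ^ β := by
    intro s t h1 h2 h3
    have hτ : 0 ≤ t - s := sub_nonneg.mpr h2
    have q0 : 0 ≤ (t - s) ^ β := Real.rpow_nonneg hτ _
    have q1 : (t - s) ^ β ≤ ε := (Real.rpow_le_rpow hτ (by linarith) hβ.le).trans hε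
    have hββ : (t - s) ^ (2 * β) = (t - s) ^ β * (t - s) ^ β := by
      rw [← Real.rpow_add_of_nonneg hτ hβ.le hβ.le, two_mul]
    have hR := (h s t h1 h2 h3).2
    have hx := hX.first s t (ha.trans h1) h2 (h3.trans hbT)
    have hY' := hd s h1 (h2.trans h3)
    calc ‖Y t - Y s‖ = ‖(Y t - Y s - Y' s (X t - X s)) + Y' s (X t - X s)‖ := by
          rw [sub_add_cancel]
      _ ≤ D * (t - s) ^ (2 * β) + ‖Y' s‖ * ‖X t - X s‖ :=
          (norm_add_le _ _).trans (add_le_add hR (ContinuousLinearMap.le_opNorm _ _))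
      _ ≤ D * (ε * (t - s) ^ β) + (A + ε * D) * (L * (t - s) ^ β) := by
          rw [hββ]
          have : 0 ≤ A + ε * D := (norm_nonneg _).trans hY'
          gcongr
      _ = _ := by ring
  have hε0 : a ≤ b → 0 ≤ ε := fun hab => (Real.rpow_nonneg (by linarith) _).trans hε
  refine ⟨fun s h1 h2 => ?_, fun s h1 h2 => (hd s h1 h2).trans ?_, fun s t h1 h2 h3 =>
    (hi s t h1 h2 h3).trans ?_, h.mono le_rfl le_rfl (by nlinarith)⟩
  · have h3 := hi a s le_rfl h1 h2
    have h4 : (s - a) ^ β ≤ 1 :=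
      ((Real.rpow_le_rpow (by linarith) (by linarith) hβ.le).trans hε).trans hε1
    have h5 := norm_sub_norm_le (Y s) (Y a)
    have h6 : 0 ≤ L * A + (L + 1) * (ε * D) := by
      have := hε0 (h1.trans h2); positivity
    nlinarith
  · have := hε0 (h1.trans h2)
    have : 0 ≤ L * (A + ε * D) := by positivity
    linarith
  · refine mul_le_mul_of_nonneg_right ?_ (Real.rpow_nonneg (sub_nonneg.mpr h2) _)
    nlinarith

theorem CtrlBound.ctrlPath (hX : RoughBound T β L X XX) (hβ : 0 < β) {a b A D : ℝ}
    (ha : 0 ≤ a) (hab : a ≤ b) (hbT : b ≤ T) (hb1 : b ≤ 1) (hD : 0 ≤ D)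
    {Y : ℝ → G} {Y' : ℝ → V →L[ℝ] G}
    (h : CtrlBound X β a b D Y Y') (h0 : ‖Y a‖ ≤ A) (h0' : ‖Y' a‖ ≤ A) :
    CtrlPath X β a b ((L + 1) * (A + D)) ((L + 1) * (A + D)) Y Y' := by
  have hL := hX.nonneg
  have hA : 0 ≤ A := (norm_nonneg _).trans h0
  have := h.ctrlPath_of_le hX hβ ha hbT hD
    (Real.rpow_le_one (by linarith) (by linarith) hβ.le) le_rfl h0 h0'
  rw [one_mul] at this
  exact this.mono le_rfl le_rfl le_rfl (by gcongr; linarith)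

/-- A controlled path that vanishes on `[0, a]` obeys the same bounds on `[0, b]` as on `[a, b]`. -/
theorem CtrlPath.extend {a b δ D : ℝ} (hβ : 0 < β) (hδ : 0 ≤ δ) (hD : 0 ≤ D)
    {Y : ℝ → G} {Y' : ℝ → V →L[ℝ] G}
    (h : CtrlPath X β a b δ D Y Y') (hY : ∀ s, 0 ≤ s → s ≤ a → Y s = 0 ∧ Y' s = 0) :
    CtrlPath X β 0 b δ D Y Y' := by
  refine ⟨fun s h1 h2 => ?_, fun s h1 h2 => ?_, fun s t h1 h2 h3 => ?_, fun s t h1 h2 h3 => ?_⟩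
  · rcases le_total s a with hs | hs
    · rw [(hY s h1 hs).1, norm_zero]; exact hδ
    · exact h.val s hs h2
  · rcases le_total s a with hs | hs
    · rw [(hY s h1 hs).2, norm_zero]; exact hδ
    · exact h.deriv s hs h2
  · rcases le_total a s with hs | hs
    · exact h.incr s t hs h2 h3
    have hm : ∀ γ : ℝ, 0 ≤ γ → 0 ≤ (t - s) ^ γ := fun γ _ => Real.rpow_nonneg (by linarith) _
    rcases le_total t a with ht | ht
    · rw [(hY s h1 hs).1, (hY t (h1.trans h2) ht).1, sub_zero, norm_zero]
      exact mul_nonneg hδ (hm β hβ.le)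
    · rw [(hY s h1 hs).1, ← (hY a (h1.trans hs) le_rfl).1]
      refine (h.incr a t le_rfl ht h3).trans (mul_le_mul_of_nonneg_left ?_ hδ)
      exact Real.rpow_le_rpow (by linarith) (by linarith) hβ.le
  · rcases le_total a s with hs | hs
    · exact h.ctrl s t hs h2 h3
    rcases le_total t a with ht | ht
    · rw [(hY s h1 hs).1, (hY t (h1.trans h2) ht).1, (hY s h1 hs).2, (hY t (h1.trans h2) ht).2]
      simp only [sub_zero, norm_zero, zero_apply]
      exact ⟨mul_nonneg hD (Real.rpow_nonneg (by linarith) _),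
        mul_nonneg hD (Real.rpow_nonneg (by linarith) _)⟩
    · obtain ⟨c1, c2⟩ := h.ctrl a t le_rfl ht h3
      obtain ⟨z1, z2⟩ := hY a (h1.trans hs) le_rfl
      rw [z2] at c1 c2
      rw [z1] at c2
      rw [(hY s h1 hs).1, (hY s h1 hs).2]
      rw [zero_apply] at c2 ⊢
      exact ⟨c1.trans (mul_le_mul_of_nonneg_left
          (Real.rpow_le_rpow (by linarith) (by linarith) hβ.le) hD),
        c2.trans (mul_le_mul_of_nonneg_left
          (Real.rpow_le_rpow (by linarith) (by linarith) (by linarith)) hD)⟩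

theorem CtrlPath.continuousOn {b δ D : ℝ} (hβ : 0 < β) {Y : ℝ → G} {Y' : ℝ → V →L[ℝ] G}
    (h : CtrlPath X β 0 b δ D Y Y') : ContinuousOn Y (Icc 0 b) := by
  intro s hs
  have hb : ∀ t ∈ Icc 0 b, dist (Y t) (Y s) ≤ δ * |t - s| ^ β := by
    intro t ht
    rw [dist_eq_norm]
    rcases le_total s t with hst | hst
    · rw [abs_of_nonneg (by linarith)]; exact h.incr s t hs.1 hst ht.2
    · rw [abs_sub_comm, abs_of_nonneg (by linarith), norm_sub_rev]
      exact h.incr t s ht.1 hst hs.2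
  have hlim : Tendsto (fun t : ℝ => δ * |t - s| ^ β) (𝓝 s) (𝓝 0) := by
    have : Continuous fun t : ℝ => δ * |t - s| ^ β :=
      continuous_const.mul ((continuous_abs.comp (continuous_id.sub continuous_const)).rpow_const
        fun _ => Or.inr hβ.le)
    have h0 := this.tendsto s
    simpa [Real.zero_rpow hβ.ne'] using h0
  rw [ContinuousWithinAt, tendsto_iff_dist_tendsto_zero]
  refine squeeze_zero' (Eventually.of_forall fun _ => dist_nonneg) ?_
    (hlim.mono_left nhdsWithin_le_nhds)
  filter_upwards [self_mem_nhdsWithin] with t ht using hb t ht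

/-- The bounds of a controlled path pass to pointwise limits. -/
theorem CtrlBound.of_tendsto {a b D : ℝ} {Y : ℕ → ℝ → G} {Y' : ℕ → ℝ → V →L[ℝ] G} {Z : ℝ → G}
    {Z' : ℝ → V →L[ℝ] G} (h : ∀ᶠ n in atTop, CtrlBound X β a b D (Y n) (Y' n))
    (hZ : ∀ s, a ≤ s → s ≤ b → Tendsto (fun n => Y n s) atTop (𝓝 (Z s)))
    (hZ' : ∀ s, a ≤ s → s ≤ b → Tendsto (fun n => Y' n s) atTop (𝓝 (Z' s))) :
    CtrlBound X β a b D Z Z' := by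
  intro s t h1 h2 h3
  have ys := hZ s h1 (h2.trans h3)
  have yt := hZ t (h1.trans h2) h3
  have ys' := hZ' s h1 (h2.trans h3)
  have yt' := hZ' t (h1.trans h2) h3
  constructor
  · exact le_of_tendsto (yt'.sub ys').norm (h.mono fun n hn => (hn s t h1 h2 h3).1)
  · refine le_of_tendsto ((yt.sub ys).sub ?_).norm (h.mono fun n hn => (hn s t h1 h2 h3).2)
    exact ((ContinuousLinearMap.apply ℝ G (X t - X s)).continuous.tendsto _).comp ys'

end ControlledTools

/-! ### The Picard map -/

section Picard

variable {V : Type*} [NormedAddCommGroup V] [NormedSpace ℝ V]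
variable {W : Type*} [NormedAddCommGroup W] [NormedSpace ℝ W]

/-- The standing data of the equation on `[0, T]` with `T ≤ 1`, with explicit constants: `M` for
the semigroup, `L` for the rough path, `C` and `C₀` for the coefficients. -/
structure EquationBound (S : C0Semigroup W) (T β M L C C₀ : ℝ) (X : ℝ → V) (XX : ℝ → ℝ → TensorSq V)
    (f₀ : ℝ → W → S.Dom 1) (f : ℝ → W → V →L[ℝ] S.Dom 2) : Prop where
  time_le : T ≤ 1
  lt_exp : 1 / 3 < β
  exp_le : β ≤ 1 / 2
  one_le : 1 ≤ M
  semigroup : ∀ t, 0 ≤ t → t ≤ 1 → ‖S.op t‖ ≤ M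
  rough : RoughBound T β L X XX
  coeff : CoeffBound T (2 * β) C f
  drift_cont : ContinuousOn (fun p : ℝ × W => f₀ p.1 p.2) (Icc 0 T ×ˢ univ)
  drift_nonneg : 0 ≤ C₀
  drift_lip : ∀ t, 0 ≤ t → t ≤ T → ∀ y z, ‖f₀ t y - f₀ t z‖ ≤ C₀ * ‖y - z‖

variable {S : C0Semigroup W} {T β M L C C₀ : ℝ} {X : ℝ → V} {XX : ℝ → ℝ → TensorSq V}
variable {f₀ : ℝ → W → S.Dom 1} {f : ℝ → W → V →L[ℝ] S.Dom 2} {ξ : W}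

theorem EquationBound.mono (hd : EquationBound S T β M L C C₀ X XX f₀ f) {T' : ℝ} (hT : T' ≤ T) :
    EquationBound S T' β M L C C₀ X XX f₀ f where
  time_le := hT.trans hd.time_le
  lt_exp := hd.lt_exp
  exp_le := hd.exp_le
  one_le := hd.one_le
  semigroup := hd.semigroup
  rough := hd.rough.mono hT
  coeff := hd.coeff.mono hT
  drift_cont := hd.drift_cont.mono (prod_mono_left (Icc_subset_Icc_right hT))
  drift_nonneg := hd.drift_nonneg
  drift_lip t h0 h1 := hd.drift_lip t h0 (h1.trans hT)

theorem EquationBound.continuousOn_drift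
    (hd : EquationBound S T β M L C C₀ X XX f₀ f) {b : ℝ} (hb : b ≤ T)
    {Y : ℝ → W} (hY : ContinuousOn Y (Icc 0 b)) :
    ContinuousOn (fun s => f₀ s (Y s)) (Icc 0 b) :=
  hd.drift_cont.comp (continuousOn_id.prodMk hY) fun _ hs => ⟨⟨hs.1, hs.2.trans hb⟩, mem_univ _⟩

theorem norm_incl_comp_le (B : V →L[ℝ] S.Dom 2) : ‖(S.incl 2).comp B‖ ≤ ‖B‖ :=
  (ContinuousLinearMap.opNorm_comp_le _ _).trans
    (mul_le_of_le_one_left (norm_nonneg B) (C0Semigroup.norm_incl_le 2))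

/-- The constant in the contraction estimate for controlled paths bounded by `N`. -/
def contractConst (β M L C C₀ N : ℝ) : ℝ :=
  (L + 1) * (C * (N + 2) ^ 2 + 2 * M * C₀
    + 2 * ((4 + 8 * sewConst (3 * β)) * M ^ 3 * L * (C * (N + 2) ^ 2)))

theorem EquationBound.contractConst_nonneg
    (hd : EquationBound S T β M L C C₀ X XX f₀ f) {N : ℝ} (hN : 0 ≤ N) :
    0 ≤ contractConst β M L C C₀ N := by
  have := hd.rough.nonneg
  have := hd.coeff.nonneg
  have := hd.drift_nonneg
  have := zero_le_one.trans hd.one_le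
  have := hd.lt_exp
  have := (sewConst_pos (by linarith : 1 < 3 * β)).le
  unfold contractConst
  positivity

variable [CompleteSpace W]

/-- `(U, U')` is the image of the controlled path `(Y, Y')` on `[0, b]` under the map whose fixed
points are the mild solutions. -/
def IsPicard (S : C0Semigroup W) (X : ℝ → V) (XX : ℝ → ℝ → TensorSq V) (f₀ : ℝ → W → S.Dom 1)
    (f : ℝ → W → V →L[ℝ] S.Dom 2) (ξ : W) (b : ℝ) (Y : ℝ → W) (Y' : ℝ → V →L[ℝ] W)
    (U : ℝ → W) (U' : ℝ → V →L[ℝ] W) : Prop :=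
  ∀ t, 0 ≤ t → t ≤ b → U' t = (S.incl 2).comp (f t (Y t)) ∧ ∃ I : W,
    HasRoughIntegral X XX (kerPath (S.kernel t) fun s => f s (Y s))
      (kerDeriv (S.kernel t) (compDeriv f Y Y')) 0 t I ∧
    U t = S.op t ξ + driftConv S (fun s => f₀ s (Y s)) t + I

theorem IsPicard.mono {b b' : ℝ} (hb : b' ≤ b) {Y U : ℝ → W} {Y' U' : ℝ → V →L[ℝ] W}
    (h : IsPicard S X XX f₀ f ξ b Y Y' U U') : IsPicard S X XX f₀ f ξ b' Y Y' U U' :=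
  fun t h0 h1 => h t h0 (h1.trans hb)

/-- All images under the Picard map start at `ξ`, the rough integral over `[0, 0]` being zero. -/
theorem IsPicard.apply_zero {b : ℝ} (hb : 0 ≤ b) {Y U : ℝ → W} {Y' U' : ℝ → V →L[ℝ] W}
    (h : IsPicard S X XX f₀ f ξ b Y Y' U U') : U 0 = ξ := by
  obtain ⟨-, I, hI, e⟩ := h 0 le_rfl hb
  have hI0 : I = 0 := hI.unique le_rfl ((hasRoughIntegral_zero 0 0).congr
    (fun r h0 h1 => absurd h1 (not_lt.mpr h0)) (fun r h0 h1 => absurd h1 (not_lt.mpr h0)))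
  rw [e, hI0, driftConv, intervalIntegral.integral_same, S.op_zero]
  simp

/-- The Picard map sends controlled paths to controlled paths. -/
theorem EquationBound.exists_picard
    (hd : EquationBound S T β M L C C₀ X XX f₀ f) (hT : 0 ≤ T) {z : W}
    (hξ : S.HasGen ξ z) {N : ℝ} (hN : 0 ≤ N) {Y : ℝ → W} {Y' : ℝ → V →L[ℝ] W}
    (hY : CtrlPath X β 0 T N N Y Y') :
    ∃ (U : ℝ → W) (U' : ℝ → V →L[ℝ] W) (D : ℝ), 0 ≤ D ∧
      IsPicard S X XX f₀ f ξ T Y Y' U U' ∧ CtrlBound X β 0 T D U U' := by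
  have hβ := hd.lt_exp
  have hβ' := hd.exp_le
  have hM0 : 0 ≤ M := zero_le_one.trans hd.one_le
  obtain ⟨K, hK, hg⟩ := hd.coeff.exists_ctrlPath (by linarith) le_rfl le_rfl hd.time_le hN hY
  have hφ := hd.continuousOn_drift le_rfl (hY.continuousOn (by linarith))
  obtain ⟨B, hB⟩ := isCompact_Icc.exists_bound_of_continuousOn hφ
  obtain ⟨I, hI, hIb⟩ := exists_rough_convolution hd.one_le hd.semigroup hd.rough hβ hβ' le_rfl
    le_rfl hd.time_le hK le_rfl hg (fun r h0 h1 => absurd h1 (not_lt.mpr h0))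
  have hB0 : 0 ≤ B := (norm_nonneg _).trans (hB 0 ⟨le_rfl, hT⟩)
  set R := (4 + 8 * sewConst (3 * β)) * M ^ 3 * L * (K + (T - 0) ^ β * K) with hR
  have hR0 : 0 ≤ R := by
    have := hd.rough.nonneg
    have := (sewConst_pos (by linarith : 1 < 3 * β)).le
    have : 0 ≤ (T - 0) ^ β := Real.rpow_nonneg (by linarith) _
    positivity
  refine ⟨fun t => S.op t ξ + driftConv S (fun s => f₀ s (Y s)) t + I t,
    fun t => (S.incl 2).comp (f t (Y t)), K + (M * ‖z‖ + 2 * M * B + R), by positivity,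
    fun t h0 h1 => ⟨rfl, I t, hI t h0 h1, rfl⟩, fun s t h1 h2 h3 => ?_⟩
  have hτ : 0 ≤ t - s := sub_nonneg.mpr h2
  have ht1 := h3.trans hd.time_le
  have q0 : 0 ≤ (t - s) ^ β := Real.rpow_nonneg hτ _
  have q1 : 0 ≤ (t - s) ^ (2 * β) := Real.rpow_nonneg hτ _
  have q2 : t - s ≤ (t - s) ^ (2 * β) := le_rpow_of_le_one hτ (by linarith) (by linarith)
  constructor
  · rw [← ContinuousLinearMap.comp_sub]
    refine (norm_incl_comp_le _).trans ((hg.incr s t h1 h2 h3).trans ?_)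
    gcongr
    exact le_add_of_nonneg_right (by positivity)
  · have b1 := hξ.norm_op_sub_le hd.one_le hd.semigroup h1 h2 ht1
    have b2 := norm_driftConv_sub_le hd.one_le hd.semigroup hd.time_le hφ
      (fun r h0 h1 => hB r ⟨h0, h1⟩) h1 h2 h3
    have b3 := hIb s t h1 h2 h3
    simp only [ContinuousLinearMap.comp_apply]
    calc _ = ‖(S.op t ξ - S.op s ξ) + (driftConv S (fun s => f₀ s (Y s)) t
          - driftConv S (fun s => f₀ s (Y s)) s)
          + (I t - I s - S.incl 2 (f s (Y s) (X t - X s)))‖ := by congr 1; abel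
      _ ≤ M * ‖z‖ * (t - s) + 2 * M * B * (t - s) + R * (t - s) ^ (2 * β) :=
          (norm_add_le _ _).trans (add_le_add ((norm_add_le _ _).trans (add_le_add b1 b2)) b3)
      _ ≤ M * ‖z‖ * (t - s) ^ (2 * β) + 2 * M * B * (t - s) ^ (2 * β)
          + R * (t - s) ^ (2 * β) := by gcongr
      _ = (M * ‖z‖ + 2 * M * B + R) * (t - s) ^ (2 * β) := by ring
      _ ≤ _ := mul_le_mul_of_nonneg_right (le_add_of_nonneg_left hK) q1

/-- The difference of two images under the Picard map solves the linear problem for the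
difference of the integrands; the initial condition cancels. -/
theorem IsPicard.sub_eq (hd : EquationBound S T β M L C C₀ X XX f₀ f) {b : ℝ} (hb : b ≤ T)
    {Y Z U H : ℝ → W} {Y' Z' U' H' : ℝ → V →L[ℝ] W}
    (hYc : ContinuousOn Y (Icc 0 b)) (hZc : ContinuousOn Z (Icc 0 b))
    (hU : IsPicard S X XX f₀ f ξ b Y Y' U U') (hH : IsPicard S X XX f₀ f ξ b Z Z' H H') {t : ℝ}
    (h0 : 0 ≤ t) (ht : t ≤ b) {I : W}
    (hI : HasRoughIntegral X XX (kerPath (S.kernel t) fun s => f s (Y s) - f s (Z s))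
      (kerDeriv (S.kernel t) fun s => compDeriv f Y Y' s - compDeriv f Z Z' s) 0 t I) :
    U t - H t = driftConv S (fun s => f₀ s (Y s) - f₀ s (Z s)) t + I := by
  obtain ⟨-, I₁, hI₁, e₁⟩ := hU t h0 ht
  obtain ⟨-, I₂, hI₂, e₂⟩ := hH t h0 ht
  have hI' : I₁ - I₂ = I := by
    refine HasRoughIntegral.unique h0 ((hI₁.sub hI₂).congr (fun r _ _ => ?_) (fun r _ _ => ?_)) hI
    · exact kerPath_sub_right _ _ _ _
    · exact kerDeriv_sub_right _ _ _ _
  rw [e₁, e₂, ← hI', ← driftConv_sub hd.one_le hd.semigroup h0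
    (ht.trans (hb.trans hd.time_le))
    ((hd.continuousOn_drift hb hYc).mono (Icc_subset_Icc_right ht))
    ((hd.continuousOn_drift hb hZc).mono (Icc_subset_Icc_right ht))]
  abel

end Picard

/-! ### The contraction estimate and uniqueness of fixed points -/

section FixedPoint

variable {V : Type*} [NormedAddCommGroup V] [NormedSpace ℝ V]
variable {G : Type*} [NormedAddCommGroup G] [NormedSpace ℝ G]
variable {W : Type*} [NormedAddCommGroup W] [NormedSpace ℝ W] [CompleteSpace W]
variable {S : C0Semigroup W} {T β M L C C₀ : ℝ} {X : ℝ → V} {XX : ℝ → ℝ → TensorSq V}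
variable {f₀ : ℝ → W → S.Dom 1} {f : ℝ → W → V →L[ℝ] S.Dom 2} {ξ : W}

/-- The contraction estimate: for controlled paths that agree on `[0, a]`, the Picard map gains
the factor `(b - a)^β` on `[a, b]`. -/
theorem EquationBound.ctrlBound_picard_sub
    (hd : EquationBound S T β M L C C₀ X XX f₀ f) {N a b D : ℝ} (hN : 0 ≤ N)
    (ha : 0 ≤ a) (hab : a ≤ b) (hb : b ≤ T) (hD : 0 ≤ D) {Y Z U H : ℝ → W}
    {Y' Z' U' H' : ℝ → V →L[ℝ] W} (hY : CtrlPath X β 0 b N N Y Y') (hZ : CtrlPath X β 0 b N N Z Z')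
    (heq : ∀ s, 0 ≤ s → s ≤ a → Y s = Z s ∧ Y' s = Z' s)
    (hYZ : CtrlBound X β a b D (fun s => Y s - Z s) (fun s => Y' s - Z' s))
    (hU : IsPicard S X XX f₀ f ξ b Y Y' U U') (hH : IsPicard S X XX f₀ f ξ b Z Z' H H') :
    CtrlBound X β a b (contractConst β M L C C₀ N * (b - a) ^ β * D) (fun s => U s - H s)
      (fun s => U' s - H' s) := by
  have hβ := hd.lt_exp
  have hβ' := hd.exp_le
  have hβ0 : 0 < β := by linarith
  have hb1 := hb.trans hd.time_le
  have hM0 : 0 ≤ M := zero_le_one.trans hd.one_le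
  have hL := hd.rough.nonneg
  have hC := hd.coeff.nonneg
  have hC₀ := hd.drift_nonneg
  have hc := (sewConst_pos (by linarith : 1 < 3 * β)).le
  set ε := (b - a) ^ β with hε
  have hε0 : 0 ≤ ε := Real.rpow_nonneg (by linarith) _
  have hε1 : ε ≤ 1 := Real.rpow_le_one (by linarith) (by linarith) hβ0.le
  set c := C * (N + 2) ^ 2 with hc1
  have hc0 : 0 ≤ c := by positivity
  set K := (4 + 8 * sewConst (3 * β)) * M ^ 3 * L with hK
  have hK0 : 0 ≤ K := by positivity
  set δ := (L + 1) * (ε * D) with hδ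
  have hδ0 : 0 ≤ δ := by positivity
  have hδD : δ ≤ (L + 1) * D := by
    rw [hδ]; gcongr; exact mul_le_of_le_one_left hD hε1
  obtain ⟨e0, e0'⟩ := heq a ha le_rfl
  have hdiff : CtrlPath X β a b δ ((L + 1) * D) (fun s => Y s - Z s) (fun s => Y' s - Z' s) := by
    have := hYZ.ctrlPath_of_le hd.rough hβ0 ha hb hD le_rfl hε1 (A := 0)
      (by rw [e0, sub_self, norm_zero]) (by rw [e0', sub_self, norm_zero])
    rwa [zero_add] at this
  have hgv : ∀ r, 0 ≤ r → r ≤ a → f r (Y r) - f r (Z r) = 0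
      ∧ compDeriv f Y Y' r - compDeriv f Z Z' r = 0 := fun r h0 h1 => by
    rw [compDeriv, compDeriv, (heq r h0 h1).1, (heq r h0 h1).2]
    exact ⟨sub_self _, sub_self _⟩
  have hg : CtrlPath X β 0 b (c * δ) (c * ((L + 1) * D)) (fun s => f s (Y s) - f s (Z s))
      (fun s => compDeriv f Y Y' s - compDeriv f Z Z' s) :=
    CtrlPath.extend hβ0 (by positivity) (by positivity)
      (hd.coeff.ctrlPath_sub hβ0 ha hb hb1 hN hδ0 hδD (hY.mono ha le_rfl le_rfl le_rfl)
      (hZ.mono ha le_rfl le_rfl le_rfl) hdiff) hgv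
  obtain ⟨I, hI, hIb⟩ := exists_rough_convolution hd.one_le hd.semigroup hd.rough hβ hβ' ha hb hb1
    (by positivity) (mul_le_mul_of_nonneg_left hδD hc0) hg (fun r h0 h1 => hgv r h0 h1.le)
  have hYc := hY.continuousOn hβ0
  have hZc := hZ.continuousOn hβ0
  have hψ : ContinuousOn (fun s => f₀ s (Y s) - f₀ s (Z s)) (Icc 0 b) :=
    (hd.continuousOn_drift hb hYc).sub (hd.continuousOn_drift hb hZc)
  have hψb : ∀ r, 0 ≤ r → r ≤ b → ‖f₀ r (Y r) - f₀ r (Z r)‖ ≤ C₀ * δ := by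
    intro r h0 h1
    refine (hd.drift_lip r h0 (h1.trans hb) _ _).trans (mul_le_mul_of_nonneg_left ?_ hC₀)
    rcases le_total r a with hr | hr
    · rw [(heq r h0 hr).1, sub_self, norm_zero]; exact hδ0
    · exact hdiff.val r hr h1
  have hcc : contractConst β M L C C₀ N * ε * D
      = c * δ + 2 * M * (C₀ * δ) + K * (c * δ + ε * (c * ((L + 1) * D))) := by
    rw [contractConst, hδ, hK]; ring
  rw [hcc]
  have hdr : ∀ s, a ≤ s → s ≤ b → U' s - H' s = (S.incl 2).comp (f s (Y s) - f s (Z s)) :=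
    fun s h1 h2 => by
      rw [(hU s (ha.trans h1) h2).1, (hH s (ha.trans h1) h2).1, ContinuousLinearMap.comp_sub]
  have hU0 : ∀ s, a ≤ s → s ≤ b → U s - H s
      = driftConv S (fun s => f₀ s (Y s) - f₀ s (Z s)) s + I s := fun s h1 h2 =>
    hU.sub_eq hd hb hYc hZc hH (ha.trans h1) h2 (hI s (ha.trans h1) h2)
  intro s t h1 h2 h3
  have hτ : 0 ≤ t - s := sub_nonneg.mpr h2
  have q0 : 0 ≤ (t - s) ^ β := Real.rpow_nonneg hτ _
  have q1 : 0 ≤ (t - s) ^ (2 * β) := Real.rpow_nonneg hτ _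
  have q2 : t - s ≤ (t - s) ^ (2 * β) := le_rpow_of_le_one hτ (by linarith) (by linarith)
  have hs0 := ha.trans h1
  beta_reduce
  rw [hdr s h1 (h2.trans h3), hdr t (h1.trans h2) h3, hU0 s h1 (h2.trans h3),
    hU0 t (h1.trans h2) h3]
  constructor
  · rw [← ContinuousLinearMap.comp_sub]
    refine (norm_incl_comp_le _).trans ((hg.incr s t hs0 h2 h3).trans
      (mul_le_mul_of_nonneg_right ?_ q0))
    have : 0 ≤ 2 * M * (C₀ * δ) := by positivity
    have : 0 ≤ K * (c * δ + ε * (c * ((L + 1) * D))) := by positivity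
    linarith
  · have b2 := norm_driftConv_sub_le hd.one_le hd.semigroup hb1 hψ hψb hs0 h2 h3
    have b3 := hIb s t h1 h2 h3
    rw [ContinuousLinearMap.comp_apply]
    calc _ = ‖(driftConv S (fun s => f₀ s (Y s) - f₀ s (Z s)) t
          - driftConv S (fun s => f₀ s (Y s) - f₀ s (Z s)) s)
          + (I t - I s - S.incl 2 ((f s (Y s) - f s (Z s)) (X t - X s)))‖ := by congr 1; abel
      _ ≤ 2 * M * (C₀ * δ) * (t - s)
          + K * (c * δ + ε * (c * ((L + 1) * D))) * (t - s) ^ (2 * β) :=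
          (norm_add_le _ _).trans (add_le_add b2 b3)
      _ ≤ 2 * M * (C₀ * δ) * (t - s) ^ (2 * β)
          + K * (c * δ + ε * (c * ((L + 1) * D))) * (t - s) ^ (2 * β) := by gcongr
      _ = (0 + 2 * M * (C₀ * δ) + K * (c * δ + ε * (c * ((L + 1) * D)))) * (t - s) ^ (2 * β) := by
          ring
      _ ≤ _ := by gcongr; positivity

theorem exists_rpow_le_half {c T β : ℝ} (hc : 0 ≤ c) (hT : 0 < T) (hβ : 0 < β) :
    ∃ k, 0 < k ∧ k ≤ T ∧ c * k ^ β ≤ 1 / 2 := by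
  have h0 : 0 < (2 * (c + 1))⁻¹ := by positivity
  refine ⟨min T ((2 * (c + 1))⁻¹ ^ β⁻¹), lt_min hT (Real.rpow_pos_of_pos h0 _), min_le_left _ _, ?_⟩
  calc _ ≤ c * ((2 * (c + 1))⁻¹ ^ β⁻¹) ^ β := by
        gcongr
        exact min_le_right _ _
    _ = c * (2 * (c + 1))⁻¹ := by rw [Real.rpow_inv_rpow h0.le hβ.ne']
    _ ≤ 1 / 2 := by
        rw [← div_eq_mul_inv, div_le_div_iff₀ (by positivity) (by norm_num)]
        linarith

/-- A controlled path with zero initial data is bounded by its seminorm. -/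
theorem CtrlBound.norm_le (hX : RoughBound T β L X XX) (hβ : 0 < β) {a b D : ℝ}
    (ha : 0 ≤ a) (hbT : b ≤ T) (hb1 : b ≤ 1) (hD : 0 ≤ D)
    {Y : ℝ → G} {Y' : ℝ → V →L[ℝ] G}
    (h : CtrlBound X β a b D Y Y') (h0 : Y a = 0) (h0' : Y' a = 0) {s : ℝ} (h1 : a ≤ s)
    (h2 : s ≤ b) : ‖Y s‖ ≤ (L + 1) * D ∧ ‖Y' s‖ ≤ (L + 1) * D := by
  have := h.ctrlPath hX hβ (A := 0) ha (h1.trans h2) hbT hb1 hD (by rw [h0, norm_zero])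
    (by rw [h0', norm_zero])
  rw [zero_add] at this
  exact ⟨this.val s h1 h2, this.deriv s h1 h2⟩

/-- A controlled path with zero initial data whose seminorms are at most `D / 2 ^ n` for every `n`
vanishes. -/
theorem CtrlBound.eq_zero (hX : RoughBound T β L X XX) (hβ : 0 < β) {a b D : ℝ}
    (ha : 0 ≤ a) (hbT : b ≤ T) (hb1 : b ≤ 1) (hD : 0 ≤ D)
    {Y : ℝ → G} {Y' : ℝ → V →L[ℝ] G}
    (h : ∀ n : ℕ, CtrlBound X β a b (D * (1 / 2) ^ n) Y Y') (h0 : Y a = 0) (h0' : Y' a = 0) {s : ℝ}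
    (h1 : a ≤ s) (h2 : s ≤ b) : Y s = 0 ∧ Y' s = 0 := by
  have hlim : Tendsto (fun n : ℕ => (L + 1) * (D * (1 / 2) ^ n)) atTop (𝓝 0) := by
    have := (tendsto_pow_atTop_nhds_zero_of_lt_one (by norm_num : (0 : ℝ) ≤ 1 / 2)
      (by norm_num)).const_mul D |>.const_mul (L + 1)
    simpa using this
  have hn := fun n : ℕ => (h n).norm_le hX hβ ha hbT hb1 (by positivity) h0 h0' h1 h2
  exact ⟨norm_le_zero_iff.mp (ge_of_tendsto' hlim fun n => (hn n).1),
    norm_le_zero_iff.mp (ge_of_tendsto' hlim fun n => (hn n).2)⟩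

/-- Fixed points of the Picard map are unique. The interval is exhausted by windows of a fixed
length `k`, chosen after the common bound `N`, on which the contraction estimate has factor at most
`1 / 2`. -/
theorem EquationBound.picard_unique
    (hd : EquationBound S T β M L C C₀ X XX f₀ f) {N b : ℝ} (hN : 0 ≤ N)
    (hb0 : 0 ≤ b) (hb : b ≤ T) {Y Z : ℝ → W} {Y' Z' : ℝ → V →L[ℝ] W}
    (hY : CtrlPath X β 0 b N N Y Y') (hZ : CtrlPath X β 0 b N N Z Z')
    (hYP : IsPicard S X XX f₀ f ξ b Y Y' Y Y') (hZP : IsPicard S X XX f₀ f ξ b Z Z' Z Z') {s : ℝ}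
    (h0 : 0 ≤ s) (hs : s ≤ b) : Y s = Z s ∧ Y' s = Z' s := by
  have hβ : 0 < β := by linarith [hd.lt_exp]
  have hc := hd.contractConst_nonneg hN
  obtain ⟨k, hk, -, hck⟩ := exists_rpow_le_half hc one_pos hβ
  -- agreement propagates over one window: the seminorm of the difference is halved indefinitely
  have step : ∀ a a', 0 ≤ a → a ≤ a' → a' ≤ b → a' - a ≤ k →
      (∀ s, 0 ≤ s → s ≤ a → Y s = Z s ∧ Y' s = Z' s) →
      ∀ s, 0 ≤ s → s ≤ a' → Y s = Z s ∧ Y' s = Z' s := by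
    intro a a' ha haa hab hka heq
    have hbd : ∀ n : ℕ, CtrlBound X β a a' ((N + N) * (1 / 2) ^ n) (fun s => Y s - Z s)
        (fun s => Y' s - Z' s) := by
      intro n
      induction n with
      | zero => rw [pow_zero, mul_one]; exact (hY.ctrl.sub hZ.ctrl).mono ha hab le_rfl
      | succ n ih =>
        refine (hd.ctrlBound_picard_sub hN ha haa (hab.trans hb) (by positivity)
          (hY.mono le_rfl hab le_rfl le_rfl) (hZ.mono le_rfl hab le_rfl le_rfl) heq ih
          (hYP.mono hab) (hZP.mono hab)).mono le_rfl le_rfl ?_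
        have : contractConst β M L C C₀ N * (a' - a) ^ β ≤ 1 / 2 := by
          refine le_trans ?_ hck
          gcongr
        calc _ ≤ 1 / 2 * ((N + N) * (1 / 2) ^ n) := by gcongr
          _ = _ := by ring
    intro r hr hra
    rcases le_total r a with h | h
    · exact heq r hr h
    · obtain ⟨e0, e0'⟩ := heq a ha le_rfl
      have := CtrlBound.eq_zero hd.rough hβ ha (hab.trans hb) ((hab.trans hb).trans hd.time_le)
        (by positivity) hbd (sub_eq_zero.mpr e0) (sub_eq_zero.mpr e0') h hra
      exact ⟨sub_eq_zero.mp this.1, sub_eq_zero.mp this.2⟩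
  have key : ∀ n : ℕ, ∀ s, 0 ≤ s → s ≤ min (n * k) b → Y s = Z s ∧ Y' s = Z' s := by
    intro n
    induction n with
    | zero =>
      intro s h0 h1
      rw [Nat.cast_zero, zero_mul, min_eq_left hb0] at h1
      obtain rfl := le_antisymm h1 h0
      have e : Y 0 = Z 0 := (hYP.apply_zero hb0).trans (hZP.apply_zero hb0).symm
      exact ⟨e, by rw [(hYP 0 le_rfl hb0).1, (hZP 0 le_rfl hb0).1, e]⟩
    | succ n ih =>
      refine step (min (n * k) b) _ (le_min (by positivity) hb0) ?_ (min_le_right _ _) ?_ ih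
      · gcongr; exact n.le_succ
      · rw [Nat.cast_succ, add_mul, one_mul, sub_le_iff_le_add]
        rcases le_total (n * k) b with h | h
        · rw [min_eq_left h]; linarith [min_le_left (n * k + k) b]
        · rw [min_eq_right h]; linarith [min_le_right (n * k + k) b]
  obtain ⟨n, hn⟩ := exists_nat_ge (b / k)
  refine key n s h0 (le_min (hs.trans ?_) hs)
  rwa [div_le_iff₀ hk] at hn

end FixedPoint

/-! ### Existence of a fixed point -/

section Existence

variable {V : Type*} [NormedAddCommGroup V] [NormedSpace ℝ V]
variable {G : Type*} [NormedAddCommGroup G] [NormedSpace ℝ G]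
variable {W : Type*} [NormedAddCommGroup W] [NormedSpace ℝ W] [CompleteSpace W]
variable {S : C0Semigroup W} {T β M L C C₀ : ℝ} {X : ℝ → V} {XX : ℝ → ℝ → TensorSq V}
variable {f₀ : ℝ → W → S.Dom 1} {f : ℝ → W → V →L[ℝ] S.Dom 2} {ξ : W}

/-- The Picard iterates, started at `ξ + f(0, ξ) X_{0,t}`, so that all of them have the same value
and the same Gubinelli derivative at time `0`. -/
theorem EquationBound.exists_picard_seq
    (hd : EquationBound S T β M L C C₀ X XX f₀ f) (hT : 0 ≤ T) {z : W}
    (hξ : S.HasGen ξ z) :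
    ∃ (P : ℕ → ℝ → W) (P' : ℕ → ℝ → V →L[ℝ] W),
      (∀ n, IsPicard S X XX f₀ f ξ T (P n) (P' n) (P (n + 1)) (P' (n + 1))) ∧
      (∀ n, ∃ K, 0 ≤ K ∧ CtrlPath X β 0 T K K (P n) (P' n)) ∧
      ∀ n, P n 0 = ξ ∧ P' n 0 = (S.incl 2).comp (f 0 ξ) := by
  have hβ : 0 < β := by linarith [hd.lt_exp]
  have hL := hd.rough.nonneg
  let A := {Q : (ℝ → W) × (ℝ → V →L[ℝ] W) // (∃ K, 0 ≤ K ∧ CtrlPath X β 0 T K K Q.1 Q.2) ∧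
    Q.1 0 = ξ ∧ Q.2 0 = (S.incl 2).comp (f 0 ξ)}
  have toPath : ∀ {Q : (ℝ → W) × (ℝ → V →L[ℝ] W)} {D : ℝ}, 0 ≤ D → CtrlBound X β 0 T D Q.1 Q.2 →
      ∃ K, 0 ≤ K ∧ CtrlPath X β 0 T K K Q.1 Q.2 := fun {Q D} hD h =>
    ⟨(L + 1) * (max ‖Q.1 0‖ ‖Q.2 0‖ + D), by positivity, h.ctrlPath hd.rough hβ le_rfl hT le_rfl
      hd.time_le hD (le_max_left _ _) (le_max_right _ _)⟩
  have hnext : ∀ Q : A, ∃ R : A, IsPicard S X XX f₀ f ξ T Q.1.1 Q.1.2 R.1.1 R.1.2 := by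
    rintro ⟨Q, ⟨K, hK, hQ⟩, q, q'⟩
    obtain ⟨U, U', D, hD, hU, hUb⟩ := hd.exists_picard hT hξ hK hQ
    refine ⟨⟨(U, U'), toPath hD hUb, hU.apply_zero hT, ?_⟩, hU⟩
    change U' 0 = _
    rw [(hU 0 le_rfl hT).1, q]
  choose Φ hΦ using hnext
  let B : V →L[ℝ] W := (S.incl 2).comp (f 0 ξ)
  let Q₀ : A := ⟨(fun t => ξ + B (X t - X 0), fun _ => B), toPath le_rfl (by
    intro s t _ _ _
    simp), by simp, rfl⟩
  let R : ℕ → A := fun n => Φ^[n] Q₀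
  refine ⟨fun n => (R n).1.1, fun n => (R n).1.2, fun n => ?_, fun n => (R n).2.1,
    fun n => (R n).2.2⟩
  have e : R (n + 1) = Φ (R n) := Function.iterate_succ_apply' _ _ _
  beta_reduce
  rw [e]
  exact hΦ _

/-- Summation of the geometric bounds on successive differences. -/
theorem CtrlBound.telescope {a b D : ℝ} (hD : 0 ≤ D) {P : ℕ → ℝ → G} {P' : ℕ → ℝ → V →L[ℝ] G}
    {n m : ℕ} (h : ∀ k < n + m, CtrlBound X β a b (D * (1 / 2) ^ k)
      (fun s => P (k + 1) s - P k s) (fun s => P' (k + 1) s - P' k s)) :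
    CtrlBound X β a b (2 * D * (1 / 2) ^ n) (fun s => P (n + m) s - P n s)
      (fun s => P' (n + m) s - P' n s) := by
  suffices CtrlBound X β a b (2 * D * ((1 / 2) ^ n - (1 / 2) ^ (n + m)))
      (fun s => P (n + m) s - P n s) (fun s => P' (n + m) s - P' n s) by
    refine this.mono le_rfl le_rfl ?_
    gcongr
    exact sub_le_self _ (by positivity)
  induction m with
  | zero =>
    intro s t _ _ _
    simp
  | succ m ih =>
    have h1 := (h (n + m) (by omega)).add (ih fun k hk => h k (by omega))
    simp only [sub_add_sub_cancel] at h1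
    refine h1.mono le_rfl le_rfl (le_of_eq ?_)
    rw [← add_assoc, pow_succ]
    ring

/-- On a short interval the Picard iterates contract geometrically. The bound `N` on the iterates is
fixed in advance from the first two of them, the interval is chosen after `N`, and the bound is
preserved because the geometric series of the differences sums to `2 D`. -/
theorem EquationBound.exists_picard_contraction
    (hd : EquationBound S T β M L C C₀ X XX f₀ f) (hT : 0 < T)
    {P : ℕ → ℝ → W} {P' : ℕ → ℝ → V →L[ℝ] W}
    (hP : ∀ n, IsPicard S X XX f₀ f ξ T (P n) (P' n) (P (n + 1)) (P' (n + 1)))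
    (hK : ∀ n, ∃ K, 0 ≤ K ∧ CtrlPath X β 0 T K K (P n) (P' n))
    (h0 : ∀ n, P n 0 = ξ ∧ P' n 0 = (S.incl 2).comp (f 0 ξ)) :
    ∃ h N D, 0 < h ∧ h ≤ T ∧ 0 ≤ N ∧ 0 ≤ D ∧
      (∀ n, CtrlPath X β 0 h N N (P n) (P' n)) ∧
      ∀ n, CtrlBound X β 0 h (D * (1 / 2) ^ n) (fun s => P (n + 1) s - P n s)
        (fun s => P' (n + 1) s - P' n s) := by
  have hβ : 0 < β := by linarith [hd.lt_exp]
  have hL := hd.rough.nonneg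
  obtain ⟨K₀, hK₀, hP₀⟩ := hK 0
  obtain ⟨K₁, hK₁, hP₁⟩ := hK 1
  set D := K₁ + K₀ with hDdef
  have hD : 0 ≤ D := by positivity
  set N := (L + 1) * (0 + 2 * D) + K₀ with hNdef
  have hN : 0 ≤ N := by positivity
  obtain ⟨h, hh, hhT, hc⟩ := exists_rpow_le_half (hd.contractConst_nonneg hN) hT hβ
  have hpath : ∀ n, (∀ k < n, CtrlBound X β 0 h (D * (1 / 2) ^ k)
      (fun s => P (k + 1) s - P k s) (fun s => P' (k + 1) s - P' k s)) →
      CtrlPath X β 0 h N N (P n) (P' n) := by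
    intro n hk
    have h1 := CtrlBound.telescope (n := 0) (m := n) hD (by simpa using hk)
    rw [pow_zero, mul_one, zero_add] at h1
    have h2 := (h1.ctrlPath hd.rough hβ (A := 0) le_rfl hh.le hhT (hhT.trans hd.time_le)
      (by positivity) (by rw [(h0 n).1, (h0 0).1, sub_self, norm_zero])
      (by rw [(h0 n).2, (h0 0).2, sub_self, norm_zero])).add (hP₀.mono le_rfl hhT le_rfl le_rfl)
    simpa only [sub_add_cancel] using h2
  have hcon : ∀ n, CtrlBound X β 0 h (D * (1 / 2) ^ n) (fun s => P (n + 1) s - P n s)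
        (fun s => P' (n + 1) s - P' n s) := by
    intro n
    induction n using Nat.strong_induction_on with
    | _ n ih =>
      cases n with
      | zero =>
        rw [pow_zero, mul_one]
        exact (hP₁.ctrl.sub hP₀.ctrl).mono le_rfl hhT le_rfl
      | succ n =>
        refine (hd.ctrlBound_picard_sub hN le_rfl hh.le hhT (by positivity)
          (hpath (n + 1) ih) (hpath n fun k hk => ih k (by omega)) (fun s h1 h2 => ?_)
          (ih n n.lt_succ_self) ((hP (n + 1)).mono hhT) ((hP n).mono hhT)).mono le_rfl le_rfl ?_
        · obtain rfl := le_antisymm h2 h1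
          exact ⟨(h0 _).1.trans (h0 _).1.symm, (h0 _).2.trans (h0 _).2.symm⟩
        · rw [sub_zero]
          calc _ ≤ 1 / 2 * (D * (1 / 2) ^ n) := by gcongr
            _ = _ := by ring
  exact ⟨h, N, D, hh, hhT, hN, hD, fun n => hpath n fun k _ => hcon k, hcon⟩

theorem cauchySeq_of_dist_le_half {α : Type*} [PseudoMetricSpace α] {u : ℕ → α} {D : ℝ}
    (h : ∀ n, dist (u (n + 1)) (u n) ≤ D * (1 / 2) ^ n) : CauchySeq u :=
  cauchySeq_of_le_geometric (1 / 2) D (by norm_num) fun n => by rw [dist_comm]; exact h n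

/-- The Picard map has a fixed point on a short interval: the pointwise limit of the iterates. Its
image is the limit of the images of the iterates, by the contraction estimate. -/
theorem EquationBound.exists_fixedPoint
    (hd : EquationBound S T β M L C C₀ X XX f₀ f) (hT : 0 < T) {z : W}
    (hξ : S.HasGen ξ z) :
    ∃ h N, 0 < h ∧ h ≤ T ∧ 0 ≤ N ∧ ∃ (Y : ℝ → W) (Y' : ℝ → V →L[ℝ] W),
      CtrlPath X β 0 h N N Y Y' ∧ IsPicard S X XX f₀ f ξ h Y Y' Y Y' := by
  have hβ : 0 < β := by linarith [hd.lt_exp]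
  have hL := hd.rough.nonneg
  obtain ⟨P, P', hP, hK, h0⟩ := hd.exists_picard_seq hT.le hξ
  obtain ⟨h, N, D, hh, hhT, hN, hD, hPN, hcon⟩ := hd.exists_picard_contraction hT hP hK h0
  have hh1 := hhT.trans hd.time_le
  have hsm : ∀ n s, 0 ≤ s → s ≤ h → ‖P (n + 1) s - P n s‖ ≤ (L + 1) * D * (1 / 2) ^ n ∧
      ‖P' (n + 1) s - P' n s‖ ≤ (L + 1) * D * (1 / 2) ^ n := fun n s h1 h2 => by
    have := (hcon n).norm_le hd.rough hβ le_rfl hhT hh1 (by positivity)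
      (by rw [(h0 _).1, (h0 _).1, sub_self]) (by rw [(h0 _).2, (h0 _).2, sub_self]) h1 h2
    rwa [← mul_assoc] at this
  have hY : ∀ s, ∃ y, 0 ≤ s → s ≤ h → Tendsto (fun n => P n s) atTop (𝓝 y) := fun s => by
    by_cases hs : 0 ≤ s ∧ s ≤ h
    · have hcs : CauchySeq fun n => P n s :=
        cauchySeq_of_dist_le_half (D := (L + 1) * D) fun n => by
          rw [dist_eq_norm]; exact (hsm n s hs.1 hs.2).1
      obtain ⟨y, hy⟩ := cauchySeq_tendsto_of_complete hcs
      exact ⟨y, fun _ _ => hy⟩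
    · exact ⟨0, fun h1 h2 => absurd ⟨h1, h2⟩ hs⟩
  have hY' : ∀ s, ∃ y, 0 ≤ s → s ≤ h → Tendsto (fun n => P' n s) atTop (𝓝 y) := fun s => by
    by_cases hs : 0 ≤ s ∧ s ≤ h
    · have hcs : CauchySeq fun n => P' n s :=
        cauchySeq_of_dist_le_half (D := (L + 1) * D) fun n => by
          rw [dist_eq_norm]; exact (hsm n s hs.1 hs.2).2
      obtain ⟨y, hy⟩ := cauchySeq_tendsto_of_complete hcs
      exact ⟨y, fun _ _ => hy⟩
    · exact ⟨0, fun h1 h2 => absurd ⟨h1, h2⟩ hs⟩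
  choose Y hY using hY
  choose Y' hY' using hY'
  have hYP : ∀ n, CtrlBound X β 0 h (2 * D * (1 / 2) ^ n) (fun s => Y s - P n s)
      (fun s => Y' s - P' n s) := fun n =>
    CtrlBound.of_tendsto (Y := fun m s => P (n + m) s - P n s)
      (Y' := fun m s => P' (n + m) s - P' n s)
      (Eventually.of_forall fun m => CtrlBound.telescope hD fun k _ => hcon k)
      (fun s h1 h2 => ((tendsto_add_atTop_iff_nat n).mpr (hY s h1 h2) |>.congr
        fun m => by rw [add_comm]).sub_const _)
      (fun s h1 h2 => ((tendsto_add_atTop_iff_nat n).mpr (hY' s h1 h2) |>.congr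
        fun m => by rw [add_comm]).sub_const _)
  have hY0 : Y 0 = ξ := tendsto_nhds_unique (hY 0 le_rfl hh.le)
    (tendsto_const_nhds.congr fun n => (h0 n).1.symm)
  have hY0' : Y' 0 = (S.incl 2).comp (f 0 ξ) := tendsto_nhds_unique (hY' 0 le_rfl hh.le)
    (tendsto_const_nhds.congr fun n => (h0 n).2.symm)
  have hYN : ∃ K, 0 ≤ K ∧ CtrlPath X β 0 h K K Y Y' := by
    have h1 := ((hYP 0).ctrlPath hd.rough hβ (A := 0) le_rfl hh.le hhT hh1
      (by positivity) (by rw [hY0, (h0 0).1, sub_self, norm_zero])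
      (by rw [hY0', (h0 0).2, sub_self, norm_zero])).add (hPN 0)
    simp only [sub_add_cancel] at h1
    exact ⟨_, by positivity, h1⟩
  obtain ⟨K, hK0, hYK⟩ := hYN
  obtain ⟨U, U', -, -, hU, -⟩ := (hd.mono hhT).exists_picard hh.le hξ hK0 hYK
  set K₁ := K + N with hK₁
  have hK₁0 : 0 ≤ K₁ := by positivity
  have hYU : ∀ n : ℕ, CtrlBound X β 0 h ((D + contractConst β M L C C₀ K₁ * h ^ β * (2 * D))
      * (1 / 2) ^ n) (fun s => Y s - U s) (fun s => Y' s - U' s) := fun n => by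
    have h1 := hd.ctrlBound_picard_sub hK₁0 le_rfl hh.le hhT (by positivity)
      (hYK.mono le_rfl le_rfl (by linarith) (by linarith))
      ((hPN n).mono le_rfl le_rfl (by linarith) (by linarith)) (fun s h1 h2 => by
        obtain rfl := le_antisymm h2 h1
        exact ⟨hY0.trans (h0 n).1.symm, hY0'.trans (h0 n).2.symm⟩) (hYP n) hU ((hP n).mono hhT)
    have h2 := (hYP (n + 1)).sub h1
    simp only [sub_sub_sub_cancel_right] at h2
    refine h2.mono le_rfl le_rfl (le_of_eq ?_)
    rw [sub_zero]; ring
  have hfix : ∀ s, 0 ≤ s → s ≤ h → Y s = U s ∧ Y' s = U' s := fun s h1 h2 => by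
    have hcc := hd.contractConst_nonneg hK₁0
    have := CtrlBound.eq_zero hd.rough hβ le_rfl hhT hh1 (by positivity) hYU
      (sub_eq_zero.mpr (hY0.trans (hU.apply_zero hh.le).symm))
      (sub_eq_zero.mpr (by rw [(hU 0 le_rfl hh.le).1, hY0', hY0])) h1 h2
    exact ⟨sub_eq_zero.mp this.1, sub_eq_zero.mp this.2⟩
  refine ⟨h, K, hh, hhT, hK0, Y, Y', hYK, fun t h1 h2 => ?_⟩
  rw [(hfix t h1 h2).1, (hfix t h1 h2).2]
  obtain ⟨e, I, hI, e'⟩ := hU t h1 h2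
  rw [(hfix t h1 h2).1] at e
  exact ⟨e, I, hI, e'⟩

end Existence

/-! ### Mild solutions as fixed points -/

section Mild

variable {V : Type*} [NormedAddCommGroup V] [NormedSpace ℝ V]
variable {G : Type*} [NormedAddCommGroup G] [NormedSpace ℝ G]
variable {W : Type*} [NormedAddCommGroup W] [NormedSpace ℝ W] [CompleteSpace W]
variable {S : C0Semigroup W} {T β M L C C₀ : ℝ} {X : ℝ → V} {XX : ℝ → ℝ → TensorSq V}
variable {f₀ : ℝ → W → S.Dom 1} {f : ℝ → W → V →L[ℝ] S.Dom 2} {ξ : W}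

/-- A one-sided Hölder bound suffices for paths. -/
theorem HolderPath.of_le {G : Type*} [NormedAddCommGroup G] {T γ C : ℝ} {Y : ℝ → G}
    (h : ∀ s t, 0 ≤ s → s ≤ t → t ≤ T → ‖Y t - Y s‖ ≤ C * (t - s) ^ γ) : HolderPath T γ Y := by
  refine ⟨C, fun s hs t ht _ => ?_⟩
  rcases le_total s t with hst | hst
  · rw [abs_of_nonneg (by linarith)]; exact h s t hs.1 hst ht.2
  · rw [abs_sub_comm, abs_of_nonneg (by linarith), norm_sub_rev]; exact h t s ht.1 hst hs.2

/-- For `s > t` the remainder at `(s, t)` is expressed through the one at `(t, s)`. -/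
theorem CtrlPath.isControlled (hX : RoughBound T β L X XX) (hβ : 0 < β) {b N : ℝ} (hb : b ≤ T)
    {Y : ℝ → G} {Y' : ℝ → V →L[ℝ] G} (h : CtrlPath X β 0 b N N Y Y') :
    IsControlled b β X Y Y' := by
  have hL := hX.nonneg
  refine ⟨.of_le h.incr, .of_le fun s t h0 h1 h2 => (h.ctrl s t h0 h1 h2).1,
    N + N * L, fun s hs t ht _ => ?_⟩
  have hN : 0 ≤ N := (norm_nonneg _).trans (h.val s hs.1 hs.2)
  rcases le_total s t with hst | hst
  · rw [abs_of_nonneg (by linarith)]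
    have := Real.rpow_nonneg (sub_nonneg.mpr hst) (2 * β)
    refine (h.ctrl s t hs.1 hst ht.2).2.trans ?_
    gcongr
    exact le_add_of_nonneg_right (by positivity)
  · have hτ : 0 ≤ s - t := sub_nonneg.mpr hst
    obtain ⟨c1, c2⟩ := h.ctrl t s ht.1 hst hs.2
    have hx := hX.first t s ht.1 hst (hs.2.trans hb)
    have hββ : (s - t) ^ (2 * β) = (s - t) ^ β * (s - t) ^ β := by
      rw [← Real.rpow_add_of_nonneg hτ hβ.le hβ.le, two_mul]
    have e : Y t - Y s - Y' s (X t - X s)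
        = -(Y s - Y t - Y' t (X s - X t)) + (Y' s - Y' t) (X s - X t) := by
      simp only [map_sub, sub_apply]; abel
    beta_reduce
    rw [abs_sub_comm, abs_of_nonneg hτ, e]
    calc _ ≤ ‖Y s - Y t - Y' t (X s - X t)‖ + ‖Y' s - Y' t‖ * ‖X s - X t‖ :=
          (norm_add_le _ _).trans (add_le_add (norm_neg _).le (ContinuousLinearMap.le_opNorm _ _))
      _ ≤ N * (s - t) ^ (2 * β) + (N * (s - t) ^ β) * (L * (s - t) ^ β) := by
          have := Real.rpow_nonneg hτ β
          gcongr
      _ = _ := by rw [hββ]; ring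

/-- The values at time `0` and the seminorms bound a controlled path. -/
theorem IsControlled.exists_ctrlPath (hX : RoughBound T β L X XX) (hβ : 0 < β) {b : ℝ}
    (hb0 : 0 ≤ b) (hb : b ≤ T) (hb1 : b ≤ 1) {Y : ℝ → G} {Y' : ℝ → V →L[ℝ] G}
    (h : IsControlled b β X Y Y') : ∃ N, 0 ≤ N ∧ CtrlPath X β 0 b N N Y Y' := by
  have hL := hX.nonneg
  obtain ⟨C₁, hC₁, h1⟩ := HolderTwo.exists_bound h.holder_deriv fun s _ _ => sub_self _
  obtain ⟨C₂, hC₂, h2⟩ := HolderTwo.exists_bound h.holder_remainder fun s _ _ => by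
    simp
  have hc : CtrlBound X β 0 b (C₁ + C₂) Y Y' := fun s t a1 a2 a3 => by
    have q := Real.rpow_nonneg (sub_nonneg.mpr a2) β
    have q' := Real.rpow_nonneg (sub_nonneg.mpr a2) (2 * β)
    exact ⟨(h1 s t a1 a2 a3).trans (by gcongr; linarith),
      (h2 s t a1 a2 a3).trans (by gcongr; linarith)⟩
  exact ⟨_, by positivity, hc.ctrlPath hX hβ le_rfl hb0 hb hb1 (by positivity)
    (le_max_left ‖Y 0‖ ‖Y' 0‖) (le_max_right _ _)⟩

/-- Mild solutions are the controlled fixed points of the Picard map. -/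
theorem isMildSolution_iff {b : ℝ} {Y : ℝ → W} {Y' : ℝ → V →L[ℝ] W} :
    IsMildSolution S β X XX f₀ f ξ b Y Y' ↔
      IsControlled b β X Y Y' ∧ IsPicard S X XX f₀ f ξ b Y Y' Y Y' :=
  ⟨fun h => ⟨h.controlled, fun t h0 h1 => ⟨h.deriv_eq t ⟨h0, h1⟩, h.mild t ⟨h0, h1⟩⟩⟩,
    fun h => ⟨h.1, fun t ht => (h.2 t ht.1 ht.2).1, fun t ht => (h.2 t ht.1 ht.2).2⟩⟩

theorem exists_equationBound (hT : T ≤ 1) (hβ : β ∈ Ioc (1 / 3 : ℝ) (1 / 2))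
    (hX : RoughBound T β L X XX) (hf₀ : IsLip T f₀) (hf : CoeffBound T (2 * β) C f) :
    ∃ M C₀, EquationBound S T β M L C C₀ X XX f₀ f := by
  obtain ⟨M, hM1, hM⟩ := S.exists_norm_op_le
  obtain ⟨C₀, hC₀⟩ := hf₀.lip
  exact ⟨M, |C₀|, hT, hβ.1, hβ.2, hM1, hM, hX, hf, hf₀.cont, abs_nonneg _, fun t h0 h1 y z =>
    (hC₀ t ⟨h0, h1⟩ y z).trans (mul_le_mul_of_nonneg_right (le_abs_self _) (norm_nonneg _))⟩

theorem IsLip.mono {W E : Type*} [NormedAddCommGroup W]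
    [NormedAddCommGroup E] {T' : ℝ} {F : ℝ → W → E}
    (h : IsLip T F) (hT : T' ≤ T) : IsLip T' F :=
  ⟨h.cont.mono (prod_mono_left (Icc_subset_Icc_right hT)),
    h.lip.imp fun _ hL t ht => hL t ⟨ht.1, ht.2.trans hT⟩⟩

end Mild

end RPDE

end

theorem mainTheorem2
    {V : Type*} [NormedAddCommGroup V] [NormedSpace ℝ V] [CompleteSpace V]
    {W : Type*} [NormedAddCommGroup W] [NormedSpace ℝ W] [CompleteSpace W]
    (S : RPDE.C0Semigroup W)
    (T : ℝ) (hT : 0 < T) (β : ℝ) (hβ : β ∈ Set.Ioc (1 / 3 : ℝ) (1 / 2))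
    (X : ℝ → V) (XX : ℝ → ℝ → RPDE.TensorSq V) (hX : RPDE.IsRoughPath T β X XX)
    (f₀ : ℝ → W → S.Dom 1) (hf₀ : RPDE.IsLip T f₀)
    (f : ℝ → W → V →L[ℝ] S.Dom 2) (hf : RPDE.IsCb T (2 * β) 3 f)
    (ξ : W) (hξ : ξ ∈ S.domain 1) :
    ∃ T₀ ∈ Set.Ioc 0 T,
      ∃ (Y : ℝ → W) (Y' : ℝ → V →L[ℝ] W),
        RPDE.IsMildSolution S β X XX f₀ f ξ T₀ Y Y' ∧
        ∀ (Z : ℝ → W) (Z' : ℝ → V →L[ℝ] W),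
          RPDE.IsMildSolution S β X XX f₀ f ξ T₀ Z Z' →
            Set.EqOn Z Y (Set.Icc 0 T₀) ∧ Set.EqOn Z' Y' (Set.Icc 0 T₀) := by
  obtain ⟨z, hz⟩ : ∃ z, S.HasGen ξ z := hξ.2
  obtain ⟨L, hL⟩ := hX.exists_roughBound
  obtain ⟨C, hC⟩ := hf.exists_coeffBound
  have hβ0 : 0 < β := by linarith [hβ.1]
  -- all estimates are made on intervals of length at most one
  have hT' : min T 1 ≤ T := min_le_left _ _
  obtain ⟨M, C₀, hd⟩ := RPDE.exists_equationBound (S := S) (min_le_right T 1) hβ (hL.mono hT')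
    (hf₀.mono hT') (hC.mono hT')
  obtain ⟨h, N, hh, hhT, hN, Y, Y', hY, hYP⟩ := hd.exists_fixedPoint (lt_min hT one_pos) hz
  refine ⟨h, ⟨hh, hhT.trans hT'⟩, Y, Y',
    RPDE.isMildSolution_iff.mpr ⟨hY.isControlled hd.rough hβ0 hhT, hYP⟩, fun Z Z' hZ => ?_⟩
  obtain ⟨hZc, hZP⟩ := RPDE.isMildSolution_iff.mp hZ
  obtain ⟨K, hK, hZK⟩ := hZc.exists_ctrlPath hd.rough hβ0 hh.le hhT (hhT.trans hd.time_le)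
  have heq : ∀ s ∈ Set.Icc 0 h, Z s = Y s ∧ Z' s = Y' s := fun s hs =>
    hd.picard_unique (N := K + N) (by positivity) hh.le hhT
      (hZK.mono le_rfl le_rfl (by linarith) (by linarith))
      (hY.mono le_rfl le_rfl (by linarith) (by linarith)) hZP hYP hs.1 hs.2
  exact ⟨fun s hs => (heq s hs).1, fun s hs => (heq s hs).2⟩
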